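/- **Theorem.** Component Order Connectivity can be solved in $O(n^2)$ time on interval graphs, where $n$ is the number of vertices. Here an instance of Component Order Connectivity consists of a finite simple undirected graph $G$ and two integers $k$ and $\ell$; the question is whether there is a set $X\subseteq V(G)$ with $|X|\le k$ such that the largest connected component of $G-X$ has at most $\ell$ vertices (the largest component of the graph without vertices has order $0$). A graph is an interval graph if it is the intersection graph of a family of nonempty intervals of the real line. The time is measured on a random access machine with words: $G$, with vertex set $\{0,\dots,n-1\}$, is given by its adjacency matrix, stored in an array, and $n$, $k$, $\ell$ (with signs) are given in registers. Each constant, register or array access, addition, truncated subtraction, multiplication, comparison, assignment and branch costs one step, and all numbers that occur must fit into words of $O(\log(n+|k|+|\ell|+2))$ bits. Precisely: there are a single program and constants $c,d$ such that for all $n$, every interval graph $G$ on $n$ vertices and all integers $k,\ell$, the program halts after at most $c(n^2+1)$ steps, all numbers that occur stay below $(n+|k|+|\ell|+2)^d$, and it outputs $1$ if $(G,k,\ell)$ is a yes-instance and $0$ otherwise. No interval representation is part of the input. -/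

import Mathlib

/-! ### Interval graphs and component order connectivity -/

/-- `G` is an interval graph: the intersection graph of a family of nonempty intervals (order-connected
sets, with or without end points) of the real line. -/
def IsIntervalGraph {V : Type*} (G : SimpleGraph V) : Prop :=
  ∃ I : V → Set ℝ, (∀ v, (I v).Nonempty ∧ (I v).OrdConnected) ∧
    ∀ u v, G.Adj u v ↔ u ≠ v ∧ (I u ∩ I v).Nonempty

open Classical in
/-- The weight of a heaviest connected component of `G` (and `0` if `G` has no vertex). -/
noncomputable def heaviestComponent {V : Type*} [Fintype V] (G : SimpleGraph V) (w : V → ℕ) : ℕ :=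
  (Finset.univ : Finset G.ConnectedComponent).sup fun c =>
    ∑ v with G.connectedComponentMk v = c, w v

/-- The graph `G - X`. -/
abbrev deleteVertices {V : Type*} (G : SimpleGraph V) (X : Finset V) :
    SimpleGraph {v : V // v ∉ X} :=
  G.comap Subtype.val

open Classical in
/-- `(G, w, k, l)` is a yes-instance of Weighted Component Order Connectivity. -/
def WeightedCOC {V : Type*} [Fintype V] (G : SimpleGraph V) (w : V → ℕ) (k l : ℤ) : Prop :=
  ∃ X : Finset V, ((∑ v ∈ X, w v : ℕ) : ℤ) ≤ k ∧
    (heaviestComponent (deleteVertices G X) (fun v => w v.1) : ℤ) ≤ l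

/-- `(G, k, l)` is a yes-instance of Component Order Connectivity: every weight is `1`. -/
def COC {V : Type*} [Fintype V] (G : SimpleGraph V) (k l : ℤ) : Prop :=
  WeightedCOC G (fun _ => 1) k l

/-! ### Random access machines with a step count

Programs are structured programs over finitely many registers and finitely many arrays (those which
occur in the program text). Every constant, register access, array access, operation, assignment,
test and branch costs at least one step. The machine works with words: a run in which some number
reaches the bound `W` gets stuck. -/

namespace RAM

/-- Register `i` holds `reg i`, and cell `j` of array `a` holds `arr a j`. -/
structure State where
  reg : ℕ → ℕ
  arr : ℕ → ℕ → ℕ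

/-- Operations of the processor; `sub` is truncated at zero, and comparisons return `0` or `1`. -/
inductive Op where
  | add | sub | mul | lt | eq

def Op.eval : Op → ℕ → ℕ → ℕ
  | .add, x, y => x + y
  | .sub, x, y => x - y
  | .mul, x, y => x * y
  | .lt, x, y => if x < y then 1 else 0
  | .eq, x, y => if x = y then 1 else 0

inductive Expr where
  | const (c : ℕ)
  | reg (r : ℕ)
  | get (a : ℕ) (i : Expr)
  | op (o : Op) (x y : Expr)

namespace Expr

def eval (s : State) : Expr → ℕ
  | const c => c
  | reg r => s.reg r
  | get a i => s.arr a (i.eval s)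
  | op o x y => o.eval (x.eval s) (y.eval s)

/-- The number of steps spent on evaluating an expression: one for every node. -/
def cost : Expr → ℕ
  | const _ => 1
  | reg _ => 1
  | get _ i => i.cost + 1
  | op _ x y => x.cost + y.cost + 1

/-- All values, including intermediate ones and array indices, are words below `W`. -/
def Fits (W : ℕ) (s : State) : Expr → Prop
  | const c => c < W
  | reg r => s.reg r < W
  | get a i => i.Fits W s ∧ s.arr a (i.eval s) < W
  | op o x y => x.Fits W s ∧ y.Fits W s ∧ o.eval (x.eval s) (y.eval s) < W

end Expr

inductive Program where
  | skip
  | assign (r : ℕ) (e : Expr)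
  | store (a : ℕ) (i e : Expr)
  | seq (p q : Program)
  | ite (b : Expr) (p q : Program)
  | while (b : Expr) (p : Program)

def State.setReg (s : State) (r x : ℕ) : State :=
  { s with reg := Function.update s.reg r x }

def State.setArr (s : State) (a i x : ℕ) : State :=
  { s with arr := Function.update s.arr a (Function.update (s.arr a) i x) }

/-- `Run W p s t s'`: with words below `W`, the program `p` started in the state `s` halts after exactly
`t` steps in the state `s'`. A test succeeds if its value is not `0`. -/
inductive Run (W : ℕ) : Program → State → ℕ → State → Prop where
  | skip (s : State) : Run W .skip s 1 s
  | assign (s : State) (r : ℕ) (e : Expr) (he : e.Fits W s) :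
      Run W (.assign r e) s (e.cost + 1) (s.setReg r (e.eval s))
  | store (s : State) (a : ℕ) (i e : Expr) (hi : i.Fits W s) (he : e.Fits W s) :
      Run W (.store a i e) s (i.cost + e.cost + 1) (s.setArr a (i.eval s) (e.eval s))
  | seq {p q : Program} {s₁ s₂ s₃ : State} {t u : ℕ}
      (hp : Run W p s₁ t s₂) (hq : Run W q s₂ u s₃) : Run W (.seq p q) s₁ (t + u) s₃
  | iteTrue {b : Expr} {p q : Program} {s s₁ : State} {t : ℕ} (hb : b.Fits W s)
      (h : b.eval s ≠ 0) (hp : Run W p s t s₁) : Run W (.ite b p q) s (b.cost + 1 + t) s₁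
  | iteFalse {b : Expr} {p q : Program} {s s₁ : State} {t : ℕ} (hb : b.Fits W s)
      (h : b.eval s = 0) (hq : Run W q s t s₁) : Run W (.ite b p q) s (b.cost + 1 + t) s₁
  | whileFalse {b : Expr} {p : Program} {s : State} (hb : b.Fits W s)
      (h : b.eval s = 0) : Run W (.while b p) s (b.cost + 1) s
  | whileTrue {b : Expr} {p : Program} {s s₁ s₂ : State} {t u : ℕ} (hb : b.Fits W s)
      (h : b.eval s ≠ 0) (hp : Run W p s t s₁) (hw : Run W (.while b p) s₁ u s₂) :
      Run W (.while b p) s (b.cost + 1 + t + u) s₂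

/-- The machine is deterministic: final state and number of steps are determined by the program and
the initial state, whatever the word bound. -/
theorem Run.unique {W W' : ℕ} {p : Program} {s s₁ s₂ : State} {t u : ℕ}
    (h₁ : Run W p s t s₁) (h₂ : Run W' p s u s₂) : t = u ∧ s₁ = s₂ := by
  induction h₁ generalizing u s₂ with
  | skip | assign | store => cases h₂; exact ⟨rfl, rfl⟩
  | seq _ _ ihp ihq =>
    cases h₂ with
    | seq hp hq =>
      obtain ⟨rfl, rfl⟩ := ihp hp
      obtain ⟨rfl, rfl⟩ := ihq hq
      exact ⟨rfl, rfl⟩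
  | iteTrue _ h _ ih =>
    cases h₂ with
    | iteTrue _ _ hp => obtain ⟨rfl, rfl⟩ := ih hp; exact ⟨rfl, rfl⟩
    | iteFalse _ h' _ => exact absurd h' h
  | iteFalse _ h _ ih =>
    cases h₂ with
    | iteTrue _ h' _ => exact absurd h h'
    | iteFalse _ _ hp => obtain ⟨rfl, rfl⟩ := ih hp; exact ⟨rfl, rfl⟩
  | whileFalse _ h =>
    cases h₂ with
    | whileFalse => exact ⟨rfl, rfl⟩
    | whileTrue _ h' => exact absurd h h'
  | whileTrue _ h _ _ ihp ihw =>
    cases h₂ with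
    | whileFalse _ h' => exact absurd h' h
    | whileTrue _ _ hp hw =>
      obtain ⟨rfl, rfl⟩ := ihp hp
      obtain ⟨rfl, rfl⟩ := ihw hw
      exact ⟨rfl, rfl⟩

end RAM

open Classical in
/-- The initial state for an instance `(G, k, l)` with `n` vertices: register `0` holds `n`, registers
`1`, `2` hold the absolute values of `k`, `l`, registers `3`, `4` hold `1` if `k`, `l` respectively is
negative, and cell `u * n + v` of array `0` holds the entry `(u, v)` of the adjacency matrix.
Everything else is `0`. -/
noncomputable def instanceState {n : ℕ} (G : SimpleGraph (Fin n)) (k l : ℤ) : RAM.State where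
  reg := fun r =>
    if r = 0 then n
    else if r = 1 then k.natAbs
    else if r = 2 then l.natAbs
    else if r = 3 then (if k < 0 then 1 else 0)
    else if r = 4 then (if l < 0 then 1 else 0)
    else 0
  arr := fun a i =>
    if a = 0 ∧ ∃ u v : Fin n, i = u * n + v ∧ G.Adj u v then 1 else 0

/-! An interval graph is the incomparability graph of the relation "entirely to the left of". Of
this relation only irreflexivity and the exchange law of `IntervalModel` are ever used.

Suppose the vertices are ordered by left end points (`LeftOrder`). After a deletion the components
of the rest occupy disjoint stretches of positions. If one component starts at position `p` and the
next one at `q`, the vertices of the former have positions at least `p` and all their neighbours lie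
before `q`. Conversely, any `l` vertices of this kind may be kept, whether connected or not. So the
largest number of vertices that can be kept before `q` is the maximum over `p < q` of `keep p + min
(innerCount p q) l`, up to truncation at `n`. The two inequalities are `card_le_keep` and
`exists_labels_of_keep`.

No representation is given, so a left order has to be found. The maximal cliques of an interval
graph can be arranged such that those through any vertex are consecutive (`exists_consecutive`,
after Gilmore and Hoffman), and sorting the vertices by their first clique gives a left order
(`leftOrder_of_consecutive`). The maximal cliques come from a maximum cardinality search: on
interval graphs its reverse is a perfect elimination ordering (`earlier_adj`), so every maximal
clique is some vertex with its earlier neighbours, and the latest earlier neighbours define a clique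
tree (`constant_of_tree`).

The arrangement is found by refining an ordered partition of the cliques. A vertex whose cliques
meet several classes is a pivot: the outermost of these classes are split so that its cliques move
together. When no pivot is left, one clique is split off from its class. This is safe if that clique
is an end of some arrangement of the class. Two passes settle this: whatever the choices of the
first pass, in every autonomous set the clique it puts last is such an end (`isEnd_of_refine`), and
a second pass that prefers those cliques stays consistent with some arrangement
(`consistent_of_refine`).

A pass has at most `3 n` refinement steps, since each uses up a pivot, a tree edge or a clique, and
each step is a bounded number of scans. Hence the whole program consists of loops `for i < n` nested
at most twice, and `Cmd.exists_run` bounds time and word size. -/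

namespace RAM

/-! ### A structured language with counted loops -/

namespace Expr

/-- With all registers and cells at most `m`, the value of a linear expression is at most
`slope * m + offset`. -/
def slope : Expr → ℕ
  | const _ => 0
  | reg _ => 1
  | get _ _ => 1
  | op .add x y => x.slope + y.slope
  | op .sub x _ => x.slope
  | op _ _ _ => 0

def offset : Expr → ℕ
  | const c => c
  | reg _ => 0
  | get _ _ => 0
  | op .add x y => x.offset + y.offset
  | op .sub x _ => x.offset
  | op .mul x y => x.offset * y.offset
  | op _ _ _ => 1

/-- Products are only formed of bounded factors (except inside of array indices). -/
def linear : Expr → Bool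
  | const _ => true
  | reg _ => true
  | get _ _ => true
  | op .add x y => x.linear && y.linear
  | op .sub x _ => x.linear
  | op .mul x y => x.linear && y.linear && x.slope == 0 && y.slope == 0
  | op _ _ _ => true

/-- All intermediate values of an expression are below `(m + 2) ^ width`. -/
def width : Expr → ℕ
  | const c => c + 1
  | reg _ => 1
  | get _ i => i.width + 1
  | op _ x y => x.width + y.width + 1

end Expr

/-- All registers and cells are at most `m`. -/
def State.Bounded (s : State) (m : ℕ) : Prop :=
  (∀ r, s.reg r ≤ m) ∧ ∀ a i, s.arr a i ≤ m

theorem State.Bounded.mono {s : State} {m m' : ℕ} (h : s.Bounded m) (hm : m ≤ m') : s.Bounded m' :=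
  ⟨fun r => (h.1 r).trans hm, fun a i => (h.2 a i).trans hm⟩

theorem State.Bounded.setReg {s : State} {m r x : ℕ} (h : s.Bounded m) (hx : x ≤ m) :
    (s.setReg r x).Bounded m := by
  refine ⟨fun q => ?_, h.2⟩
  by_cases hq : q = r
  · subst hq; simpa [State.setReg] using hx
  · simpa [State.setReg, hq] using h.1 q

theorem State.Bounded.setArr {s : State} {m a i x : ℕ} (h : s.Bounded m) (hx : x ≤ m) :
    (s.setArr a i x).Bounded m := by
  refine ⟨h.1, fun b j => ?_⟩
  by_cases hb : b = a
  · subst hb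
    by_cases hj : j = i
    · subst hj; simpa [State.setArr] using hx
    · simpa [State.setArr, hj] using h.2 b j
  · simpa [State.setArr, hb] using h.2 b j

theorem Expr.eval_le_of_linear {s : State} {m : ℕ} (hs : s.Bounded m) (e : Expr)
    (he : e.linear = true) : e.eval s ≤ e.slope * m + e.offset := by
  induction e with
  | const c => simp [eval, offset, slope]
  | reg r => simpa [eval, offset, slope] using hs.1 r
  | get a i => simpa [eval, offset, slope] using hs.2 a _
  | op o x y ihx ihy =>
    cases o with
    | add =>
      simp only [linear, Bool.and_eq_true] at he
      simp only [eval, Op.eval, slope, offset]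
      have := ihx he.1
      have := ihy he.2
      nlinarith
    | sub =>
      simp only [linear] at he
      simp only [eval, Op.eval, slope, offset]
      have := ihx he
      omega
    | mul =>
      simp only [linear, Bool.and_eq_true, beq_iff_eq] at he
      simp only [eval, Op.eval, slope, offset]
      have hx := ihx he.1.1.1
      have hy := ihy he.1.1.2
      rw [he.1.2] at hx
      rw [he.2] at hy
      simp only [Nat.zero_mul, Nat.zero_add] at hx hy ⊢
      exact Nat.mul_le_mul hx hy
    | lt =>
      simp only [eval, Op.eval, slope, offset]
      split <;> omega
    | eq =>
      simp only [eval, Op.eval, slope, offset]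
      split <;> omega

/-- Stored values grow only additively, but intermediate values may be products, such as the matrix
index `u * n + v`. A bound by a fixed power of the largest stored number covers them. -/
theorem Expr.eval_lt_pow_width {s : State} {m : ℕ} (hs : s.Bounded m) (e : Expr) :
    e.eval s < (m + 2) ^ e.width := by
  induction e with
  | const c =>
    calc c < 2 ^ c := Nat.lt_two_pow_self
      _ ≤ (m + 2) ^ c := Nat.pow_le_pow_left (by omega) c
      _ ≤ (m + 2) ^ (c + 1) := Nat.pow_le_pow_right (by omega) (by omega)
  | reg r => have := hs.1 r; simp only [eval, width, pow_one]; omega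
  | get a i ih =>
    have := hs.2 a (i.eval s)
    calc s.arr a (i.eval s) < (m + 2) ^ 1 := by rw [pow_one]; omega
      _ ≤ _ := Nat.pow_le_pow_right (by omega) (by simp [width])
  | op o x y ihx ihy =>
    have hx : 1 ≤ (m + 2) ^ x.width := Nat.one_le_pow _ _ (by omega)
    have hy : 1 ≤ (m + 2) ^ y.width := Nat.one_le_pow _ _ (by omega)
    -- The factor `2` is at most `m + 2`, which accounts for the extra `1` in the width of an
    -- operation.
    have key : o.eval (x.eval s) (y.eval s) < 2 * ((m + 2) ^ x.width * (m + 2) ^ y.width) := by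
      cases o <;> simp only [Op.eval]
      · nlinarith
      · have : (m + 2) ^ x.width ≤ (m + 2) ^ x.width * (m + 2) ^ y.width :=
          Nat.le_mul_of_pos_right _ hy
        omega
      · have : x.eval s * y.eval s ≤ (m + 2) ^ x.width * (m + 2) ^ y.width :=
          Nat.mul_le_mul ihx.le ihy.le
        nlinarith
      · split <;> nlinarith
      · split <;> nlinarith
    calc _ < 2 * ((m + 2) ^ x.width * (m + 2) ^ y.width) := key
      _ ≤ (m + 2) * ((m + 2) ^ x.width * (m + 2) ^ y.width) := Nat.mul_le_mul_right _ (by omega)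
      _ = (m + 2) ^ (op o x y).width := by simp only [width]; ring

theorem Expr.fits_of_width_le {s : State} {m h : ℕ} (hs : s.Bounded m) (e : Expr)
    (he : e.width ≤ h) : e.Fits ((m + 2) ^ h) s := by
  have key : e.eval s < (m + 2) ^ h :=
    (e.eval_lt_pow_width hs).trans_le (Nat.pow_le_pow_right (by omega) he)
  induction e with
  | const c => exact key
  | reg r => exact key
  | get a i ih =>
    simp only [width] at he
    refine ⟨ih (by omega) ?_, key⟩
    exact (i.eval_lt_pow_width hs).trans_le (Nat.pow_le_pow_right (by omega) (by omega))
  | op o x y ihx ihy =>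
    simp only [width] at he
    refine ⟨ihx (by omega) ?_, ihy (by omega) ?_, key⟩
    · exact (x.eval_lt_pow_width hs).trans_le (Nat.pow_le_pow_right (by omega) (by omega))
    · exact (y.eval_lt_pow_width hs).trans_le (Nat.pow_le_pow_right (by omega) (by omega))

theorem Expr.Fits.mono {W W' : ℕ} {s : State} (hW : W ≤ W') {e : Expr} (h : e.Fits W s) :
    e.Fits W' s := by
  induction e with
  | const c => exact lt_of_lt_of_le h hW
  | reg r => exact lt_of_lt_of_le h hW
  | get a i ih => exact ⟨ih h.1, lt_of_lt_of_le h.2 hW⟩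
  | op o x y ihx ihy => exact ⟨ihx h.1, ihy h.2.1, lt_of_lt_of_le h.2.2 hW⟩

/-- Programs whose loops are all of the form `for i = 0, …, (register 0) - 1`. -/
inductive Cmd where
  | skip
  | assign (r : ℕ) (e : Expr)
  | store (a : ℕ) (i e : Expr)
  | seq (p q : Cmd)
  | ite (b : Expr) (p q : Cmd)
  | loop (i : ℕ) (p : Cmd)

namespace Cmd

def toProgram : Cmd → Program
  | skip => .skip
  | assign r e => .assign r e
  | store a i e => .store a i e
  | seq p q => .seq p.toProgram q.toProgram
  | ite b p q => .ite b p.toProgram q.toProgram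
  | loop i p => .seq (.assign i (.const 0)) (.while (.op .lt (.reg i) (.reg 0))
      (.seq p.toProgram (.assign i (.op .add (.reg i) (.const 1)))))

/-- The state after `j` rounds of a loop with the counter `i` and the body `f`. -/
def rounds (f : State → State) (i : ℕ) (s : State) : ℕ → State
  | 0 => s.setReg i 0
  | j + 1 => (f (rounds f i s j)).setReg i (j + 1)

def exec : Cmd → State → State
  | skip, s => s
  | assign r e, s => s.setReg r (e.eval s)
  | store a i e, s => s.setArr a (i.eval s) (e.eval s)
  | seq p q, s => q.exec (p.exec s)
  | ite b p q, s => if b.eval s ≠ 0 then p.exec s else q.exec s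
  | loop i p, s => rounds p.exec i s (s.reg 0)

def writtenRegs : Cmd → List ℕ
  | skip => []
  | assign r _ => [r]
  | store _ _ _ => []
  | seq p q => p.writtenRegs ++ q.writtenRegs
  | ite _ p q => p.writtenRegs ++ q.writtenRegs
  | loop i p => i :: p.writtenRegs

def writtenArrs : Cmd → List ℕ
  | skip => []
  | assign _ _ => []
  | store a _ _ => [a]
  | seq p q => p.writtenArrs ++ q.writtenArrs
  | ite _ p q => p.writtenArrs ++ q.writtenArrs
  | loop _ p => p.writtenArrs

/-- Values grow linearly, and loop counters and the loop bound are not changed. -/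
def wellFormed : Cmd → Bool
  | skip => true
  | assign r e => e.linear && decide (e.slope ≤ 1) && r != 0
  | store _ _ e => e.linear && decide (e.slope ≤ 1)
  | seq p q => p.wellFormed && q.wellFormed
  | ite _ p q => p.wellFormed && q.wellFormed
  | loop i p => p.wellFormed && i != 0 && !(p.writtenRegs.contains i)

def depth : Cmd → ℕ
  | skip => 0
  | assign _ _ => 0
  | store _ _ _ => 0
  | seq p q => max p.depth q.depth
  | ite _ p q => max p.depth q.depth
  | loop _ p => p.depth + 1

/-- A bound on the number of steps if register `0` holds `n`. -/
def time (n : ℕ) : Cmd → ℕ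
  | skip => 1
  | assign _ e => e.cost + 1
  | store _ i e => i.cost + e.cost + 1
  | seq p q => p.time n + q.time n
  | ite b p q => b.cost + 1 + (p.time n + q.time n)
  | loop _ p => 6 + n * (p.time n + 8)

/-- A bound on the growth of the largest number if register `0` holds `n`. -/
def growth (n : ℕ) : Cmd → ℕ
  | skip => 0
  | assign _ e => e.offset
  | store _ _ e => e.offset
  | seq p q => p.growth n + q.growth n
  | ite _ p q => p.growth n + q.growth n
  | loop _ p => n * p.growth n

def width : Cmd → ℕ
  | skip => 0
  | assign _ e => e.width
  | store _ i e => i.width + e.width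
  | seq p q => p.width + q.width
  | ite b p q => b.width + (p.width + q.width)
  | loop _ p => p.width + 5

theorem exec_reg_of_notMem (p : Cmd) (s : State) {r : ℕ} (h : r ∉ p.writtenRegs) :
    (p.exec s).reg r = s.reg r := by
  induction p generalizing s with
  | skip => rfl
  | assign q e =>
    simp only [writtenRegs, List.mem_singleton] at h
    simp [exec, State.setReg, h]
  | store a i e => rfl
  | seq p q ihp ihq =>
    simp only [writtenRegs, List.mem_append, not_or] at h
    simp only [exec]
    rw [ihq _ h.2, ihp _ h.1]
  | ite b p q ihp ihq =>
    simp only [writtenRegs, List.mem_append, not_or] at h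
    simp only [exec]
    split
    · exact ihp _ h.1
    · exact ihq _ h.2
  | loop i p ih =>
    simp only [writtenRegs, List.mem_cons, not_or] at h
    simp only [exec]
    generalize s.reg 0 = n
    induction n with
    | zero => simp [rounds, State.setReg, h.1]
    | succ n ihn => simpa [rounds, State.setReg, h.1, ih _ h.2] using ihn

theorem exec_arr_of_notMem (p : Cmd) (s : State) {a : ℕ} (h : a ∉ p.writtenArrs) :
    (p.exec s).arr a = s.arr a := by
  induction p generalizing s with
  | skip => rfl
  | assign q e => rfl
  | store b i e =>
    simp only [writtenArrs, List.mem_singleton] at h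
    simp [exec, State.setArr, h]
  | seq p q ihp ihq =>
    simp only [writtenArrs, List.mem_append, not_or] at h
    simp only [exec]
    rw [ihq _ h.2, ihp _ h.1]
  | ite b p q ihp ihq =>
    simp only [writtenArrs, List.mem_append, not_or] at h
    simp only [exec]
    split
    · exact ihp _ h.1
    · exact ihq _ h.2
  | loop i p ih =>
    simp only [writtenArrs] at h
    simp only [exec]
    generalize s.reg 0 = n
    induction n with
    | zero => rfl
    | succ n ihn => simpa [rounds, State.setReg, ih _ h] using ihn

theorem wellFormed.zero_notMem {p : Cmd} (h : p.wellFormed = true) : 0 ∉ p.writtenRegs := by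
  induction p with
  | skip => simp [writtenRegs]
  | assign r e =>
    simp only [wellFormed, Bool.and_eq_true, bne_iff_ne] at h
    simpa [writtenRegs] using h.2.symm
  | store a i e => simp [writtenRegs]
  | seq p q ihp ihq =>
    simp only [wellFormed, Bool.and_eq_true] at h
    simp [writtenRegs, ihp h.1, ihq h.2]
  | ite b p q ihp ihq =>
    simp only [wellFormed, Bool.and_eq_true] at h
    simp [writtenRegs, ihp h.1, ihq h.2]
  | loop i p ih =>
    simp only [wellFormed, Bool.and_eq_true, bne_iff_ne] at h
    simp [writtenRegs, ih h.1.1, h.1.2.symm]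

/-- Loop induction. -/
theorem exec_loop {I : ℕ → State → Prop} {i : ℕ} {p : Cmd} {s : State}
    (hp : (loop i p).wellFormed = true) (h0 : I 0 (s.setReg i 0))
    (hstep : ∀ j s', j < s.reg 0 → s'.reg i = j → s'.reg 0 = s.reg 0 → I j s' →
      I (j + 1) ((p.exec s').setReg i (j + 1))) :
    I (s.reg 0) ((loop i p).exec s) := by
  have hz := wellFormed.zero_notMem hp
  simp only [writtenRegs, List.mem_cons, not_or] at hz
  simp only [wellFormed, Bool.and_eq_true, bne_iff_ne] at hp
  have key : ∀ j ≤ s.reg 0, I j (rounds p.exec i s j) ∧ (rounds p.exec i s j).reg i = j ∧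
      (rounds p.exec i s j).reg 0 = s.reg 0 := by
    intro j
    induction j with
    | zero => exact fun _ => ⟨h0, by simp [rounds, State.setReg], by simp [rounds, State.setReg, hz.1]⟩
    | succ j ih =>
      intro hj
      obtain ⟨h1, h2, h3⟩ := ih (by omega)
      refine ⟨hstep j _ (by omega) h2 h3 h1, by simp [rounds, State.setReg], ?_⟩
      simp [rounds, State.setReg, hz.1, exec_reg_of_notMem _ _ hz.2, h3]
  exact (key _ le_rfl).1

/-- The induction is on the number `k` of remaining rounds, while the bound `m` on the numbers rises
by `g` in each of them. The counter does not contribute to the growth: it never exceeds `n`, which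
is itself stored in register `0`. -/
theorem run_while {W n i : ℕ} {p : Cmd} (hi : i ∉ p.writtenRegs) (hi0 : i ≠ 0)
    (h0 : 0 ∉ p.writtenRegs) {T g : ℕ}
    (ih : ∀ s m, s.reg 0 = n → s.Bounded m → (m + g + 2) ^ p.width ≤ W →
      ∃ t ≤ T, Run W p.toProgram s t (p.exec s) ∧ (p.exec s).Bounded (m + g))
    (s₀ : State) (k : ℕ) : ∀ j s m, j + k = n → s = rounds p.exec i s₀ j → s.reg 0 = n →
      s.reg i = j → s.Bounded m → (m + k * g + 2) ^ (p.width + 5) ≤ W →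
      ∃ t ≤ 4 + k * (T + 8), Run W (.while (.op .lt (.reg i) (.reg 0))
      (.seq p.toProgram (.assign i (.op .add (.reg i) (.const 1))))) s t
        (rounds p.exec i s₀ n) ∧ (rounds p.exec i s₀ n).Bounded (m + k * g) := by
  induction k with
  | zero =>
    intro j s m hj hs hs0 hsi hb hW
    simp only [Nat.add_zero] at hj
    subst hj
    refine ⟨4, by omega, ?_, ?_⟩
    · rw [← hs]
      refine Run.whileFalse (b := .op .lt (.reg i) (.reg 0)) ?_ ?_
      · exact ((Expr.op .lt (.reg i) (.reg 0)).fits_of_width_le hb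
          (h := p.width + 5) (by simp [Expr.width])).mono (by simpa using hW)
      · simp [Expr.eval, Op.eval, hsi, hs0]
    · rw [← hs]; exact hb.mono (by omega)
  | succ k ihk =>
    intro j s m hj hs hs0 hsi hb hW
    have hm : m + g + k * g = m + (k + 1) * g := by ring
    have hkg : g ≤ (k + 1) * g := by nlinarith
    have hW1 : ∀ w ≤ p.width + 5, ∀ m' ≤ m + (k + 1) * g, (m' + 2) ^ w ≤ W := fun w hw m' hm' =>
      ((Nat.pow_le_pow_right (by omega) hw).trans (Nat.pow_le_pow_left (by omega) _)).trans hW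
    obtain ⟨t, ht, hr, hb'⟩ := ih s m hs0 hb (hW1 _ (by omega) _ (by omega))
    have hpi : (p.exec s).reg i = j := by rw [exec_reg_of_notMem _ _ hi, hsi]
    have hp0 : (p.exec s).reg 0 = n := by rw [exec_reg_of_notMem _ _ h0, hs0]
    have hn : n ≤ m := hs0 ▸ hb.1 0
    obtain ⟨u, hu, hru, hbu⟩ := ihk (j + 1) ((p.exec s).setReg i (j + 1)) (m + g) (by omega)
      (by rw [hs]; rfl) (by simp [State.setReg, hp0, hi0.symm]) (by simp [State.setReg])
      (hb'.setReg (by omega)) (hW1 _ le_rfl _ hm.le)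
    -- The loop test takes `4` steps, and so does incrementing the counter.
    refine ⟨4 + (t + 4) + u, ?_, ?_, hm ▸ hbu⟩
    · have : (k + 1) * (T + 8) = k * (T + 8) + (T + 8) := by ring
      omega
    · refine Run.whileTrue (b := .op .lt (.reg i) (.reg 0)) (s₁ := (p.exec s).setReg i (j + 1))
        ?_ ?_ (Run.seq hr ?_) hru
      · exact ((Expr.op .lt (.reg i) (.reg 0)).fits_of_width_le hb
          (h := p.width + 5) (by simp [Expr.width])).mono (hW1 _ le_rfl _ (by omega))
      · simp [Expr.eval, Op.eval, hsi, hs0]; omega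
      · have := Run.assign (W := W) (p.exec s) i (.op .add (.reg i) (.const 1))
          (((Expr.op .add (.reg i) (.const 1)).fits_of_width_le hb'
          (h := p.width + 5) (by simp [Expr.width])).mono (hW1 _ le_rfl _ (by omega)))
        simpa [Expr.eval, Op.eval, hpi, Expr.cost] using this

/-- An assigned expression has slope at most one, so it raises the largest stored number by at most
its offset. Growth therefore adds up along the run, and words above the `width`-th power of the
final bound suffice throughout. -/
theorem run (p : Cmd) (hp : p.wellFormed = true) (W n : ℕ) : ∀ (s : State) (m : ℕ),
    s.reg 0 = n → s.Bounded m → (m + p.growth n + 2) ^ p.width ≤ W →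
    ∃ t ≤ p.time n, Run W p.toProgram s t (p.exec s) ∧ (p.exec s).Bounded (m + p.growth n) := by
  induction p with
  | skip =>
    intro s m _ hb _
    exact ⟨1, le_rfl, Run.skip s, hb⟩
  | assign r e =>
    intro s m hn hb hW
    simp only [wellFormed, Bool.and_eq_true, decide_eq_true_eq] at hp
    refine ⟨_, le_rfl, Run.assign s r e ((e.fits_of_width_le hb le_rfl).mono
      ((Nat.pow_le_pow_left (by omega) _).trans hW)), ?_⟩
    refine (hb.mono (Nat.le_add_right _ _)).setReg ?_
    have := e.eval_le_of_linear hb hp.1.1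
    simp only [growth]
    nlinarith [hp.1.2]
  | store a i e =>
    intro s m hn hb hW
    simp only [wellFormed, Bool.and_eq_true, decide_eq_true_eq] at hp
    simp only [width] at hW
    refine ⟨_, le_rfl, Run.store s a i e
      ((i.fits_of_width_le hb (h := i.width + e.width) (by omega)).mono
      ((Nat.pow_le_pow_left (by omega) _).trans hW))
      ((e.fits_of_width_le hb (h := i.width + e.width) (by omega)).mono
      ((Nat.pow_le_pow_left (by omega) _).trans hW)), ?_⟩
    refine (hb.mono (Nat.le_add_right _ _)).setArr ?_
    have := e.eval_le_of_linear hb hp.1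
    simp only [growth]
    nlinarith [hp.2]
  | seq p q ihp ihq =>
    intro s m hn hb hW
    simp only [wellFormed, Bool.and_eq_true] at hp
    simp only [width, growth] at hW
    obtain ⟨t, ht, hr, hb1⟩ := ihp hp.1 s m hn hb (((Nat.pow_le_pow_left (by omega) _).trans
      (Nat.pow_le_pow_right (by omega) (by omega))).trans hW)
    obtain ⟨u, hu, hq, hb2⟩ := ihq hp.2 (p.exec s) _
      (by rw [exec_reg_of_notMem _ _ (wellFormed.zero_notMem hp.1), hn]) hb1
      (((Nat.pow_le_pow_left (by omega) _).trans
      (Nat.pow_le_pow_right (by omega) (by omega))).trans hW)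
    exact ⟨t + u, by simp only [time]; omega, Run.seq hr hq, hb2.mono (by simp only [growth]; omega)⟩
  | ite b p q ihp ihq =>
    intro s m hn hb hW
    simp only [wellFormed, Bool.and_eq_true] at hp
    simp only [width, growth] at hW
    have hfit := (b.fits_of_width_le hb (h := b.width + (p.width + q.width)) (by omega)).mono
      ((Nat.pow_le_pow_left (by omega) _).trans hW)
    by_cases h : b.eval s = 0
    · obtain ⟨t, ht, hr, hb1⟩ := ihq hp.2 s m hn hb (((Nat.pow_le_pow_left (by omega) _).trans
        (Nat.pow_le_pow_right (by omega) (by omega))).trans hW)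
      refine ⟨b.cost + 1 + t, by simp only [time]; omega, ?_, ?_⟩
      · simpa [exec, h, toProgram] using Run.iteFalse hfit h hr
      · simpa [exec, h] using hb1.mono (by simp only [growth]; omega)
    · obtain ⟨t, ht, hr, hb1⟩ := ihp hp.1 s m hn hb (((Nat.pow_le_pow_left (by omega) _).trans
        (Nat.pow_le_pow_right (by omega) (by omega))).trans hW)
      refine ⟨b.cost + 1 + t, by simp only [time]; omega, ?_, ?_⟩
      · simpa [exec, h, toProgram] using Run.iteTrue hfit h hr
      · simpa [exec, h] using hb1.mono (by simp only [growth]; omega)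
  | loop i p ih =>
    intro s m hn hb hW
    have hz := wellFormed.zero_notMem hp
    simp only [writtenRegs, List.mem_cons, not_or] at hz
    simp only [wellFormed, Bool.and_eq_true, bne_iff_ne, Bool.not_eq_true',
      List.contains_eq_mem, decide_eq_false_iff_not] at hp
    simp only [width, growth] at hW
    obtain ⟨t, ht, hr, hb1⟩ := run_while (W := W) (n := n) (T := p.time n) (g := p.growth n)
      hp.2 hp.1.2 hz.2 (fun s m h1 h2 h3 => ih hp.1.1 s m h1 h2 h3) s n 0 (s.setReg i 0) m
      (by omega) rfl (by simpa [State.setReg, hz.1] using hn) (by simp [State.setReg])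
      (hb.setReg (Nat.zero_le _)) hW
    refine ⟨2 + t, by simp only [time]; omega, ?_, ?_⟩
    · simp only [exec, hn]
      refine Run.seq ?_ hr
      refine Run.assign (W := W) s i (.const 0) ?_
      exact lt_of_lt_of_le (by positivity) hW
    · simp only [exec, hn]; exact hb1

theorem exists_time_le (p : Cmd) : ∃ c, ∀ n, p.time n ≤ c * (n + 1) ^ p.depth := by
  induction p with
  | skip => exact ⟨1, fun n => by simp [time, depth]⟩
  | assign r e => exact ⟨e.cost + 1, fun n => by simp [time, depth]⟩
  | store a i e => exact ⟨i.cost + e.cost + 1, fun n => by simp [time, depth]⟩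
  | seq p q ihp ihq =>
    obtain ⟨c, hc⟩ := ihp
    obtain ⟨d, hd⟩ := ihq
    refine ⟨c + d, fun n => ?_⟩
    have h1 : (n + 1) ^ p.depth ≤ (n + 1) ^ max p.depth q.depth :=
      Nat.pow_le_pow_right (by omega) (le_max_left _ _)
    have h2 : (n + 1) ^ q.depth ≤ (n + 1) ^ max p.depth q.depth :=
      Nat.pow_le_pow_right (by omega) (le_max_right _ _)
    simp only [time, depth]
    nlinarith [hc n, hd n, Nat.mul_le_mul_left c h1, Nat.mul_le_mul_left d h2]
  | ite b p q ihp ihq =>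
    obtain ⟨c, hc⟩ := ihp
    obtain ⟨d, hd⟩ := ihq
    refine ⟨b.cost + 1 + c + d, fun n => ?_⟩
    have h1 : (n + 1) ^ p.depth ≤ (n + 1) ^ max p.depth q.depth :=
      Nat.pow_le_pow_right (by omega) (le_max_left _ _)
    have h2 : (n + 1) ^ q.depth ≤ (n + 1) ^ max p.depth q.depth :=
      Nat.pow_le_pow_right (by omega) (le_max_right _ _)
    have h3 : 1 ≤ (n + 1) ^ max p.depth q.depth := Nat.one_le_pow _ _ (by omega)
    simp only [time, depth]
    nlinarith [hc n, hd n, Nat.mul_le_mul_left c h1, Nat.mul_le_mul_left d h2,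
      Nat.mul_le_mul_left (b.cost + 1) h3]
  | loop i p ih =>
    obtain ⟨c, hc⟩ := ih
    refine ⟨c + 14, fun n => ?_⟩
    have h3 : 1 ≤ (n + 1) ^ p.depth := Nat.one_le_pow _ _ (by omega)
    simp only [time, depth, pow_succ]
    nlinarith [Nat.mul_le_mul_left n (hc n), Nat.mul_le_mul_left n h3]

theorem exists_growth_le (p : Cmd) : ∃ c, ∀ n, p.growth n ≤ c * (n + 1) ^ p.depth := by
  induction p with
  | skip => exact ⟨1, fun n => by simp [growth, depth]⟩
  | assign r e => exact ⟨e.offset, fun n => by simp [growth, depth]⟩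
  | store a i e => exact ⟨e.offset, fun n => by simp [growth, depth]⟩
  | seq p q ihp ihq | ite b p q ihp ihq =>
    obtain ⟨c, hc⟩ := ihp
    obtain ⟨d, hd⟩ := ihq
    refine ⟨c + d, fun n => ?_⟩
    have h1 : (n + 1) ^ p.depth ≤ (n + 1) ^ max p.depth q.depth :=
      Nat.pow_le_pow_right (by omega) (le_max_left _ _)
    have h2 : (n + 1) ^ q.depth ≤ (n + 1) ^ max p.depth q.depth :=
      Nat.pow_le_pow_right (by omega) (le_max_right _ _)
    simp only [growth, depth]
    nlinarith [hc n, hd n, Nat.mul_le_mul_left c h1, Nat.mul_le_mul_left d h2]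
  | loop i p ih =>
    obtain ⟨c, hc⟩ := ih
    refine ⟨c, fun n => ?_⟩
    simp only [growth, depth, pow_succ]
    nlinarith [Nat.mul_le_mul_left n (hc n), Nat.zero_le (c * (n + 1) ^ p.depth)]

end Cmd

/-! ### Quadratic time for programs of loop depth two. -/

theorem instanceState_bounded {n : ℕ} (G : SimpleGraph (Fin n)) (k l : ℤ) :
    (instanceState G k l).Bounded (n + k.natAbs + l.natAbs + 1) := by
  constructor
  · intro r
    simp only [instanceState]
    split_ifs <;> omega
  · intro a i
    simp only [instanceState]
    split_ifs <;> omega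

/-- A well-formed program of loop depth `2`, followed by an assignment to register `0`, runs in
quadratic time on words of logarithmic length. -/
theorem Cmd.exists_run (p : Cmd) (hp : p.wellFormed = true) (hd : p.depth ≤ 2) (e : Expr) :
    ∃ c d, ∀ (n : ℕ) (G : SimpleGraph (Fin n)) (k l : ℤ), ∃ t,
      Run ((n + k.natAbs + l.natAbs + 2) ^ d) (.seq p.toProgram (.assign 0 e))
        (instanceState G k l) t ((p.exec (instanceState G k l)).setReg 0
          (e.eval (p.exec (instanceState G k l)))) ∧
      t ≤ c * (n ^ 2 + 1) := by
  obtain ⟨c, hc⟩ := p.exists_time_le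
  obtain ⟨g, hg⟩ := p.exists_growth_le
  -- The factor `2` comes from `(n + 1) ^ 2 ≤ 2 * (n ^ 2 + 1)`. The exponent `g + 3` comes from a
  -- growth of at most `g * N ^ 2` together with `g + 1 ≤ N ^ g`.
  refine ⟨2 * c + e.cost + 1, (g + 3) * (p.width + e.width), fun n G k l => ?_⟩
  set N := n + k.natAbs + l.natAbs + 2 with hN
  have hpow : (n + 1) ^ p.depth ≤ (n + 1) ^ 2 := Nat.pow_le_pow_right (by omega) hd
  have hgr : n + k.natAbs + l.natAbs + 1 + p.growth n + 2 ≤ N ^ (g + 3) := by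
    have h1 : p.growth n ≤ g * (n + 1) ^ 2 := (hg n).trans (Nat.mul_le_mul_left _ hpow)
    have h2 : (n + 1) ^ 2 ≤ N ^ 2 := Nat.pow_le_pow_left (by omega) 2
    have h3 : g + 1 ≤ N ^ g := by
      have : g < 2 ^ g := Nat.lt_two_pow_self
      exact this.trans_le (Nat.pow_le_pow_left (by omega) g)
    have h4 : 2 ≤ N := by omega
    have h5 : N + 1 ≤ N ^ 2 := by nlinarith
    have h6 : N ^ 2 * 2 ≤ N ^ 3 := by
      rw [pow_succ N 2]; exact Nat.mul_le_mul_left _ (by omega)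
    calc n + k.natAbs + l.natAbs + 1 + p.growth n + 2 ≤ N ^ 2 + g * N ^ 2 := by
          nlinarith [Nat.mul_le_mul_left g h2]
      _ = (g + 1) * N ^ 2 := by ring
      _ ≤ N ^ g * N ^ 3 := Nat.mul_le_mul h3 (by omega)
      _ = N ^ (g + 3) := by ring
  have hW : (n + k.natAbs + l.natAbs + 1 + p.growth n + 2) ^ (p.width + e.width) ≤
      N ^ ((g + 3) * (p.width + e.width)) := by
    rw [pow_mul]; exact Nat.pow_le_pow_left hgr _
  obtain ⟨t, ht, hr, hb⟩ := p.run hp (N ^ ((g + 3) * (p.width + e.width))) n (instanceState G k l) _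
    (by simp [instanceState]) (instanceState_bounded G k l)
    ((Nat.pow_le_pow_right (by omega) (by omega)).trans hW)
  refine ⟨t + (e.cost + 1), Run.seq hr (Run.assign _ 0 e
    ((e.fits_of_width_le hb (h := p.width + e.width) (by omega)).mono hW)), ?_⟩
  have h1 : t ≤ c * (n + 1) ^ 2 := (ht.trans (hc n)).trans (Nat.mul_le_mul_left _ hpow)
  have h2 : c * (n + 1) ^ 2 ≤ c * (2 * (n ^ 2 + 1)) :=
    Nat.mul_le_mul_left _ (by zify; nlinarith [sq_nonneg ((n : ℤ) - 1)])
  have h3 : (e.cost + 1) * 1 ≤ (e.cost + 1) * (n ^ 2 + 1) := Nat.mul_le_mul_left _ (by omega)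
  calc t + (e.cost + 1) ≤ c * (2 * (n ^ 2 + 1)) + (e.cost + 1) * (n ^ 2 + 1) := by omega
    _ = (2 * c + e.cost + 1) * (n ^ 2 + 1) := by ring

end RAM

/-! ### Interval models and perfect elimination orderings -/

/-- The relation `r` ("entirely to the left of") of an interval representation of `G`. -/
structure IntervalModel {V : Type*} (G : SimpleGraph V) (r : V → V → Prop) : Prop where
  irrefl : ∀ x, ¬ r x x
  exchange : ∀ x y z w, r x y → r z w → r x w ∨ r z y
  adj_iff : ∀ u v, G.Adj u v ↔ u ≠ v ∧ ¬ r u v ∧ ¬ r v u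

/-- A failure of the exchange law would give points with `p < q' ≤ p' < q ≤ p`. Convexity enters
only for adjacency: of two sets neither of which is left of the other, one contains a point of the
other. -/
theorem IsIntervalGraph.exists_model {V : Type*} {G : SimpleGraph V} (h : IsIntervalGraph G) :
    ∃ r, IntervalModel G r := by
  obtain ⟨I, hI, hadj⟩ := h
  refine ⟨fun x y => ∀ p ∈ I x, ∀ q ∈ I y, p < q, ?_, ?_, ?_⟩
  · intro x hx
    obtain ⟨p, hp⟩ := (hI x).1
    exact lt_irrefl _ (hx p hp p hp)
  · intro x y z w hxy hzw
    by_contra hcon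
    push Not at hcon
    obtain ⟨⟨p, hp, q, hq, hpq⟩, ⟨p', hp', q', hq', hpq'⟩⟩ := hcon
    have h1 := hxy p hp q' hq'
    have h2 := hzw p' hp' q hq
    linarith
  · intro u v
    rw [hadj]
    refine and_congr_right fun _ => ⟨?_, ?_⟩
    · rintro ⟨p, hpu, hpv⟩
      exact ⟨fun hr => lt_irrefl _ (hr p hpu p hpv), fun hr => lt_irrefl _ (hr p hpv p hpu)⟩
    · rintro ⟨h1, h2⟩
      push Not at h1 h2
      obtain ⟨p, hp, q, hq, hpq⟩ := h1
      obtain ⟨p', hp', q', hq', hpq'⟩ := h2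
      rcases le_total q' q with hle | hle
      · exact ⟨q, (hI u).2.out hq' hp ⟨hle, hpq⟩, hq⟩
      · exact ⟨q', hq', (hI v).2.out hq hp' ⟨hle, hpq'⟩⟩

namespace IntervalModel

variable {V : Type*} {G : SimpleGraph V} {r : V → V → Prop}

theorem flip (h : IntervalModel G r) : IntervalModel G (fun x y => r y x) where
  irrefl := h.irrefl
  exchange x y z w hxy hzw := (h.exchange y x w z hxy hzw).symm
  adj_iff u v := by rw [h.adj_iff]; tauto

theorem trans (h : IntervalModel G r) {x y z : V} (hxy : r x y) (hyz : r y z) : r x z :=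
  (h.exchange x y y z hxy hyz).resolve_right (h.irrefl y)

theorem rel_or_rel (h : IntervalModel G r) {u v : V} (huv : u ≠ v) (hadj : ¬ G.Adj u v) :
    r u v ∨ r v u := by
  rw [h.adj_iff] at hadj; tauto

theorem not_adj (h : IntervalModel G r) {u v : V} (huv : r u v) : ¬ G.Adj u v := by
  rw [h.adj_iff]; tauto

/-- Otherwise `z` would be left of `u`, hence left of its neighbour `y`. -/
theorem rel_or_adj (h : IntervalModel G r) {u y z : V} (huy : r u y) (hzy : G.Adj z y)
    (hzu : z ≠ u) : r u z ∨ G.Adj z u := by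
  by_contra hcon
  push Not at hcon
  rcases h.rel_or_rel hzu hcon.2 with h1 | h1
  · exact h.not_adj (h.trans h1 huy) hzy
  · exact hcon.1 h1

/-- Two vertices, one to the left of the other, are not connected by a path all of whose inner
vertices come later in an ordering found by a neighbourhood search. -/
theorem not_connected_later (t : V → ℕ) (ht : Function.Injective t)
    (hP : ∀ a b c, t a < t b → t b < t c → G.Adj a c → ¬ G.Adj a b →
      ∃ d, t d < t b ∧ G.Adj d b ∧ ¬ G.Adj d c) :
    ∀ (m : ℕ) (r : V → V → Prop), IntervalModel G r → ∀ u w c e : V, max (t u) (t w) = m →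
      r u w → m < t c → m < t e → G.Adj c u → G.Adj e w →
      ¬ Relation.ReflTransGen (fun z z' => G.Adj z z' ∧ m < t z ∧ m < t z') c e := by
  intro m
  -- For earlier neighbours `u`, `w` of one vertex a path of a single vertex would do. Paths are
  -- allowed because the descent replaces `w` by an earlier vertex `d` and appends `w` to the path.
  induction m using Nat.strong_induction_on with
  | _ m ih =>
    have main : ∀ (r : V → V → Prop), IntervalModel G r → ∀ u w c e : V, max (t u) (t w) = m →
        t u < t w → r u w → m < t c → m < t e → G.Adj c u → G.Adj e w →
        ¬ Relation.ReflTransGen (fun z z' => G.Adj z z' ∧ m < t z ∧ m < t z') c e := by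
      intro r h u w c e hm huw hr hc he hcu hew hpath
      have hm' : t w = m := by omega
      -- Walking back along the path from `w`, which is right of `u`, all vertices stay right of `u`
      -- until one adjacent to `u` appears. This vertex `c'` still has a neighbour `y` right of `u`,
      -- so it reaches beyond the right end of `u`.
      have hfound : ∀ z, Relation.ReflTransGen
          (fun z z' => G.Adj z z' ∧ m < t z ∧ m < t z') z e → r u z ∨
          ∃ c' y, G.Adj c' u ∧ m < t c' ∧ r u y ∧ G.Adj c' y ∧
          Relation.ReflTransGen (fun z z' => G.Adj z z' ∧ m < t z ∧ m < t z') c' e := by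
        intro z hz
        induction hz using Relation.ReflTransGen.head_induction_on with
        | refl =>
          rcases h.rel_or_adj hr hew (by rintro rfl; omega) with h1 | h1
          · exact Or.inl h1
          · exact Or.inr ⟨e, w, h1, he, hr, hew, .refl⟩
        | head hzz' hrest ihz =>
          rename_i z z'
          rcases ihz with h1 | h1
          · rcases h.rel_or_adj h1 hzz'.1 (by rintro rfl; have := hzz'.2.1; omega) with h2 | h2
            · exact Or.inl h2
            · exact Or.inr ⟨z, z', h2, hzz'.2.1, h1, hzz'.1, hrest.head hzz'⟩
          · exact Or.inr h1
      rcases hfound c hpath with h1 | ⟨c', y, hc'u, hc', huy, hc'y, hpath'⟩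
      · exact h.not_adj h1 hcu.symm
      -- The search visited `w` before `c'` although the earlier `u` is adjacent only to `c'`, so
      -- some earlier `d` sees `w` but not `c'`. Exchange shows that `d` is right of `c'`, hence
      -- right of `u`, and the pair `u`, `d` is a smaller instance.
      obtain ⟨d, hdw, hdw', hdc⟩ := hP u w c' huw (by omega) hc'u.symm (h.not_adj hr)
      have hdne : d ≠ c' := by rintro rfl; omega
      have hc'd : r c' d := by
        rcases h.rel_or_rel hdne hdc with h1 | h1
        · rcases h.exchange _ _ _ _ hr h1 with h2 | h2
          · exact absurd hc'u.symm (h.not_adj h2)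
          · exact absurd hdw' (h.not_adj h2)
        · exact h1
      have hud : r u d := by
        rcases h.exchange _ _ _ _ huy hc'd with h1 | h1
        · exact h1
        · exact absurd hc'y (h.not_adj h1)
      refine ih (max (t u) (t d)) (by omega) r h u d c' w rfl hud (by omega) (by omega) hc'u
        hdw'.symm ?_
      refine Relation.ReflTransGen.tail (b := e) ?_ ⟨hew, by omega, by omega⟩
      exact Relation.ReflTransGen.mono (fun a b hab => ⟨hab.1, by omega, by omega⟩) _ _ hpath'
    intro r h u w c e hm hr hc he hcu hew hpath
    have hne : t u ≠ t w := fun heq => by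
      have := ht heq
      subst this
      exact h.irrefl _ hr
    rcases lt_or_gt_of_ne hne with hlt | hlt
    · exact main r h u w c e hm hlt hr hc he hcu hew hpath
    · refine main _ h.flip w u e c (by omega) hlt hr he hc hew hcu ?_
      have hsymm : Std.Symm (fun z z' => G.Adj z z' ∧ m < t z ∧ m < t z') :=
        ⟨fun a b hab => ⟨hab.1.symm, hab.2.2, hab.2.1⟩⟩
      exact (Relation.ReflTransGen.stdSymm).symm _ _ hpath

/-- A neighbourhood search finds (the reverse of) a perfect elimination ordering. -/
theorem earlier_adj (h : IntervalModel G r) (t : V → ℕ) (ht : Function.Injective t)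
    (hP : ∀ a b c, t a < t b → t b < t c → G.Adj a c → ¬ G.Adj a b →
      ∃ d, t d < t b ∧ G.Adj d b ∧ ¬ G.Adj d c)
    {u w v : V} (hu : G.Adj u v) (hw : G.Adj w v) (htu : t u < t v) (htw : t w < t v)
    (huw : u ≠ w) : G.Adj u w := by
  by_contra hcon
  rcases h.rel_or_rel huw hcon with h1 | h1
  · exact not_connected_later t ht hP _ r h u w v v rfl h1 (by omega) (by omega) hu.symm hw.symm
      .refl
  · exact not_connected_later t ht hP _ r h w u v v rfl h1 (by omega) (by omega) hw.symm hu.symm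
      .refl

end IntervalModel

/-! ### Maximal cliques of a graph with a perfect elimination ordering -/

/-- For every vertex, the neighbours which come earlier in the ordering `t` form a clique. -/
structure EarlierCliques {V : Type*} (G : SimpleGraph V) (t : V → ℕ) : Prop where
  injective : Function.Injective t
  adj : ∀ u w v, G.Adj v u → G.Adj v w → t u < t v → t w < t v → u ≠ w → G.Adj u w

/-- `x` is an earlier neighbour of `v`. -/
def Earlier {V : Type*} (G : SimpleGraph V) (t : V → ℕ) (v x : V) : Prop :=
  G.Adj v x ∧ t x < t v

/-- `x` belongs to the clique formed by `v` and its earlier neighbours. -/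
def InClique {V : Type*} (G : SimpleGraph V) (t : V → ℕ) (v x : V) : Prop :=
  x = v ∨ Earlier G t v x

/-- The clique of `v` is inclusion maximal. -/
def CliqueMaximal {V : Type*} (G : SimpleGraph V) (t : V → ℕ) (v : V) : Prop :=
  ∀ y, (∀ x, InClique G t v x → x ≠ y → G.Adj x y) → InClique G t v y

/-- `v` is the latest of the earlier neighbours of `w`. -/
def IsParent {V : Type*} (G : SimpleGraph V) (t : V → ℕ) (w v : V) : Prop :=
  Earlier G t w v ∧ ∀ x, Earlier G t w x → t x ≤ t v

open Classical in
/-- The size of the clique of `v`. -/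
noncomputable def cliqueSize {V : Type*} [Fintype V] (G : SimpleGraph V) (t : V → ℕ) (v : V) : ℕ :=
  (Finset.univ.filter (InClique G t v)).card

/-- `rep` maps every vertex to a vertex with a maximal clique around its own clique. -/
structure CliqueRep {V : Type*} (G : SimpleGraph V) (t : V → ℕ) (rep : V → V) : Prop where
  subset : ∀ v x, InClique G t v x → InClique G t (rep v) x
  maximal : ∀ v, CliqueMaximal G t (rep v)
  eq_self : ∀ v, CliqueMaximal G t v → rep v = v

/-- `x` belongs to the maximal clique represented by `c`. -/
def InMaxClique {V : Type*} (G : SimpleGraph V) (t : V → ℕ) (rep : V → V) (c x : V) : Prop :=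
  rep c = c ∧ InClique G t c x

/-- `r` is a strict total order of `X` for which all sets `{c | A c x}` are consecutive. -/
structure ConsecutiveOn {ι κ : Type*} (A : ι → κ → Prop) (X : Set ι) (r : ι → ι → Prop) : Prop where
  irrefl : ∀ c ∈ X, ¬ r c c
  trans : ∀ c ∈ X, ∀ d ∈ X, ∀ e ∈ X, r c d → r d e → r c e
  total : ∀ c ∈ X, ∀ d ∈ X, c ≠ d → r c d ∨ r d c
  consecutive : ∀ x, ∀ c ∈ X, ∀ d ∈ X, ∀ e ∈ X, A c x → A e x → r c d → r d e → A d x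

namespace EarlierCliques

variable {V : Type*} {G : SimpleGraph V} {t : V → ℕ}

theorem inClique_adj (h : EarlierCliques G t) {c x y : V} (hx : InClique G t c x)
    (hy : InClique G t c y) (hxy : x ≠ y) : G.Adj x y := by
  rcases hx with rfl | hx
  · rcases hy with rfl | hy
    · exact absurd rfl hxy
    · exact hy.1
  · rcases hy with rfl | hy
    · exact hx.1.symm
    · exact h.adj x y c hx.1 hy.1 hx.2 hy.2 hxy

theorem inClique_le {c x : V} (hx : InClique G t c x) : t x ≤ t c := by
  rcases hx with rfl | hx
  · exact le_rfl
  · exact hx.2.le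

/-- The earlier neighbours of `w` are pairwise adjacent and `v` is the latest of them, so the others
are earlier neighbours of `v`. -/
theorem inClique_parent (h : EarlierCliques G t) {w v x : V} (hwv : IsParent G t w v)
    (hx : Earlier G t w x) : InClique G t v x := by
  by_cases hxv : x = v
  · exact Or.inl hxv
  · refine Or.inr ⟨h.adj v x w hwv.1.1 hx.1 hwv.1.2 hx.2 (Ne.symm hxv), ?_⟩
    exact lt_of_le_of_ne (hwv.2 x hx) fun he => hxv (h.injective he)

section

variable [Fintype V]

/-- By `inClique_parent` the earlier neighbours of `w` lie in the clique of `v`; equal cardinalities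
turn this inclusion into an equality. This makes maximality testable by comparing sizes. -/
theorem inClique_of_size (h : EarlierCliques G t) {w v : V} (hwv : IsParent G t w v)
    (hs : cliqueSize G t w = cliqueSize G t v + 1) {x : V} (hx : InClique G t v x) :
    Earlier G t w x := by
  classical
  have hsub : Finset.univ.filter (Earlier G t w) ⊆ Finset.univ.filter (InClique G t v) := by
    intro y hy
    simp only [Finset.mem_filter, Finset.mem_univ, true_and] at hy ⊢
    exact h.inClique_parent hwv hy
  have hins : Finset.univ.filter (InClique G t w) =
      insert w (Finset.univ.filter (Earlier G t w)) := by
    ext y; simp [InClique]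
  have hcard : (Finset.univ.filter (InClique G t w)).card =
      (Finset.univ.filter (Earlier G t w)).card + 1 := by
    rw [hins, Finset.card_insert_of_notMem]
    simp [Earlier]
  have heq := Finset.eq_of_subset_of_card_le hsub (by
    simp only [cliqueSize] at hs
    convert (show (Finset.univ.filter (InClique G t v)).card ≤
      (Finset.univ.filter (Earlier G t w)).card by
        have h1 : (Finset.univ.filter (InClique G t w)).card =
          (Finset.univ.filter (InClique G t v)).card + 1 := by convert hs
        omega))
  have : x ∈ Finset.univ.filter (Earlier G t w) := by rw [heq]; simpa using hx
  simpa using this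

theorem not_maximal_of_size (h : EarlierCliques G t) {w v : V} (hwv : IsParent G t w v)
    (hs : cliqueSize G t w = cliqueSize G t v + 1) : ¬ CliqueMaximal G t v := by
  intro hmax
  have := hmax w fun x hx _ => (h.inClique_of_size hwv hs hx).1.symm
  have h1 := inClique_le this
  have h2 := hwv.1.2
  omega

/-- Take the earliest vertex `w` after `v` that is adjacent to the whole clique of `v`. An earlier
neighbour of `w` later than `v` would also be adjacent to this clique, against the choice of `w`. So
`v` is the parent of `w` and nothing is lost from the clique. -/
theorem exists_child_of_not_maximal (h : EarlierCliques G t) {v : V}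
    (hv : ¬ CliqueMaximal G t v) :
    ∃ w, IsParent G t w v ∧ cliqueSize G t w = cliqueSize G t v + 1 := by
  classical
  simp only [CliqueMaximal] at hv
  push Not at hv
  obtain ⟨y, hy, hyv⟩ := hv
  have hex : ∃ m, ∃ w, t w = m ∧ t v < t w ∧ ∀ x, InClique G t v x → G.Adj w x := by
    refine ⟨_, y, rfl, ?_, fun x hx => ?_⟩
    · have hvy : G.Adj v y := hy v (Or.inl rfl) fun he => hyv (Or.inl he.symm)
      by_contra hcon
      refine hyv (Or.inr ⟨hvy, lt_of_le_of_ne (by omega) fun he => ?_⟩)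
      exact hvy.ne (h.injective he.symm)
    · exact (hy x hx (by rintro rfl; exact hyv hx)).symm
  obtain ⟨w, hwm, hvw, hw⟩ := Nat.find_spec hex
  have hmin : ∀ z, t z < t w → t v < t z → ¬ ∀ x, InClique G t v x → G.Adj z x := by
    intro z hz hvz hcon
    exact Nat.find_min hex (m := t z) (by omega) ⟨z, rfl, hvz, hcon⟩
  have hsub : ∀ x, InClique G t v x → Earlier G t w x := fun x hx =>
    ⟨hw x hx, (inClique_le hx).trans_lt hvw⟩
  have hpar : IsParent G t w v := by
    refine ⟨hsub v (Or.inl rfl), fun x hx => ?_⟩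
    by_contra hcon
    refine hmin x hx.2 (by omega) fun z hz => ?_
    refine h.adj x z w hx.1 (hw z hz) hx.2 (hsub z hz).2 ?_
    rintro rfl
    have := inClique_le hz
    omega
  refine ⟨w, hpar, ?_⟩
  have hins : Finset.univ.filter (InClique G t w) =
      insert w (Finset.univ.filter (InClique G t v)) := by
    ext z
    simp only [Finset.mem_filter, Finset.mem_univ, true_and, Finset.mem_insert]
    constructor
    · rintro (rfl | hz)
      · exact Or.inl rfl
      · exact Or.inr (h.inClique_parent hpar hz)
    · rintro (rfl | hz)
      · exact Or.inl rfl
      · exact Or.inr (hsub z hz)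
  simp only [cliqueSize]
  rw [← Finset.card_insert_of_notMem (a := w), ← hins]
  simp only [Finset.mem_filter, Finset.mem_univ, true_and]
  intro hcon
  have := inClique_le hcon
  omega

end

/-- The maximal cliques of an interval graph can be arranged such that the cliques through any
vertex are consecutive. -/
theorem exists_consecutive (h : EarlierCliques G t) {r : V → V → Prop} (hr : IntervalModel G r)
    {rep : V → V} (hrep : CliqueRep G t rep) :
    ∃ r', ConsecutiveOn (InMaxClique G t rep) Set.univ r' := by
  classical
  -- The order of the cliques: some vertex of `c` lies entirely left of some vertex of `d`. In each
  -- verification below, exchange leaves only alternatives between two vertices of one clique, which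
  -- are never comparable, except for the one that is wanted.
  let B : V → V → Prop := fun c d => ∃ u w, InClique G t c u ∧ InClique G t d w ∧ r u w
  have hmax : ∀ c, rep c = c → CliqueMaximal G t c := fun c hc => hc ▸ hrep.maximal c
  have clique : ∀ {c u w}, InClique G t c u → InClique G t c w → ¬ r u w := by
    intro c u w hu hw huw
    have hne : u ≠ w := by rintro rfl; exact hr.irrefl _ huw
    exact hr.not_adj huw (h.inClique_adj hu hw hne)
  have btrans : ∀ c d e, B c d → B d e → B c e := by
    rintro c d e ⟨u, w, hu, hw, huw⟩ ⟨w', z, hw', hz, hwz⟩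
    rcases hr.exchange _ _ _ _ huw hwz with h1 | h1
    · exact ⟨u, z, hu, hz, h1⟩
    · exact absurd h1 (clique hw' hw)
  have bcons : ∀ x c d e, rep d = d → InClique G t c x → InClique G t e x → B c d → B d e →
      InClique G t d x := by
    rintro x c d e hd hcx hex ⟨u, w, hu, hw, huw⟩ ⟨w', z, hw', hz, hwz⟩
    refine hmax d hd x fun y hy hyx => ?_
    by_contra hcon
    rcases hr.rel_or_rel hyx hcon with h1 | h1
    · rcases hr.exchange _ _ _ _ huw h1 with h2 | h2
      · exact clique hu hcx h2
      · exact clique hy hw h2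
    · rcases hr.exchange _ _ _ _ h1 hwz with h2 | h2
      · exact clique hex hz h2
      · exact clique hw' hy h2
  -- If no pair of vertices is comparable, the two cliques are completely joined, and maximality
  -- puts each of `c`, `d` into the clique of the other, which forces equal times.
  have btotal : ∀ c d, rep c = c → rep d = d → c ≠ d → B c d ∨ B d c := by
    intro c d hc hd hcd
    by_contra hcon
    have hall : ∀ u w, InClique G t c u → InClique G t d w → u ≠ w → G.Adj u w := by
      intro u w hu hw huw
      by_contra hadj
      rcases hr.rel_or_rel huw hadj with h1 | h1
      · exact hcon (Or.inl ⟨u, w, hu, hw, h1⟩)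
      · exact hcon (Or.inr ⟨w, u, hw, hu, h1⟩)
    have h1 : InClique G t c d := hmax c hc d fun u hu hud => hall u d hu (Or.inl rfl) hud
    have h2 : InClique G t d c := hmax d hd c fun u hu huc =>
      (hall c u (Or.inl rfl) hu (Ne.symm huc)).symm
    exact hcd (h.injective (le_antisymm (inClique_le h2) (inClique_le h1)))
  -- The vertices that represent no maximal clique are placed behind all others, ordered by time; no
  -- set of cliques contains them, so they do no harm there.
  refine ⟨fun c d => (rep c = c ∧ rep d = d ∧ B c d) ∨ (rep c = c ∧ rep d ≠ d) ∨
    (rep c ≠ c ∧ rep d ≠ d ∧ t c < t d), ⟨?_, ?_, ?_, ?_⟩⟩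
  · rintro c - (⟨_, _, u, w, hu, hw, huw⟩ | hc | hc)
    · exact clique hu hw huw
    · exact hc.2 hc.1
    · exact lt_irrefl _ hc.2.2
  · rintro c - d - e - hcd hde
    have := btrans c d e
    by_cases hc : rep c = c <;> by_cases hd : rep d = d <;> by_cases he : rep e = e <;>
      simp only [hc, hd, he, ne_eq, not_true_eq_false, not_false_eq_true, true_and, false_and,
        or_false, false_or, and_true, and_false] at hcd hde ⊢
    · exact this hcd hde
    · omega
  · rintro c - d - hcd
    have hne : t c ≠ t d := fun he => hcd (h.injective he)
    have := btotal c d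
    by_cases hc : rep c = c <;> by_cases hd : rep d = d <;>
      simp only [hc, hd, ne_eq, not_true_eq_false, not_false_eq_true, true_and, false_and,
        or_false, false_or, and_true, and_false, or_true]
    · exact this hc hd hcd
    · omega
  · rintro x c - d - e - ⟨hc, hcx⟩ ⟨he, hex⟩ hcd hde
    have hd : rep d = d := by
      rcases hde with h1 | h1 | h1
      · exact h1.1
      · exact h1.1
      · exact absurd he h1.2.1
    refine ⟨hd, bcons x c d e hd hcx hex ?_ ?_⟩
    · rcases hcd with h1 | h1 | h1
      · exact h1.2.2
      · exact absurd hd h1.2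
      · exact absurd hd h1.2.1
    · rcases hde with h1 | h1 | h1
      · exact h1.2.2
      · exact absurd he h1.2
      · exact absurd he h1.2.1

theorem rep_rep {rep : V → V} (hrep : CliqueRep G t rep) (v : V) : rep (rep v) = rep v :=
  hrep.eq_self _ (hrep.maximal v)

theorem inMaxClique_rep {rep : V → V} (hrep : CliqueRep G t rep) {v x : V}
    (hx : InClique G t v x) : InMaxClique G t rep (rep v) x :=
  ⟨rep_rep hrep v, hrep.subset v x hx⟩

/-- The edges `rep v — rep (par v)` connect all maximal cliques through `x`. -/
theorem constant_of_tree (h : EarlierCliques G t) {rep : V → V} {par : V → V}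
    (hpar : ∀ v x, Earlier G t v x → IsParent G t v (par v)) (f : V → ℕ) (x : V)
    (hf : ∀ v, Earlier G t v x → f (rep v) = f (rep (par v))) :
    ∀ c d, InMaxClique G t rep c x → InMaxClique G t rep d x → f c = f d := by
  -- Passing from `c` to its parent keeps `x` in the clique and decreases the time, so the walk ends
  -- at `x` itself.
  have key : ∀ m c, t c = m → InClique G t c x → f (rep c) = f (rep x) := by
    intro m
    induction m using Nat.strong_induction_on with
    | _ m ih =>
      rintro c hc (rfl | hx)
      · rfl
      · rw [hf c hx]
        have hp := hpar c x hx
        refine ih (t (par c)) ?_ _ rfl (h.inClique_parent hp hx)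
        have := hp.1.2
        omega
  rintro c d ⟨hc, hcx⟩ ⟨hd, hdx⟩
  rw [← hc, ← hd, key _ c rfl hcx, key _ d rfl hdx]

theorem inMaxClique_edge (h : EarlierCliques G t) {rep : V → V} (hrep : CliqueRep G t rep)
    {par : V → V} (hpar : ∀ v x, Earlier G t v x → IsParent G t v (par v)) {v x : V}
    (hx : Earlier G t v x) :
    InMaxClique G t rep (rep v) x ∧ InMaxClique G t rep (rep (par v)) x :=
  ⟨inMaxClique_rep hrep (Or.inr hx), inMaxClique_rep hrep (h.inClique_parent (hpar v x hx) hx)⟩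

/-- An edge lies in the clique of its later end. -/
theorem adj_iff_inMaxClique (h : EarlierCliques G t) {rep : V → V} (hrep : CliqueRep G t rep)
    {x y : V} (hxy : x ≠ y) :
    G.Adj x y ↔ ∃ c, InMaxClique G t rep c x ∧ InMaxClique G t rep c y := by
  constructor
  · intro hadj
    rcases lt_or_gt_of_ne (fun he => hxy (h.injective he) : t x ≠ t y) with hlt | hlt
    · exact ⟨rep y, inMaxClique_rep hrep (Or.inr ⟨hadj.symm, hlt⟩),
        inMaxClique_rep hrep (Or.inl rfl)⟩
    · exact ⟨rep x, inMaxClique_rep hrep (Or.inl rfl), inMaxClique_rep hrep (Or.inr ⟨hadj, hlt⟩)⟩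
  · rintro ⟨c, hx, hy⟩
    exact h.inClique_adj hx.2 hy.2 hxy

end EarlierCliques

/-! ### Consecutive arrangements by refinement of ordered partitions

An ordered partition of `ι` is given by a function `key : ι → ℕ`; its classes are the fibres. -/

section Refinement

variable {ι κ : Type*} (A : ι → κ → Prop)

open Classical in
/-- The ordered partition after the classes of the lowest and highest keys `a`, `b` in
`{c | A c x}` are split by this set. -/
noncomputable def pivotKey (key : ι → ℕ) (x : κ) (a b : ℕ) (c : ι) : ℕ :=
  key c + (if a < key c ∨ (key c = a ∧ A c x) then 1 else 0) +
    (if b < key c ∨ (key c = b ∧ ¬ A c x) then 1 else 0)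

open Classical in
/-- The ordered partition after `C` has been moved to the left of the rest of its class. -/
noncomputable def splitKey (key : ι → ℕ) (C c : ι) : ℕ :=
  key c + if key C < key c ∨ (key c = key C ∧ c ≠ C) then 1 else 0

/-- The set `{c | A c x}` meets several classes. -/
def Straddles (key : ι → ℕ) (x : κ) : Prop :=
  ∃ c d, A c x ∧ A d x ∧ key c ≠ key d

/-- The first and the last class which meet `{c | A c x}` are contained in this set. -/
def Settled (key : ι → ℕ) (x : κ) : Prop :=
  ∀ c d, A c x → ¬ A d x → key c = key d → ∃ e e', A e x ∧ A e' x ∧ key e < key c ∧ key c < key e'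

/-- A step of the refinement process. -/
inductive RefineStep (prio : ι → ℕ) (key : ι → ℕ) : (ι → ℕ) → Prop
  | pivot (x : κ) (lo hi : ι) (hlo : A lo x) (hhi : A hi x)
      (hle : ∀ c, A c x → key lo ≤ key c ∧ key c ≤ key hi) (hlt : key lo < key hi) :
      RefineStep prio key (pivotKey A key x (key lo) (key hi))
  | split (C : ι) (hfree : ∀ x, Straddles A key x → Settled A key x)
      (hC : ∀ c, key c = key C → prio c ≤ prio C) :
      RefineStep prio key (splitKey key C)

/-- Every set `{c | A c x}` is disjoint from `X`, contains `X`, or is contained in `X`. -/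
def Autonomous (X : Set ι) : Prop :=
  ∀ x, (∀ c ∈ X, ¬ A c x) ∨ (∀ c ∈ X, A c x) ∨ (∀ c, A c x → c ∈ X)

/-- `D` is the last element of some consecutive arrangement of `X`. -/
def IsEnd (X : Set ι) (D : ι) : Prop :=
  ∃ r, ConsecutiveOn A X r ∧ ∀ c ∈ X, c ≠ D → r c D

variable {A}

theorem ConsecutiveOn.flip {X : Set ι} {r : ι → ι → Prop} (h : ConsecutiveOn A X r) :
    ConsecutiveOn A X (fun c d => r d c) where
  irrefl := h.irrefl
  trans c hc d hd e he h1 h2 := h.trans e he d hd c hc h2 h1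
  total c hc d hd hcd := (h.total c hc d hd hcd).symm
  consecutive x c hc d hd e he hcx hex h1 h2 := h.consecutive x e he d hd c hc hex hcx h2 h1

theorem ConsecutiveOn.mono {X Y : Set ι} {r : ι → ι → Prop} (h : ConsecutiveOn A X r)
    (hYX : Y ⊆ X) : ConsecutiveOn A Y r where
  irrefl c hc := h.irrefl c (hYX hc)
  trans c hc d hd e he := h.trans c (hYX hc) d (hYX hd) e (hYX he)
  total c hc d hd := h.total c (hYX hc) d (hYX hd)
  consecutive x c hc d hd e he := h.consecutive x c (hYX hc) d (hYX hd) e (hYX he)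

theorem lt_pivotKey {key : ι → ℕ} {x : κ} {a b : ℕ} {c d : ι} (h : key c < key d) :
    pivotKey A key x a b c < pivotKey A key x a b d := by
  simp only [pivotKey]
  split_ifs <;> omega

theorem lt_splitKey {key : ι → ℕ} {C c d : ι} (h : key c < key d) :
    splitKey key C c < splitKey key C d := by
  simp only [splitKey]
  split_ifs <;> omega

theorem pivotKey_congr {key : ι → ℕ} {x : κ} {a b : ℕ} {c d : ι} (h : key c = key d)
    (hA : A c x ↔ A d x) : pivotKey A key x a b c = pivotKey A key x a b d := by
  rw [pivotKey, pivotKey, h, propext hA]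

theorem RefineStep.lt {prio key key' : ι → ℕ} (h : RefineStep A prio key key') {c d : ι}
    (hcd : key c < key d) : key' c < key' d := by
  cases h with
  | pivot => exact lt_pivotKey hcd
  | split => exact lt_splitKey hcd

theorem RefineStep.lt_of_reflTransGen {prio key key' : ι → ℕ}
    (h : Relation.ReflTransGen (RefineStep A prio) key key') {c d : ι}
    (hcd : key c < key d) : key' c < key' d := by
  induction h with
  | refl => exact hcd
  | tail _ hs ih => exact hs.lt ih

theorem RefineStep.ne {prio key key' : ι → ℕ} (h : RefineStep A prio key key') {c d : ι}
    (hcd : key c ≠ key d) : key' c ≠ key' d := by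
  rcases lt_or_gt_of_ne hcd with hlt | hlt
  · exact (h.lt hlt).ne
  · exact (h.lt hlt).ne'

theorem Straddles.step {prio key key' : ι → ℕ} (h : RefineStep A prio key key') {x : κ}
    (hx : Straddles A key x) : Straddles A key' x := by
  obtain ⟨c, d, hc, hd, hcd⟩ := hx
  exact ⟨c, d, hc, hd, h.ne hcd⟩

theorem Settled.step {prio key key' : ι → ℕ} (h : RefineStep A prio key key') {x : κ}
    (hx : Settled A key x) : Settled A key' x := by
  intro c d hc hd hcd
  obtain ⟨e, e', he, he', h1, h2⟩ := hx c d hc hd (by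
    by_contra hne
    exact h.ne hne hcd)
  exact ⟨e, e', he, he', h.lt h1, h.lt h2⟩

/-- `pivotKey` separates members from non-members in the two outer classes, so a class that is still
mixed lies strictly between them. -/
theorem settled_pivotKey {key : ι → ℕ} {x : κ} {lo hi : ι} (hlo : A lo x) (hhi : A hi x)
    (hle : ∀ c, A c x → key lo ≤ key c ∧ key c ≤ key hi) (hlt : key lo < key hi) :
    Settled A (pivotKey A key x (key lo) (key hi)) x := by
  intro c d hc hd hcd
  have heq : key c = key d := by
    by_contra hne
    rcases lt_or_gt_of_ne hne with h1 | h1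
    · exact (lt_pivotKey h1).ne hcd
    · exact (lt_pivotKey h1).ne' hcd
  have h1 := hle c hc
  have h2 : key c ≠ key lo := by
    intro h2
    have h3 : key lo ≠ key hi := hlt.ne
    have h4 : ¬ key hi < key lo := by omega
    simp [pivotKey, ← heq, h2, hc, hd, h3, h4] at hcd
  have h2' : key c ≠ key hi := by
    intro h2
    simp [pivotKey, ← heq, h2, hc, hd, hlt] at hcd
  exact ⟨lo, hi, hlo, hhi, lt_pivotKey (by omega), lt_pivotKey (by omega)⟩

/-- Move the complement of `N` behind `N`, arranged with `D` last. -/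
theorem IsEnd.of_block {X : Set ι} {N : ι → Prop} {r : ι → ι → Prop} {D : ι} (hD : D ∈ X)
    (hND : ¬ N D) (hr : ConsecutiveOn A X r)
    (hN : ∀ c ∈ X, ∀ d ∈ X, ∀ e ∈ X, N c → N e → r c d → r d e → N d)
    (haut : ∀ x, (∀ c ∈ X, ¬ N c → ¬ A c x) ∨ (∀ c ∈ X, ¬ N c → A c x) ∨
      (∀ c ∈ X, A c x → ¬ N c))
    (hend : IsEnd A {c ∈ X | ¬ N c} D) : IsEnd A X D := by
  obtain ⟨z, hz, hzD⟩ := hend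
  -- As `N` is convex and does not contain `D`, it lies on one side of `D`. After a reflection of
  -- `r` if necessary it lies on the left, so a set that contains `c` in `N` and also `D` contains
  -- everything of `N` to the right of `c`.
  obtain ⟨r₀, hr₀, hstar⟩ : ∃ r₀, ConsecutiveOn A X r₀ ∧ ∀ x, ∀ c ∈ X, ∀ d ∈ X, N c → N d →
      A c x → A D x → r₀ c d → A d x := by
    by_cases h0 : ∃ c₀ ∈ X, N c₀ ∧ r c₀ D
    · obtain ⟨c₀, hc₀, hNc₀, hc₀D⟩ := h0
      refine ⟨r, hr, fun x c hc d hd hNc hNd hcx hDx hcd => ?_⟩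
      rcases hr.total d hd D hD (by rintro rfl; exact hND hNd) with h1 | h1
      · exact hr.consecutive x c hc d hd D hD hcx hDx hcd h1
      · exact absurd (hN c₀ hc₀ D hD d hd hNc₀ hNd hc₀D h1) hND
    · push Not at h0
      refine ⟨_, hr.flip, fun x c hc d hd hNc hNd hcx hDx hcd => ?_⟩
      rcases hr.total d hd D hD (by rintro rfl; exact hND hNd) with h1 | h1
      · exact absurd h1 (h0 d hd hNd)
      · exact hr.consecutive x D hD d hd c hc hDx hcx h1 hcd
  refine ⟨fun c d => (N c ∧ ¬ N d) ∨ (N c ∧ N d ∧ r₀ c d) ∨ (¬ N c ∧ ¬ N d ∧ z c d),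
    ⟨?_, ?_, ?_, ?_⟩, ?_⟩
  · rintro c hc (h1 | h1 | h1)
    · exact h1.2 h1.1
    · exact hr₀.irrefl c hc h1.2.2
    · exact hz.irrefl c ⟨hc, h1.1⟩ h1.2.2
  · intro c hc d hd e he hcd hde
    have h1 := hr₀.trans c hc d hd e he
    have h2 := fun (h : ¬ N c) (h' : ¬ N d) (h'' : ¬ N e) =>
      hz.trans c ⟨hc, h⟩ d ⟨hd, h'⟩ e ⟨he, h''⟩
    tauto
  · intro c hc d hd hcd
    have h1 := hr₀.total c hc d hd hcd
    have h2 := fun (h : ¬ N c) (h' : ¬ N d) => hz.total c ⟨hc, h⟩ d ⟨hd, h'⟩ hcd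
    tauto
  · intro x c hc d hd e he hcx hex hcd hde
    have h1 := hr₀.consecutive x c hc d hd e he hcx hex
    have h2 := fun (h : ¬ N c) (h' : ¬ N d) (h'' : ¬ N e) =>
      hz.consecutive x c ⟨hc, h⟩ d ⟨hd, h'⟩ e ⟨he, h''⟩ hcx hex
    have h3 := hstar x c hc d hd
    have h4 := haut x
    -- A set that meets both `N` and its complement contains the complement by `haut`, in particular
    -- `D`. So it contains a final stretch of `N` by `hstar`, followed by the whole complement.
    by_cases hNc : N c <;> by_cases hNd : N d <;> by_cases hNe : N e <;>
      simp only [hNc, hNd, hNe, not_true_eq_false, not_false_eq_true, true_and, false_and,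
        and_false, or_false, false_or] at hcd hde
    · exact h1 hcd hde
    · rcases h4 with h5 | h5 | h5
      · exact absurd hex (h5 e he hNe)
      · exact h3 hNc hNd hcx (h5 D hD hND) hcd
      · exact absurd hNc (h5 c hc hcx)
    · rcases h4 with h5 | h5 | h5
      · exact absurd hex (h5 e he hNe)
      · exact h5 d hd hNd
      · exact absurd hNc (h5 c hc hcx)
    · exact h2 hNc hNd hNe hcd hde
  · intro c hc hcD
    by_cases hNc : N c
    · exact Or.inl ⟨hNc, hND⟩
    · exact Or.inr (Or.inr ⟨hNc, hND, hzD c ⟨hc, hNc⟩ hcD⟩)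

/-- In every autonomous set, a refinement process puts the end of some arrangement last. -/
theorem isEnd_of_refine {prio key fin : ι → ℕ}
    (h : Relation.ReflTransGen (RefineStep A prio) key fin) (hfin : Function.Injective fin) :
    ∀ X, Autonomous A X → (∃ r, ConsecutiveOn A X r ∧ ∀ c ∈ X, ∀ d ∈ X, ∀ e ∈ X,
      (∃ f ∈ X, key c < key f) → (∃ f ∈ X, key e < key f) → r c d → r d e →
      ∃ f ∈ X, key d < key f) →
    ∀ D ∈ X, (∀ c ∈ X, fin c ≤ fin D) → IsEnd A X D := by
  -- The invariant is that the part of `X` outside its last class is convex in some consecutive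
  -- arrangement of `X`. The induction runs over the remaining process, with `X` general, because a
  -- split may replace `X` by its last class.
  induction h using Relation.ReflTransGen.head_induction_on with
  | refl =>
    rintro X hX ⟨r, hr, hN⟩ D hD hmax
    have hiff : ∀ c ∈ X, ¬ (∃ f ∈ X, fin c < fin f) → c = D := by
      intro c hc hcon
      push Not at hcon
      exact hfin (le_antisymm (hmax c hc) (hcon D hD))
    -- At the end of the process the last class is `{D}`.
    refine IsEnd.of_block hD (N := fun c => ∃ f ∈ X, fin c < fin f) ?_ hr hN ?_ ?_
    · rintro ⟨f, hf, hlt⟩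
      have := hmax f hf
      omega
    · intro x
      by_cases hx : A D x
      · refine Or.inr (Or.inl fun c hc hNc => ?_)
        rw [hiff c hc hNc]; exact hx
      · refine Or.inl fun c hc hNc => ?_
        rw [hiff c hc hNc]; exact hx
    · refine ⟨fun _ _ => False, ⟨fun _ _ => id, fun _ _ _ _ _ _ h => h.elim, ?_,
        fun _ _ _ _ _ _ _ _ _ h => h.elim⟩, ?_⟩
      · rintro c ⟨hc, hNc⟩ d ⟨hd, hNd⟩ hcd
        exact absurd ((hiff c hc hNc).trans (hiff d hd hNd).symm) hcd
      · rintro c ⟨hc, hNc⟩ hcD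
        exact absurd (hiff c hc hNc) hcD
  | head hstep hrest ih =>
    rename_i key key'
    rintro X hX ⟨r, hr, hN⟩ D hD hmax
    have hlt : ∀ {c d}, key c < key d → fin c < fin d := fun hcd =>
      RefineStep.lt_of_reflTransGen hrest (hstep.lt hcd)
    have hDtop : ∀ c ∈ X, key c ≤ key D := by
      intro c hc
      by_contra hcon
      have h1 := hlt (not_le.mp hcon)
      have h2 := hmax c hc
      omega
    have htop : ∀ {c}, c ∈ X → ((∃ f ∈ X, key c < key f) ↔ key c ≠ key D) := by
      intro c hc
      constructor
      · rintro ⟨f, hf, hlt⟩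
        have := hDtop f hf
        omega
      · intro hne
        have := hDtop c hc
        exact ⟨D, hD, by omega⟩
    cases hstep with
    | pivot x lo hi hlo hhi hle hlohi =>
      refine ih X hX ⟨r, hr, ?_⟩ D hD hmax
      have hDtop' : ∀ c ∈ X, pivotKey A key x (key lo) (key hi) c ≤
          pivotKey A key x (key lo) (key hi) D := by
        intro c hc
        by_contra hcon
        have h1 := RefineStep.lt_of_reflTransGen hrest (not_le.mp hcon)
        have h2 := hmax c hc
        omega
      have htop' : ∀ {c}, c ∈ X → ((∃ f ∈ X, pivotKey A key x (key lo) (key hi) c <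
          pivotKey A key x (key lo) (key hi) f) ↔ pivotKey A key x (key lo) (key hi) c ≠
          pivotKey A key x (key lo) (key hi) D) := by
        intro c hc
        constructor
        · rintro ⟨f, hf, hlt⟩
          have := hDtop' f hf
          omega
        · intro hne
          have := hDtop' c hc
          exact ⟨D, hD, by omega⟩
      -- Only a pivot that splits the last class of `X` changes the part outside of it.
      by_cases hsame : ∀ c ∈ X, key c = key D → (A c x ↔ A D x)
      · have heq : ∀ c ∈ X, (pivotKey A key x (key lo) (key hi) c =
            pivotKey A key x (key lo) (key hi) D ↔ key c = key D) := by
          intro c hc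
          constructor
          · intro h1
            by_contra hne
            rcases lt_or_gt_of_ne hne with h2 | h2
            · exact (lt_pivotKey h2).ne h1
            · exact (lt_pivotKey h2).ne' h1
          · intro h1
            exact pivotKey_congr h1 (hsame c hc h1)
        intro c hc d hd e he h1 h2 hcd hde
        rw [htop' hc, ne_eq, heq c hc, ← ne_eq, ← htop hc] at h1
        rw [htop' he, ne_eq, heq e he, ← ne_eq, ← htop he] at h2
        rw [htop' hd, ne_eq, heq d hd, ← ne_eq, ← htop hd]
        exact hN c hc d hd e he h1 h2 hcd hde
      · push Not at hsame
        obtain ⟨c₀, hc₀, hc₀D, hAc₀⟩ := hsame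
        -- The set of the pivot neither avoids nor contains `X`, so by autonomy it lies inside `X`.
        have hsub : ∀ c, A c x → c ∈ X := by
          rcases hX x with h1 | h1 | h1
          · exfalso; have := h1 c₀ hc₀; have := h1 D hD; tauto
          · exfalso; have := h1 c₀ hc₀; have := h1 D hD; tauto
          · exact h1
        by_cases hhiD : key hi = key D
        · have hloD : key lo ≠ key D := by omega
          have hAD : ¬ A D x := by
            intro hAD
            have hAc : ¬ A c₀ x := by tauto
            have := hDtop' c₀ hc₀
            simp [pivotKey, hc₀D, hAD, hAc, hhiD, hloD.symm] at this
          -- The last class of `X` is the last one that the pivot meets, so the members in it move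
          -- left. Thus the part outside the last class is enlarged by the set of the pivot. Both
          -- are convex and they share `lo`, hence their union is convex.
          have hval : ∀ c ∈ X, (∃ f ∈ X, pivotKey A key x (key lo) (key hi) c <
              pivotKey A key x (key lo) (key hi) f) ↔ ((∃ f ∈ X, key c < key f) ∨ A c x) := by
            intro c hc
            rw [htop' hc, htop hc]
            by_cases hcD : key c = key D
            · have : key lo < key D := by omega
              by_cases hcx : A c x <;> simp [pivotKey, hcD, hhiD, hcx, hAD, this]
            · have h1 : key c < key D := by have := hDtop c hc; omega
              have h2 := (lt_pivotKey (A := A) (x := x) (a := key lo) (b := key hi) h1).ne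
              simp [hcD, h2]
          intro c hc d hd e he h1 h2 hcd hde
          rw [hval c hc] at h1
          rw [hval e he] at h2
          rw [hval d hd]
          have hNlo : ∃ f ∈ X, key lo < key f := (htop (hsub lo hlo)).2 hloD
          have hloX := hsub lo hlo
          by_cases hdlo : d = lo
          · subst hdlo; exact Or.inr hlo
          rcases hr.total d hd lo hloX hdlo with h3 | h3
          · rcases h1 with h1 | h1
            · exact Or.inl (hN c hc d hd lo hloX h1 hNlo hcd h3)
            · exact Or.inr (hr.consecutive x c hc d hd lo hloX h1 hlo hcd h3)
          · rcases h2 with h2 | h2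
            · exact Or.inl (hN lo hloX d hd e he hNlo h2 h3 hde)
            · exact Or.inr (hr.consecutive x lo hloX d hd e he hlo h2 h3 hde)
        · exfalso
          have h1 := hDtop hi (hsub hi hhi)
          have h2 : ¬ A c₀ x := fun h => by have := (hle c₀ h).2; omega
          have h3 : ¬ A D x := fun h => by have := (hle D h).2; omega
          tauto
    | split C hfree hC =>
      -- If `Y` is a single class, only `C` leaves the last class, and a single element is convex.
      have hsplit : ∀ Y : Set ι, C ∈ Y → (∀ c ∈ Y, key c = key C) → ConsecutiveOn A Y r →
          ∃ r, ConsecutiveOn A Y r ∧ ∀ c ∈ Y, ∀ d ∈ Y, ∀ e ∈ Y,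
          (∃ f ∈ Y, splitKey key C c < splitKey key C f) →
          (∃ f ∈ Y, splitKey key C e < splitKey key C f) → r c d → r d e →
          ∃ f ∈ Y, splitKey key C d < splitKey key C f := by
        intro Y hCY hY hrY
        have hone : ∀ c ∈ Y, (∃ f ∈ Y, splitKey key C c < splitKey key C f) → c = C := by
          rintro c hc ⟨f, hf, hlt⟩
          by_contra hne
          rw [splitKey, splitKey, hY c hc, hY f hf] at hlt
          simp only [lt_irrefl, false_or, true_and, ne_eq, hne, not_false_eq_true, if_true] at hlt
          split_ifs at hlt <;> omega
        refine ⟨r, hrY, fun c hc d hd e he h1 h2 hcd hde => ?_⟩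
        rw [hone c hc h1] at hcd
        rw [hone e he h2] at hde
        exact absurd (hrY.trans C hCY d hd C hCY hcd hde) (hrY.irrefl C hCY)
      by_cases hCX : C ∈ X ∧ key C = key D
      · obtain ⟨hCX, hCD⟩ := hCX
        by_cases hall : ∀ c ∈ X, key c = key D
        · exact ih X hX (hsplit X hCX (fun c hc => (hall c hc).trans hCD.symm) hr) D hD hmax
        -- If `X` has several classes, continue with its last class `Y` and put the rest of `X` in
        -- front by `IsEnd.of_block`.
        · set Y : Set ι := {c ∈ X | ¬ ∃ f ∈ X, key c < key f} with hYdef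
          have hYmem : ∀ {c}, c ∈ Y ↔ c ∈ X ∧ key c = key D := by
            intro c
            constructor
            · rintro ⟨h1, h2⟩
              rw [htop h1] at h2
              exact ⟨h1, not_not.mp h2⟩
            · rintro ⟨h1, h2⟩
              exact ⟨h1, by rw [htop h1]; exact not_not.mpr h2⟩
          have hYX : Y ⊆ X := fun c hc => hc.1
          have hYaut : Autonomous A Y := by
            intro x
            rcases hX x with h1 | h1 | h1
            · exact Or.inl fun c hc => h1 c (hYX hc)
            · exact Or.inr (Or.inl fun c hc => h1 c (hYX hc))
            · by_contra hcon
              push Not at hcon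
              obtain ⟨⟨c, hc, hcx⟩, ⟨d, hd, hdx⟩, ⟨e, hex, heY⟩⟩ := hcon
              have hc' := hYmem.1 hc
              have hd' := hYmem.1 hd
              have heX := h1 e hex
              have heD : key e ≠ key D := fun he => heY (hYmem.2 ⟨heX, he⟩)
              -- Since the set of `x` straddles, it is settled: a mixed last class would force an
              -- element of it in a still higher class, outside of `X`.
              obtain ⟨_, e', _, he', _, hlt'⟩ := hfree x ⟨c, e, hcx, hex, by omega⟩ c d hcx hdx
                (by omega)
              have := hDtop e' (h1 e' he')
              omega
          have hDY : D ∈ Y := hYmem.2 ⟨hD, rfl⟩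
          refine IsEnd.of_block hD (N := fun c => ∃ f ∈ X, key c < key f) hDY.2 hr hN ?_ ?_
          · intro x
            rcases hYaut x with h1 | h1 | h1
            · exact Or.inl fun c hc hNc => h1 c ⟨hc, hNc⟩
            · exact Or.inr (Or.inl fun c hc hNc => h1 c ⟨hc, hNc⟩)
            · exact Or.inr (Or.inr fun c _ hcx => (h1 c hcx).2)
          · exact ih Y hYaut (hsplit Y (hYmem.2 ⟨hCX, hCD⟩)
              (fun c hc => (hYmem.1 hc).2.trans hCD.symm) (hr.mono hYX)) D hDY
              (fun c hc => hmax c (hYX hc))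
      · refine ih X hX ⟨r, hr, ?_⟩ D hD hmax
        have heq : ∀ c ∈ X, ((∃ f ∈ X, splitKey key C c < splitKey key C f) ↔
            ∃ f ∈ X, key c < key f) := by
          intro c hc
          rw [htop hc]
          constructor
          · rintro ⟨f, hf, hlt⟩ hcD
            have h1 := hDtop f hf
            rcases Nat.lt_or_ge (key f) (key c) with h2 | h2
            · exact absurd (lt_splitKey (C := C) h2) (by omega)
            · have h3 : key f = key D := by omega
              have hcC : key c = key C → c ≠ C := fun _ he => hCX (he ▸ ⟨hc, hcD⟩)
              simp only [splitKey] at hlt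
              split_ifs at hlt <;> grind
          · intro hne
            have := hDtop c hc
            exact ⟨D, hD, lt_splitKey (by omega)⟩
        intro c hc d hd e he h1 h2 hcd hde
        rw [heq c hc] at h1
        rw [heq e he] at h2
        rw [heq d hd]
        exact hN c hc d hd e he h1 h2 hcd hde

/-- A refinement process which prefers the ends of autonomous sets keeps consistent with some
consecutive arrangement. -/
theorem consistent_of_refine {prio key fin : ι → ℕ}
    (hprio : ∀ X, Autonomous A X → ∀ D ∈ X, (∀ c ∈ X, prio c ≤ prio D) → IsEnd A X D)
    (h : Relation.ReflTransGen (RefineStep A prio) key fin)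
    (hkey : ∃ r, ConsecutiveOn A Set.univ r ∧ ∀ c d, key c < key d → r c d) :
    ∃ r, ConsecutiveOn A Set.univ r ∧ ∀ c d, fin c < fin d → r c d := by
  induction h with
  | refl => exact hkey
  | @tail key key' _ hstep ih =>
    obtain ⟨r, hr, hcons⟩ := ih
    have hasymm : ∀ {c d}, r c d → ¬ r d c := fun {c d} h1 h2 =>
      hr.irrefl c trivial (hr.trans c trivial d trivial c trivial h1 h2)
    cases hstep with
    | pivot x lo hi hlo hhi hle hlohi =>
      -- A pivot needs no new arrangement: in the lowest class that it meets, its members must be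
      -- next to `hi` on the right, and in the highest class next to `lo` on the left.
      refine ⟨r, hr, fun c d hcd => ?_⟩
      rcases lt_trichotomy (key c) (key d) with h1 | h1 | h1
      · exact hcons c d h1
      · have hne : c ≠ d := by rintro rfl; omega
        have hlo' := hcons c hi
        have hhi' := hcons lo d
        have hlo'' := hcons d hi
        have hhi'' := hcons lo c
        have hc1 := hr.consecutive x d trivial c trivial hi trivial
        have hc2 := hr.consecutive x lo trivial d trivial c trivial
        rcases hr.total c trivial d trivial hne with h2 | h2
        · exact h2
        · exfalso
          have e1 : ¬ (key d = key lo ∧ A d x ∧ ¬ A c x) := by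
            rintro ⟨h3, h4, h5⟩
            exact h5 (hc1 h4 hhi h2 (hlo' (by omega)))
          have e2 : ¬ (key c = key hi ∧ A c x ∧ ¬ A d x) := by
            rintro ⟨h3, h4, h5⟩
            exact h5 (hc2 hlo h4 (hhi' (by omega)) h2)
          simp only [pivotKey] at hcd
          by_cases hcx : A c x <;> by_cases hdx : A d x <;> simp [h1, hcx, hdx] at hcd e1 e2
          · split_ifs at hcd <;> omega
          · split_ifs at hcd <;> omega
      · exact absurd (lt_pivotKey (A := A) (x := x) (a := key lo) (b := key hi) h1) (by omega)
    | split C hfree hC =>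
      set X : Set ι := {c | key c = key C} with hX
      -- A set that meets the class and leaves it straddles, hence is settled. If it also missed
      -- part of the class, it would have elements in a lower and in a higher class, and consistency
      -- with `r` would force it to contain the class after all.
      have haut : Autonomous A X := by
        intro x
        by_contra hcon
        push Not at hcon
        obtain ⟨⟨c, hc, hcx⟩, ⟨d, hd, hdx⟩, ⟨e, hex, heX⟩⟩ := hcon
        have hc' : key c = key C := hc
        have hd' : key d = key C := hd
        have he' : key e ≠ key C := heX
        obtain ⟨f, f', hf, hf', h1, h2⟩ := hfree x ⟨c, e, hcx, hex, by omega⟩ c d hcx hdx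
          (by omega)
        exact hdx (hr.consecutive x f trivial d trivial f' trivial hf hf'
          (hcons _ _ (by omega)) (hcons _ _ (by omega)))
      obtain ⟨z, hz, hzC⟩ := hprio X haut C rfl fun c hc => hC c hc
      have hout : ∀ {c d e}, key c = key C → key d = key C → key e ≠ key C → r c e → r d e := by
        intro c d e hc hd he hce
        rcases lt_or_gt_of_ne he with h1 | h1
        · exact absurd hce (hasymm (hcons e c (by omega)))
        · exact hcons d e (by omega)
      have hout' : ∀ {c d e}, key c = key C → key d = key C → key e ≠ key C → r e c → r e d := by
        intro c d e hc hd he hce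
        rcases lt_or_gt_of_ne he with h1 | h1
        · exact hcons e d (by omega)
        · exact absurd hce (hasymm (hcons c e (by omega)))
      -- The class of `C` is an interval of `r` and autonomous, so its inner order may be replaced.
      -- The replacement is the reverse of `z`, because `C` is last in `z` and has to come first.
      refine ⟨fun c d => (key c = key C ∧ key d = key C ∧ z d c) ∨
        (¬ (key c = key C ∧ key d = key C) ∧ r c d), ⟨?_, ?_, ?_, ?_⟩, ?_⟩
      · rintro c - (h1 | h1)
        · exact hz.irrefl c h1.1 h1.2.2
        · exact hr.irrefl c trivial h1.2
      · rintro c - d - e - hcd hde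
        have h1 := hr.trans c trivial d trivial e trivial
        have h2 := fun h h' h'' => hz.trans e h'' d h' c h
        have h3 := @hasymm c d
        by_cases hc : key c = key C <;> by_cases hd : key d = key C <;>
          by_cases he : key e = key C <;>
          simp only [hc, hd, he, true_and, and_true, and_false, false_and, not_true_eq_false,
            not_false_eq_true, or_false, false_or] at hcd hde ⊢
        · exact h2 hc hd he hde hcd
        · exact hout hd hc he hde
        · exact (h3 hcd (hout' he hc hd hde)).elim
        · exact h1 hcd hde
        · exact hout' hd he hc hcd
        · exact h1 hcd hde
        · exact h1 hcd hde
        · exact h1 hcd hde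
      · rintro c - d - hcd
        have h1 := hr.total c trivial d trivial hcd
        have h2 := fun h h' => hz.total c h d h' hcd
        by_cases hc : key c = key C <;> by_cases hd : key d = key C <;>
          simp only [hc, hd, true_and, and_true, and_false, false_and, not_true_eq_false,
            not_false_eq_true, or_false, false_or]
        · exact (h2 hc hd).symm
        · exact h1
        · exact h1
        · exact h1
      · rintro x c - d - e - hcx hex hcd hde
        have h1 := hr.consecutive x c trivial d trivial e trivial hcx hex
        have h2 := fun h h' h'' => hz.consecutive x e h'' d h' c h hex hcx
        rcases haut x with h3 | h3 | h3
        · have hc : key c ≠ key C := fun h => h3 c h hcx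
          have he : key e ≠ key C := fun h => h3 e h hex
          simp only [hc, he, false_and, and_false, not_false_eq_true, true_and, false_or] at hcd hde
          exact h1 hcd hde
        · by_cases hd : key d = key C
          · exact h3 d hd
          · simp only [hd, false_and, and_false, not_false_eq_true, true_and, false_or] at hcd hde
            exact h1 hcd hde
        · have hc : key c = key C := h3 c hcx
          have he : key e = key C := h3 e hex
          by_cases hd : key d = key C
          · simp only [hc, hd, he, true_and, not_true_eq_false, false_and, or_false] at hcd hde
            exact h2 hc hd he hde hcd
          · simp only [hd, false_and, and_false, not_false_eq_true, true_and, false_or] at hcd hde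
            exact absurd (hout' he hc hd hde) (hasymm hcd)
      · intro c d hcd
        rcases lt_trichotomy (key c) (key d) with h1 | h1 | h1
        · exact Or.inr ⟨by omega, hcons c d h1⟩
        · simp only [splitKey, h1] at hcd
          have h2 : key d = key C := by
            by_contra hne
            rw [h1] at hcd
            simp [hne] at hcd
          have h3 : c = C := by
            by_contra hne
            simp [h2, hne] at hcd
            split_ifs at hcd <;> omega
          have h4 : d ≠ C := by
            rintro rfl
            simp [h3] at hcd
          subst h3
          exact Or.inl ⟨rfl, h2, hzC d h2 h4⟩
        · exact absurd (lt_splitKey (C := C) h1) (by omega)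

/-- Two passes of the refinement process, the second one with the result of the first one as
priorities, find a consecutive arrangement if there is one. -/
theorem consecutive_of_refine_twice {prio key₁ key₂ : ι → ℕ}
    (hA : ∃ r, ConsecutiveOn A Set.univ r)
    (h₁ : Relation.ReflTransGen (RefineStep A prio) (fun _ => 0) key₁)
    (hinj₁ : Function.Injective key₁)
    (h₂ : Relation.ReflTransGen (RefineStep A key₁) (fun _ => 0) key₂)
    (hinj₂ : Function.Injective key₂) {x : κ} {c d e : ι} (hc : A c x) (he : A e x)
    (hcd : key₂ c ≤ key₂ d) (hde : key₂ d ≤ key₂ e) : A d x := by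
  obtain ⟨r, hr⟩ := hA
  have hprio : ∀ X, Autonomous A X → ∀ D ∈ X, (∀ c ∈ X, key₁ c ≤ key₁ D) → IsEnd A X D :=
    fun X hX => isEnd_of_refine h₁ hinj₁ X hX
      -- With constant keys there is nothing outside the last class, and the convexity condition is
      -- void.
      ⟨r, hr.mono (Set.subset_univ _), fun c _ d _ e _ h => by simp at h⟩
  obtain ⟨r', hr', hcons⟩ := consistent_of_refine hprio h₂ ⟨r, hr, fun c d h => by simp at h⟩
  rcases hcd.eq_or_lt with h1 | h1
  · exact hinj₂ h1 ▸ hc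
  rcases hde.eq_or_lt with h2 | h2
  · exact (hinj₂ h2).symm ▸ he
  exact hr'.consecutive x c trivial d trivial e trivial hc he (hcons _ _ h1) (hcons _ _ h2)

end Refinement

/-! ### Component order connectivity along an ordering by left end points -/

/-- An ordering of the vertices by the left end points of an interval representation. -/
structure LeftOrder {V : Type*} (G : SimpleGraph V) (pos : V → ℕ) : Prop where
  injective : Function.Injective pos
  adj : ∀ a b c, pos a < pos b → pos b < pos c → G.Adj a c → G.Adj a b

/-- The first clique of `b` lies between the first clique of `a` and any common clique of `a` and
`c`, so it contains `a` as well. -/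
theorem leftOrder_of_consecutive {V ι : Type*} {G : SimpleGraph V} {A : ι → V → Prop}
    {key : ι → ℕ} {left pos : V → ℕ}
    (hadj : ∀ x y, x ≠ y → (G.Adj x y ↔ ∃ c, A c x ∧ A c y))
    (hkey : ∀ x c d e, A c x → A e x → key c ≤ key d → key d ≤ key e → A d x)
    (hleft : ∀ x, ∃ c, A c x ∧ key c = left x) (hmin : ∀ x c, A c x → left x ≤ key c)
    (hpos : Function.Injective pos) (hmono : ∀ x y, left x < left y → pos x < pos y) :
    LeftOrder G pos := by
  refine ⟨hpos, fun a b c hab hbc hac => ?_⟩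
  have h1 : left a ≤ left b := by
    by_contra hcon; have := hmono b a (by omega); omega
  have h2 : left b ≤ left c := by
    by_contra hcon; have := hmono c b (by omega); omega
  have hne : a ≠ b := by rintro rfl; omega
  obtain ⟨e, hea, hec⟩ := (hadj a c hac.ne).1 hac
  obtain ⟨ca, hca, hka⟩ := hleft a
  obtain ⟨cb, hcb, hkb⟩ := hleft b
  have h3 := hmin c e hec
  exact (hadj a b hne).2 ⟨cb, hkey a ca cb e hca hea (by omega) (by omega), hcb⟩

open Classical in
/-- The rank of `x` if the elements are sorted by `left`, with ties broken by the linear order. -/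
noncomputable def leftRank {V : Type*} [Fintype V] [LinearOrder V] (left : V → ℕ) (x : V) : ℕ :=
  (Finset.univ.filter fun y => left y < left x ∨ (left y = left x ∧ y < x)).card

section

variable {V : Type*} [Fintype V] [LinearOrder V] {left : V → ℕ}

theorem leftRank_lt_leftRank {x y : V} (h : left x < left y ∨ (left x = left y ∧ x < y)) :
    leftRank left x < leftRank left y := by
  refine Finset.card_lt_card ?_
  rw [Finset.ssubset_iff_of_subset]
  · exact ⟨x, by simpa using h, by simp⟩
  · intro z hz
    simp only [Finset.mem_filter, Finset.mem_univ, true_and] at hz ⊢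
    rcases hz with hz | ⟨hz, hz'⟩ <;> rcases h with h | ⟨h, h'⟩
    · exact Or.inl (by omega)
    · exact Or.inl (by omega)
    · exact Or.inl (by omega)
    · exact Or.inr ⟨by omega, hz'.trans h'⟩

theorem leftRank_injective : Function.Injective (leftRank left) := by
  intro x y hxy
  by_contra hne
  rcases lt_trichotomy (left x) (left y) with h | h | h
  · exact (leftRank_lt_leftRank (Or.inl h)).ne hxy
  · rcases lt_or_gt_of_ne hne with h' | h'
    · exact (leftRank_lt_leftRank (Or.inr ⟨h, h'⟩)).ne hxy
    · exact (leftRank_lt_leftRank (Or.inr ⟨h.symm, h'⟩)).ne' hxy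
  · exact (leftRank_lt_leftRank (Or.inl h)).ne' hxy

theorem leftRank_lt_card (x : V) : leftRank left x < Fintype.card V := by
  refine Finset.card_lt_card ?_
  rw [Finset.ssubset_iff_of_subset (Finset.subset_univ _)]
  exact ⟨x, Finset.mem_univ _, by simp⟩

end

section COC

variable {V : Type*} [Fintype V] {G : SimpleGraph V}

theorem COC.exists_bounded_components {k l : ℤ} (h : COC G k l) :
    ∃ X : Finset V, (X.card : ℤ) ≤ k ∧ 0 ≤ l ∧ ∀ (v : {v : V // v ∉ X}) (S : Finset V),
      (∀ u ∈ S, ∃ hu : u ∉ X, (deleteVertices G X).Reachable ⟨u, hu⟩ v) → (S.card : ℤ) ≤ l := by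
  classical
  obtain ⟨X, hX, hl⟩ := h
  refine ⟨X, by simpa using hX, le_trans (by positivity) hl, fun v S hS => le_trans ?_ hl⟩
  have h1 : ∑ u with (deleteVertices G X).connectedComponentMk u =
      (deleteVertices G X).connectedComponentMk v, 1 ≤
      heaviestComponent (deleteVertices G X) fun _ => 1 := by
    unfold heaviestComponent
    convert Finset.le_sup (f := fun c => ∑ u with (deleteVertices G X).connectedComponentMk u = c, 1)
      (Finset.mem_univ ((deleteVertices G X).connectedComponentMk v))
    rfl
  have h2 : S.card ≤ ∑ u with (deleteVertices G X).connectedComponentMk u =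
      (deleteVertices G X).connectedComponentMk v, 1 := by
    rw [← Finset.card_eq_sum_ones]
    refine le_trans (Finset.card_le_card ?_) (Finset.card_image_le (f := Subtype.val))
    intro u hu
    obtain ⟨hu', hr⟩ := hS u hu
    simp only [Finset.mem_image, Finset.mem_filter, Finset.mem_univ, true_and]
    exact ⟨⟨u, hu'⟩, SimpleGraph.ConnectedComponent.sound hr, rfl⟩
  exact_mod_cast h2.trans h1

/-- Labels that are constant along edges are constant on components, so each component fits into one
fibre. Fibres need not be connected, so the components need not be known. -/
theorem COC.of_labels {k : ℤ} {l : ℕ} (Y : Finset V) (f : V → ℕ)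
    (hf : ∀ u ∈ Y, ∀ v ∈ Y, G.Adj u v → f u = f v)
    (hl : ∀ i, (Y.filter fun v => f v = i).card ≤ l) (hk : (Fintype.card V : ℤ) ≤ Y.card + k) :
    COC G k l := by
  classical
  refine ⟨Yᶜ, ?_, ?_⟩
  · rw [← Finset.card_eq_sum_ones, Finset.card_compl]
    have := Finset.card_le_univ Y
    omega
  · have key : heaviestComponent (deleteVertices G Yᶜ) (fun _ => 1) ≤ l := by
      unfold heaviestComponent
      refine Finset.sup_le fun c hc => ?_
      clear hc
      induction c using SimpleGraph.ConnectedComponent.ind with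
      | _ v =>
        rw [← Finset.card_eq_sum_ones]
        refine le_trans ?_ (hl (f v.1))
        rw [← Finset.card_image_of_injective _ Subtype.val_injective]
        refine Finset.card_le_card fun u hu => ?_
        simp only [Finset.mem_image, Finset.mem_filter, Finset.mem_univ, true_and] at hu ⊢
        obtain ⟨w, hw, rfl⟩ := hu
        refine ⟨by simpa using w.2, ?_⟩
        obtain ⟨p⟩ := SimpleGraph.ConnectedComponent.exact hw
        clear hw
        induction p with
        | nil => rfl
        | @cons a b c hadj _ ih =>
          exact (hf a.1 (by simpa using a.2) b.1 (by simpa using b.2) hadj).trans ih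
    exact_mod_cast key

open Classical in
/-- The number of vertices at positions `≥ p` all of whose neighbours have positions `< q`. -/
noncomputable def innerCount (pos last : V → ℕ) (p q : ℕ) : ℕ :=
  (Finset.univ.filter fun v => p ≤ pos v ∧ last v < q).card

/-- The recurrence for the largest number `keep q` of vertices which can be kept among those with
all neighbours at positions `< q`. -/
structure KeepTable (pos last : V → ℕ) (l : ℕ) (keep : ℕ → ℕ) : Prop where
  zero : keep 0 = 0
  le : ∀ q < Fintype.card V, ∀ p ≤ q,
    min (Fintype.card V) (keep p + min (innerCount pos last p (q + 1)) l) ≤ keep (q + 1)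
  exists_le : ∀ q < Fintype.card V, keep (q + 1) = 0 ∨
    ∃ p ≤ q, keep (q + 1) ≤ keep p + min (innerCount pos last p (q + 1)) l

/-- `last v` is the last position in the closed neighbourhood of `v`. -/
structure LastNeighbor (G : SimpleGraph V) (pos last : V → ℕ) : Prop where
  self_le : ∀ v, pos v ≤ last v
  adj_le : ∀ v u, G.Adj v u → pos u ≤ last v
  exists_eq : ∀ v, ∃ u, (u = v ∨ G.Adj v u) ∧ last v = pos u

variable {pos last : V → ℕ} {l : ℕ} {keep : ℕ → ℕ}

/-- A new block of at most `l` vertices at positions `≥ p` is put behind a solution for `p`. No edge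
joins the two, because the old vertices have all their neighbours before `p`. The label `q` of the
new block is fresh since older labels are smaller. -/
theorem exists_labels_of_keep (hlast : LastNeighbor G pos last) (hkeep : KeepTable pos last l keep) :
    ∀ q ≤ Fintype.card V, ∃ (Y : Finset V) (f : V → ℕ), keep q ≤ Y.card ∧
      (∀ v ∈ Y, last v < q ∧ f v < q) ∧ (∀ u ∈ Y, ∀ v ∈ Y, G.Adj u v → f u = f v) ∧
      ∀ i, (Y.filter fun v => f v = i).card ≤ l := by
  classical
  intro q
  induction q using Nat.strong_induction_on with
  | _ q ih =>
    intro hq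
    rcases q with _ | q
    · exact ⟨∅, fun _ => 0, by simp [hkeep.zero], by simp, by simp, by simp⟩
    rcases hkeep.exists_le q (by omega) with h0 | ⟨p, hp, hle⟩
    · exact ⟨∅, fun _ => 0, by simp [h0], by simp, by simp, by simp⟩
    obtain ⟨Y, f, hY, hYq, hYf, hYl⟩ := ih p (by omega) (by omega)
    obtain ⟨T, hT, hTc⟩ := Finset.exists_subset_card_eq
      (min_le_left (innerCount pos last p (q + 1)) l)
    have hTm : ∀ v ∈ T, p ≤ pos v ∧ last v < q + 1 := fun v hv => by simpa using hT hv
    have hdisj : Disjoint Y T := by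
      rw [Finset.disjoint_left]
      intro v hvY hvT
      have h1 := (hYq v hvY).1
      have h2 := (hTm v hvT).1
      have h3 := hlast.self_le v
      omega
    have hYT : ∀ v ∈ Y, v ∉ T := fun v hv => Finset.disjoint_left.1 hdisj hv
    refine ⟨Y ∪ T, fun v => if v ∈ T then q else f v, ?_, ?_, ?_, ?_⟩
    · rw [Finset.card_union_of_disjoint hdisj, hTc]; omega
    · intro v hv
      rcases Finset.mem_union.1 hv with hv | hv
      · have := hYq v hv
        simp only [hYT v hv, if_false]; omega
      · have := hTm v hv
        simp only [hv, if_true]; omega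
    · have hcross : ∀ u ∈ Y, ∀ v ∈ T, ¬ G.Adj u v := by
        intro u hu v hv hadj
        have h1 := (hYq u hu).1
        have h2 := hlast.adj_le u v hadj
        have h3 := (hTm v hv).1
        omega
      intro u hu v hv hadj
      rcases Finset.mem_union.1 hu with hu | hu <;> rcases Finset.mem_union.1 hv with hv | hv
      · simp only [hYT u hu, hYT v hv, if_false]; exact hYf u hu v hv hadj
      · exact absurd hadj (hcross u hu v hv)
      · exact absurd hadj.symm (hcross v hv u hu)
      · simp only [hu, hv, if_true]
    · intro i
      by_cases hi : i = q
      · refine le_trans (Finset.card_le_card (t := T) ?_) (hTc.le.trans (min_le_right _ _))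
        intro v hv
        simp only [Finset.mem_filter, Finset.mem_union] at hv
        rcases hv with ⟨hv | hv, hvi⟩
        · have := (hYq v hv).2
          simp only [hYT v hv, if_false] at hvi
          omega
        · exact hv
      · refine le_trans (Finset.card_le_card ?_) (hYl i)
        intro v hv
        simp only [Finset.mem_filter, Finset.mem_union] at hv ⊢
        rcases hv with ⟨hv | hv, hvi⟩
        · simp only [hYT v hv, if_false] at hvi
          exact ⟨hv, hvi⟩
        · simp only [hv, if_true] at hvi
          omega

open Classical in
-- Induction over the positions `q` at which a surviving component starts, with `q = n` as the final
-- one. The survivors before `q` are those before the previous start `b` and those from `b` on, and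
-- the latter form one component.
theorem card_le_keep (hpos : LeftOrder G pos) (hcard : ∀ v, pos v < Fintype.card V)
    (hlast : LastNeighbor G pos last)
    (hkeep : KeepTable pos last l keep) (X : Finset V)
    (hX : ∀ (v : {v : V // v ∉ X}) (S : Finset V),
      (∀ u ∈ S, ∃ hu : u ∉ X, (deleteVertices G X).Reachable ⟨u, hu⟩ v) → S.card ≤ l) :
    ∀ q ≤ Fintype.card V, (q = Fintype.card V ∨ ∃ b ∉ X, pos b = q ∧
      ∀ u ∉ X, pos u < q → ¬ G.Adj u b) →
      (Finset.univ.filter fun v => v ∉ X ∧ pos v < q).card ≤ keep q := by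
  intro q
  induction q using Nat.strong_induction_on with
  | _ q ih =>
    intro hq hcut
    by_cases hne : ∃ v ∉ X, pos v < q
    swap
    · push Not at hne
      rw [Finset.filter_false_of_mem]
      · simp
      · rintro v - ⟨hv, hvq⟩
        have := hne v hv
        omega
    obtain ⟨v₀, hv₀, hv₀q⟩ := hne
    set S : Finset V := Finset.univ.filter fun b => b ∉ X ∧ pos b < q ∧
      ∀ u ∉ X, pos u < pos b → ¬ G.Adj u b with hS
    have hSne : S.Nonempty := by
      obtain ⟨b, hb, hbmin⟩ := Finset.exists_min_image
        (Finset.univ.filter fun v => v ∉ X ∧ pos v < q) pos ⟨v₀, by simp [hv₀, hv₀q]⟩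
      simp only [Finset.mem_filter, Finset.mem_univ, true_and] at hb hbmin
      refine ⟨b, ?_⟩
      simp only [hS, Finset.mem_filter, Finset.mem_univ, true_and]
      refine ⟨hb.1, hb.2, fun u hu hub => ?_⟩
      have := hbmin u ⟨hu, by omega⟩
      omega
    obtain ⟨b, hb, hbmax⟩ := Finset.exists_max_image S pos hSne
    simp only [hS, Finset.mem_filter, Finset.mem_univ, true_and] at hb hbmax
    obtain ⟨hbX, hbq, hbadj⟩ := hb
    -- By the choice of `b` every later survivor before `q` has an earlier surviving neighbour `u`.
    -- If `u` came before `b`, the left order would make it adjacent to `b`, which starts a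
    -- component. So descending along such neighbours ends at `b`.
    have hreach : ∀ m v, pos v = m → ∀ hv : v ∉ X, pos b ≤ pos v → pos v < q →
        (deleteVertices G X).Reachable ⟨v, hv⟩ ⟨b, hbX⟩ := by
      intro m
      induction m using Nat.strong_induction_on with
      | _ m ihm =>
        intro v hm hv hbv hvq
        by_cases hvb : v = b
        · subst hvb; exact SimpleGraph.Reachable.refl _
        have hlt : pos b < pos v :=
          lt_of_le_of_ne hbv fun he => hvb (hpos.injective he.symm)
        have : ¬ ∀ u ∉ X, pos u < pos v → ¬ G.Adj u v := by
          intro hcon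
          have := hbmax v ⟨hv, hvq, hcon⟩
          omega
        push Not at this
        obtain ⟨u, hu, huv, hadj⟩ := this
        have hbu : pos b ≤ pos u := by
          by_contra hcon
          exact hbadj u hu (by omega) (hpos.adj u b v (by omega) hlt hadj)
        have h1 := ihm (pos u) (by omega) u rfl hu hbu (by omega)
        refine SimpleGraph.Reachable.trans (SimpleGraph.Adj.reachable ?_) h1
        exact hadj.symm
    -- This concerns all neighbours, also deleted ones: a neighbour of `v` at or beyond `q` would
    -- make `v` adjacent to the vertex at `q`.
    have hin : ∀ v ∉ X, pos v < q → last v < q := by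
      intro v hv hvq
      obtain ⟨w, hw, hlw⟩ := hlast.exists_eq v
      by_contra hcon
      have hwq : q ≤ pos w := by omega
      rcases hcut with rfl | ⟨c, hc, hcq, hcadj⟩
      · have := hcard w
        omega
      · rcases hw with rfl | hw
        · omega
        · refine hcadj v hv hvq ?_
          by_cases hwc : w = c
          · exact hwc ▸ hw
          · have : pos w ≠ pos c := fun he => hwc (hpos.injective he)
            exact hpos.adj v c w (by omega) (by omega) hw
    set T : Finset V := Finset.univ.filter fun v => v ∉ X ∧ pos b ≤ pos v ∧ pos v < q with hT
    have hTl : T.card ≤ l := by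
      refine hX ⟨b, hbX⟩ T fun u hu => ?_
      simp only [hT, Finset.mem_filter, Finset.mem_univ, true_and] at hu
      exact ⟨hu.1, hreach _ u rfl hu.1 hu.2.1 hu.2.2⟩
    have hTi : T.card ≤ innerCount pos last (pos b) q := by
      refine Finset.card_le_card fun u hu => ?_
      simp only [hT, Finset.mem_filter, Finset.mem_univ, true_and] at hu ⊢
      exact ⟨hu.2.1, hin u hu.1 hu.2.2⟩
    have hP := ih (pos b) hbq (by omega) (Or.inr ⟨b, hbX, rfl, hbadj⟩)
    have hsum : (Finset.univ.filter fun v => v ∉ X ∧ pos v < q).card ≤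
        (Finset.univ.filter fun v => v ∉ X ∧ pos v < pos b).card + T.card := by
      refine le_trans (Finset.card_le_card ?_) (Finset.card_union_le _ _)
      intro u hu
      simp only [hT, Finset.mem_filter, Finset.mem_univ, true_and, Finset.mem_union] at hu ⊢
      by_cases h1 : pos u < pos b
      · exact Or.inl ⟨hu.1, h1⟩
      · exact Or.inr ⟨hu.1, by omega, hu.2⟩
    have hn : (Finset.univ.filter fun v => v ∉ X ∧ pos v < q).card ≤ Fintype.card V :=
      Finset.card_le_univ _
    obtain ⟨q, rfl⟩ : ∃ q', q = q' + 1 := ⟨q - 1, by omega⟩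
    have := hkeep.le q (by omega) (pos b) (by omega)
    omega

theorem coc_iff_keep (hpos : LeftOrder G pos) (hcard : ∀ v, pos v < Fintype.card V)
    (hlast : LastNeighbor G pos last) (hkeep : KeepTable pos last l keep) (k : ℕ) :
    COC G k l ↔ Fintype.card V ≤ keep (Fintype.card V) + k := by
  classical
  constructor
  · intro h
    obtain ⟨X, hXk, _, hX⟩ := h.exists_bounded_components
    have h1 := card_le_keep hpos hcard hlast hkeep X
      (fun v S hS => by exact_mod_cast hX v S hS) _ le_rfl (Or.inl rfl)
    have h2 : (Finset.univ.filter fun v => v ∉ X ∧ pos v < Fintype.card V) = Xᶜ := by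
      ext v; simp [hcard v]
    rw [h2, Finset.card_compl] at h1
    have := Finset.card_le_univ X
    omega
  · intro h
    obtain ⟨Y, f, hY, _, hf, hl⟩ := exists_labels_of_keep hlast hkeep _ le_rfl
    exact COC.of_labels Y f hf hl (by omega)

end COC

theorem not_coc_of_neg {V : Type*} [Fintype V] {G : SimpleGraph V} {k l : ℤ} (h : k < 0 ∨ l < 0) :
    ¬ COC G k l := by
  intro hc
  obtain ⟨X, hX, hl, _⟩ := hc.exists_bounded_components
  omega

namespace RAM

/-! ### Building blocks of programs and their semantics -/

@[simp] theorem State.setReg_reg (s : State) (r x q : ℕ) :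
    (s.setReg r x).reg q = if q = r then x else s.reg q := by
  simp [State.setReg, Function.update_apply]

@[simp] theorem State.setReg_arr (s : State) (r x : ℕ) : (s.setReg r x).arr = s.arr := rfl

@[simp] theorem State.setArr_reg (s : State) (a i x : ℕ) : (s.setArr a i x).reg = s.reg := rfl

@[simp] theorem State.setArr_arr (s : State) (a i x b j : ℕ) :
    (s.setArr a i x).arr b j = if b = a ∧ j = i then x else s.arr b j := by
  by_cases hb : b = a
  · subst hb; simp [State.setArr, Function.update_apply]
  · simp [State.setArr, hb]

/-- The states agree outside of the given registers and arrays. -/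
def AgreeOff (R B : List ℕ) (s s' : State) : Prop :=
  (∀ r ∉ R, s'.reg r = s.reg r) ∧ ∀ a ∉ B, s'.arr a = s.arr a

theorem AgreeOff.trans {R B : List ℕ} {s s' s'' : State} (h : AgreeOff R B s s')
    (h' : AgreeOff R B s' s'') : AgreeOff R B s s'' :=
  ⟨fun r hr => (h'.1 r hr).trans (h.1 r hr), fun a ha => (h'.2 a ha).trans (h.2 a ha)⟩

theorem AgreeOff.mono {R B R' B' : List ℕ} {s s' : State} (h : AgreeOff R B s s')
    (hR : ∀ r ∈ R, r ∈ R') (hB : ∀ a ∈ B, a ∈ B') : AgreeOff R' B' s s' :=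
  ⟨fun r hr => h.1 r fun hr' => hr (hR r hr'), fun a ha => h.2 a fun ha' => ha (hB a ha')⟩

namespace Cmd

theorem agreeOff_exec (p : Cmd) (s : State) {R B : List ℕ} (hR : ∀ r ∈ p.writtenRegs, r ∈ R)
    (hB : ∀ a ∈ p.writtenArrs, a ∈ B) : AgreeOff R B s (p.exec s) :=
  ⟨fun _ hr => p.exec_reg_of_notMem s fun h => hr (hR _ h),
    fun _ ha => p.exec_arr_of_notMem s fun h => ha (hB _ h)⟩

/-- Among the indices `i < n` with `cond ≠ 0`, look for the first one that is best with respect to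
`better`, which compares the indices in the registers `i` and `b`; `f` tells if there is one. -/
def pick (i f b : ℕ) (cond better : Expr) : Cmd :=
  .seq (.assign f (.const 0)) (.loop i (.ite cond (.ite (.op .eq (.reg f) (.const 0))
    (.seq (.assign f (.const 1)) (.assign b (.reg i)))
    (.ite better (.assign b (.reg i)) .skip)) .skip))

/-- The values `v` are integers so that minima can be found as maxima of negated values. The tests
need to be correct only in states that differ from `s` in the scratch registers. -/
theorem exec_pick {i f b : ℕ} {cond better : Expr} {s : State} (hwf : (pick i f b cond better).wellFormed)
    (hfb : f ≠ b) (hif : i ≠ f) (hib : i ≠ b)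
    (P : ℕ → Prop) (v : ℕ → ℤ)
    (hP : ∀ s', AgreeOff [i, f, b] [] s s' → s'.reg i < s.reg 0 →
      (cond.eval s' ≠ 0 ↔ P (s'.reg i)))
    (hv : ∀ s', AgreeOff [i, f, b] [] s s' → s'.reg i < s.reg 0 → s'.reg b < s.reg 0 →
      (better.eval s' ≠ 0 ↔ v (s'.reg b) < v (s'.reg i))) :
    (((pick i f b cond better).exec s).reg f = 0 ∧ ∀ j < s.reg 0, ¬ P j) ∨
    (((pick i f b cond better).exec s).reg f = 1 ∧ ((pick i f b cond better).exec s).reg b < s.reg 0 ∧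
      P (((pick i f b cond better).exec s).reg b) ∧
      ∀ j < s.reg 0, P j → v j ≤ v (((pick i f b cond better).exec s).reg b)) := by
  simp only [pick, wellFormed, Bool.and_eq_true, bne_iff_ne] at hwf
  have hf0 : (0 : ℕ) ≠ f := by
    intro h
    simp [Expr.linear, Expr.slope] at hwf
    omega
  have hs0 : ((s.setReg f 0).reg 0) = s.reg 0 := by simp [hf0]
  rw [← hs0]
  refine exec_loop (s := s.setReg f 0) (I := fun n s' => AgreeOff [i, f, b] [] s s' ∧
    ((s'.reg f = 0 ∧ ∀ j < n, ¬ P j) ∨ (s'.reg f = 1 ∧ s'.reg b < n ∧ P (s'.reg b) ∧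
      ∀ j < n, P j → v j ≤ v (s'.reg b)))) ?_ ?_ ?_ |>.2
  · simp only [wellFormed, Bool.and_eq_true, bne_iff_ne]; exact hwf.2
  · refine ⟨⟨fun r hr => ?_, fun a _ => rfl⟩, Or.inl ⟨?_, by simp⟩⟩
    · simp only [List.mem_cons, List.not_mem_nil, not_or, or_false] at hr
      simp [hr.1, hr.2.1]
    · simp [hif.symm]
  · intro j s' hj hij h0 ⟨hag, hI⟩
    rw [hs0] at hj
    refine ⟨hag.trans (AgreeOff.trans (agreeOff_exec (.ite cond (.ite (.op .eq (.reg f) (.const 0))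
        (.seq (.assign f (.const 1)) (.assign b (.reg i)))
        (.ite better (.assign b (.reg i)) .skip)) .skip) s' ?_ ?_) ⟨fun r hr => ?_, fun a _ => rfl⟩),
        ?_⟩
    · simp [writtenRegs]
    · simp [writtenArrs]
    · simp only [List.mem_cons, List.not_mem_nil, not_or, or_false] at hr
      simp [hr.1]
    have hc := hP s' hag (by omega)
    have hv' := hv s' hag (by omega)
    rw [hij] at hc
    have hstep : ∀ {Q : ℕ → Prop}, (∀ j' < j, Q j') → Q j → ∀ j' ≤ j, Q j' := by
      intro Q h1 h2 j' hj'
      rcases hj'.lt_or_eq with h | rfl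
      · exact h1 j' h
      · exact h2
    by_cases hcond : P j
    · have hce : cond.eval s' ≠ 0 := hc.2 hcond
      rcases hI with ⟨hf, hno⟩ | ⟨hf, hb, hPb, hmax⟩
      · refine Or.inr ⟨?_, ?_, ?_, ?_⟩ <;>
          simp [exec, hce, Expr.eval, Op.eval, hf, hif.symm, hib.symm, hif, hfb, hij, hcond]
        exact hstep (Q := fun j' => P j' → v j' ≤ v j) (fun j' h h' => absurd h' (hno j' h))
          (fun _ => le_rfl)
      · specialize hv' (by omega)
        rw [hij] at hv'
        by_cases hbet : v (s'.reg b) < v j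
        · have hbe : better.eval s' ≠ 0 := hv'.2 hbet
          refine Or.inr ⟨?_, ?_, ?_, ?_⟩ <;>
            simp [exec, hce, Expr.eval, Op.eval, hf, hif.symm, hib.symm, hfb, hij, hcond, hbe]
          exact hstep (Q := fun j' => P j' → v j' ≤ v j)
            (fun j' h h' => (hmax j' h h').trans hbet.le) (fun _ => le_rfl)
        · have hbe : better.eval s' = 0 := by
            by_contra h; exact hbet (hv'.1 h)
          refine Or.inr ⟨?_, ?_, ?_, ?_⟩ <;>
            simp [exec, hce, Expr.eval, Op.eval, hf, hif.symm, hib.symm, hbe, hPb]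
          · omega
          · exact hstep (Q := fun j' => P j' → v j' ≤ v (s'.reg b)) hmax (fun _ => not_lt.1 hbet)
    · have hce : cond.eval s' = 0 := by
        by_contra h; exact hcond (hc.1 h)
      rcases hI with ⟨hf, hno⟩ | ⟨hf, hb, hPb, hmax⟩
      · refine Or.inl ⟨by simp [exec, hce, hf, hif.symm], 
          fun j' hj' => hstep (Q := fun j' => ¬ P j') hno hcond j' (by omega)⟩
      · refine Or.inr ⟨?_, ?_, ?_, ?_⟩ <;> simp [exec, hce, hf, hif.symm, hib.symm, hPb]
        · omega
        · exact hstep (Q := fun j' => P j' → v j' ≤ v (s'.reg b)) hmax (fun h => absurd h hcond)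

/-- Count the indices `i < n` with `cond ≠ 0`. -/
def count (i r : ℕ) (cond : Expr) : Cmd :=
  .seq (.assign r (.const 0)) (.loop i (.ite cond (.assign r (.op .add (.reg r) (.const 1))) .skip))

open Classical in
theorem exec_count {i r : ℕ} {cond : Expr} {s : State} (hwf : (count i r cond).wellFormed)
    (hir : i ≠ r) (P : ℕ → Prop)
    (hP : ∀ s', AgreeOff [i, r] [] s s' → s'.reg i < s.reg 0 →
      (cond.eval s' ≠ 0 ↔ P (s'.reg i))) :
    ((count i r cond).exec s).reg r = ((Finset.range (s.reg 0)).filter P).card := by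
  simp only [count, wellFormed, Bool.and_eq_true, bne_iff_ne] at hwf
  have hr0 : (0 : ℕ) ≠ r := fun h => hwf.1.2 h.symm
  have hs0 : ((s.setReg r 0).reg 0) = s.reg 0 := by simp [hr0]
  rw [← hs0]
  refine (exec_loop (s := s.setReg r 0) (I := fun n s' => AgreeOff [i, r] [] s s' ∧
    s'.reg r = ((Finset.range n).filter P).card) ?_ ?_ ?_).2
  · simp only [wellFormed, Bool.and_eq_true, bne_iff_ne]; exact hwf.2
  · refine ⟨⟨fun q hq => ?_, fun a _ => rfl⟩, ?_⟩
    · simp only [List.mem_cons, List.not_mem_nil, not_or, or_false] at hq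
      simp [hq.1, hq.2]
    · simp [hir.symm]
  · intro j s' hj hij h0 ⟨hag, hI⟩
    rw [hs0] at hj
    refine ⟨hag.trans (AgreeOff.trans (agreeOff_exec
      (.ite cond (.assign r (.op .add (.reg r) (.const 1))) .skip) s' ?_ ?_)
      ⟨fun q hq => ?_, fun a _ => rfl⟩), ?_⟩
    · simp [writtenRegs]
    · simp [writtenArrs]
    · simp only [List.mem_cons, List.not_mem_nil, not_or, or_false] at hq
      simp [hq.1]
    have hc := hP s' hag (by omega)
    rw [hij] at hc
    rw [Finset.range_add_one, Finset.filter_insert]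
    by_cases hcond : P j
    · have hce : cond.eval s' ≠ 0 := hc.2 hcond
      simp [exec, hce, Expr.eval, Op.eval, hir.symm, hcond, hI]
    · have hce : cond.eval s' = 0 := by
        by_contra h; exact hcond (hc.1 h)
      simp [exec, hce, hir.symm, hcond, hI]

/-- Set all cells `i < n` of an array. -/
def fill (i a : ℕ) (e : Expr) : Cmd :=
  .loop i (.store a (.reg i) e)

/-- The cell that is about to be written still has its old content, which permits updates in place.
-/
theorem exec_fill {i a : ℕ} {e : Expr} {s : State} (hwf : (fill i a e).wellFormed)
    (g : ℕ → ℕ)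
    (hg : ∀ s', AgreeOff [i] [a] s s' → s'.reg i < s.reg 0 →
      s'.arr a (s'.reg i) = s.arr a (s'.reg i) → e.eval s' = g (s'.reg i)) :
    ∀ j < s.reg 0, ((fill i a e).exec s).arr a j = g j := by
  refine (exec_loop (I := fun n s' => AgreeOff [i] [a] s s' ∧ (∀ j < n, s'.arr a j = g j) ∧
    ∀ j, n ≤ j → s'.arr a j = s.arr a j) hwf ?_ ?_).2.1
  · refine ⟨⟨fun q hq => ?_, fun b _ => rfl⟩, by simp, fun _ _ => rfl⟩
    simp only [List.mem_cons, List.not_mem_nil, or_false] at hq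
    simp [hq]
  · intro j s' hj hij h0 ⟨hag, h1, h2⟩
    have hval := hg s' hag (by omega) (h2 _ hij.ge)
    rw [hij] at hval
    refine ⟨hag.trans ⟨fun q hq => ?_, fun b hb => ?_⟩, ?_, ?_⟩
    · simp only [List.mem_cons, List.not_mem_nil, or_false] at hq
      simp [hq, exec]
    · simp only [List.mem_cons, List.not_mem_nil, or_false] at hb
      funext x
      simp [exec, hb]
    · intro j' hj'
      by_cases hjj : j' = j
      · simp [exec, Expr.eval, hij, hjj, hval]
      · simp [exec, Expr.eval, hij, hjj, h1 j' (by omega)]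
    · intro j' hj'
      simp [exec, Expr.eval, hij, h2 j' (by omega), show j' ≠ j by omega]

/-- Set all cells `i < n` of an array to values found by a subroutine. -/
def tabulate (i a : ℕ) (p : Cmd) (e : Expr) : Cmd :=
  .loop i (.seq p (.store a (.reg i) e))

theorem exec_tabulate {i a : ℕ} {p : Cmd} {e : Expr} {s : State}
    (hwf : (tabulate i a p e).wellFormed) (hp : p.writtenArrs = []) (R : ℕ → ℕ → Prop)
    (hR : ∀ s', AgreeOff (i :: p.writtenRegs) [a] s s' → s'.reg i < s.reg 0 →
      s'.reg 0 = s.reg 0 → R (s'.reg i) (e.eval (p.exec s'))) :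
    ∀ j < s.reg 0, R j (((tabulate i a p e).exec s).arr a j) := by
  have hwf' := hwf
  simp only [tabulate, wellFormed, Bool.and_eq_true, bne_iff_ne, Bool.not_eq_true',
      List.contains_eq_mem, decide_eq_false_iff_not, writtenRegs, List.append_nil] at hwf'
  have hi := hwf'.2
  refine (exec_loop (I := fun n s' => AgreeOff (i :: p.writtenRegs) [a] s s' ∧
    (∀ j < n, R j (s'.arr a j))) hwf ?_ ?_).2
  · refine ⟨⟨fun q hq => ?_, fun b _ => rfl⟩, by simp⟩
    simp only [List.mem_cons, not_or] at hq
    simp [hq.1]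
  · intro j s' hj hij h0 ⟨hag, h1⟩
    have hval := hR s' hag (by omega) h0
    rw [hij] at hval
    have hi' : (p.exec s').reg i = j := by rw [exec_reg_of_notMem _ _ hi, hij]
    have harr : ∀ b, (p.exec s').arr b = s'.arr b := fun b =>
      exec_arr_of_notMem _ _ (by simp [hp])
    refine ⟨hag.trans ⟨fun q hq => ?_, fun b hb => ?_⟩, ?_⟩
    · simp only [List.mem_cons, not_or] at hq
      simp [hq.1, exec, exec_reg_of_notMem _ _ hq.2]
    · simp only [List.mem_cons, List.not_mem_nil, or_false] at hb
      funext x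
      simp [exec, hb, harr]
    · intro j' hj'
      by_cases hjj : j' = j
      · subst hjj
        simp [exec, Expr.eval, hi', hval]
      · simp [exec, Expr.eval, hi', hjj, harr, h1 j' (by omega)]

end Cmd

end RAM

/-! ### Invariants of the algorithm -/

section Search

variable {V : Type*} [Fintype V] {G : SimpleGraph V}

open Classical in
/-- The state of a maximum cardinality search after `m` vertices have been visited; `time` is `0` on
the other vertices, and `cnt` counts visited neighbours. -/
structure SearchInvariant (G : SimpleGraph V) (m : ℕ) (time cnt : V → ℕ) : Prop where
  le : ∀ v, time v ≤ m
  injOn : ∀ u v, time u = time v → time u ≠ 0 → u = v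
  exists_eq : ∀ i < m, ∃ v, time v = i + 1
  card : (Finset.univ.filter fun v => time v ≠ 0).card = m
  cnt_eq : ∀ v, cnt v = (Finset.univ.filter fun u => time u ≠ 0 ∧ G.Adj u v).card
  search : ∀ a b c, time a ≠ 0 → time a < time b → (time c = 0 ∨ time b < time c) → G.Adj a c →
    ¬ G.Adj a b → ∃ d, time d ≠ 0 ∧ time d < time b ∧ G.Adj d b ∧ ¬ G.Adj d c

theorem SearchInvariant.init : SearchInvariant G 0 (fun _ => 0) (fun _ => 0) where
  le := by simp
  injOn := by simp
  exists_eq := by simp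
  card := by simp
  cnt_eq := by simp
  search := by simp

namespace SearchInvariant

variable {m : ℕ} {time cnt : V → ℕ}

theorem exists_unvisited (h : SearchInvariant G m time cnt) (hm : m < Fintype.card V) :
    ∃ v, time v = 0 := by
  classical
  by_contra hcon
  push Not at hcon
  have := h.card
  rw [Finset.filter_true_of_mem (fun v _ => hcon v), Finset.card_univ] at this
  omega

open Classical in
-- Visits are numbered from `1`, as `0` marks unvisited vertices. Only triples whose middle vertex
-- is the new one need an argument; there the maximality of the count is used.
theorem step (h : SearchInvariant G m time cnt) {b : V} (hb : time b = 0)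
    (hmax : ∀ c, time c = 0 → cnt c ≤ cnt b) {time' cnt' : V → ℕ}
    (htime : ∀ v, time' v = if v = b then m + 1 else time v)
    (hcnt : ∀ v, cnt' v = cnt v + if G.Adj b v then 1 else 0) :
    SearchInvariant G (m + 1) time' cnt' := by
  have hb' : time' b = m + 1 := by simp [htime]
  have hne : ∀ {v}, v ≠ b → time' v = time v := fun hv => by simp [htime, hv]
  have hvis : (Finset.univ.filter fun v => time' v ≠ 0) =
      insert b (Finset.univ.filter fun v => time v ≠ 0) := by
    ext v
    by_cases hv : v = b <;> simp [htime, hv]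
  refine ⟨fun v => ?_, fun u v huv hu => ?_, fun i hi => ?_, ?_, fun v => ?_, ?_⟩
  · have := h.le v
    rw [htime]; split <;> omega
  · by_cases hub : u = b <;> by_cases hvb : v = b
    · rw [hub, hvb]
    · have := h.le v; rw [hub, hb', hne hvb] at huv; omega
    · have := h.le u; rw [hvb, hb', hne hub] at huv; omega
    · rw [hne hub, hne hvb] at huv; rw [hne hub] at hu; exact h.injOn u v huv hu
  · by_cases him : i = m
    · exact ⟨b, by rw [hb', him]⟩
    · obtain ⟨v, hv⟩ := h.exists_eq i (by omega)
      refine ⟨v, ?_⟩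
      rw [hne, hv]
      rintro rfl; omega
  · rw [hvis, Finset.card_insert_of_notMem (by simp [hb]), h.card]
  · rw [hcnt, h.cnt_eq]
    by_cases hadj : G.Adj b v
    · have : (Finset.univ.filter fun u => time' u ≠ 0 ∧ G.Adj u v) =
          insert b (Finset.univ.filter fun u => time u ≠ 0 ∧ G.Adj u v) := by
        ext u
        by_cases hu : u = b <;> simp [htime, hu, hadj]
      rw [this, Finset.card_insert_of_notMem (by simp [hb]), if_pos hadj]
    · rw [if_neg hadj, Nat.add_zero]
      congr 1
      ext u
      by_cases hu : u = b <;> simp [htime, hu, hadj]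
  · intro a c d ha hac hcd had hac'
    have hab : a ≠ b := by
      rintro rfl
      rw [hb'] at hac
      have : time' c ≤ m + 1 := by
        rw [htime]; have := h.le c; split <;> omega
      omega
    by_cases hcb : c = b
    · subst hcb
      have hdc : d ≠ c := by rintro rfl; omega
      have hd0 : time d = 0 := by
        have := h.le d
        rw [hne hdc, hb'] at hcd
        omega
      by_contra hcon
      push Not at hcon
      -- Without a suitable vertex, every visited neighbour of the new vertex `c` would be a
      -- neighbour of `d`, and `a` would be an additional one.
      have hlt : cnt c < cnt d := by
        rw [h.cnt_eq, h.cnt_eq]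
        refine Finset.card_lt_card ?_
        rw [Finset.ssubset_iff_of_subset]
        · exact ⟨a, by simpa [← hne hab, ha] using had, by simpa using fun _ => hac'⟩
        · intro u hu
          simp only [Finset.mem_filter, Finset.mem_univ, true_and] at hu ⊢
          have huc : u ≠ c := by rintro rfl; exact hu.1 hb
          refine ⟨hu.1, hcon u (by rw [hne huc]; exact hu.1) ?_ hu.2⟩
          have := h.le u
          rw [hne huc, hb']; omega
      have := hmax d hd0
      omega
    · have hcd' : time d = 0 ∨ time c < time d := by
        by_cases hdb : d = b
        · exact Or.inl (hdb ▸ hb)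
        · rwa [hne hcb, hne hdb] at hcd
      rw [hne hab, hne hcb] at hac
      rw [hne hab] at ha
      obtain ⟨e, he0, hec, hecadj, hed⟩ := h.search a c d ha hac hcd' had hac'
      have heb : e ≠ b := by rintro rfl; exact he0 hb
      exact ⟨e, by rwa [hne heb], by rwa [hne heb, hne hcb], hecadj, hed⟩

theorem earlierCliques (h : SearchInvariant G (Fintype.card V) time cnt) {r : V → V → Prop}
    (hr : IntervalModel G r) : EarlierCliques G time ∧ ∀ v, time v ≠ 0 := by
  classical
  have hvis : ∀ v, time v ≠ 0 := by
    intro v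
    have h1 := (Finset.card_eq_iff_eq_univ _).1 h.card
    have : v ∈ Finset.univ.filter fun v => time v ≠ 0 := by rw [h1]; exact Finset.mem_univ v
    simpa using this
  have hinj : Function.Injective time := fun u v huv => h.injOn u v huv (hvis u)
  refine ⟨⟨hinj, fun u w v hu hw htu htw huw => ?_⟩, hvis⟩
  refine hr.earlier_adj time hinj (fun a b c hab hbc hac hac' => ?_) hu.symm hw.symm htu htw huw
  obtain ⟨d, _, h1, h2, h3⟩ := h.search a b c (hvis a) hab (Or.inr hbc) hac hac'
  exact ⟨d, h1, h2, h3⟩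

end SearchInvariant

/-- `w` witnesses that the clique of `v` is not maximal. -/
def Extends (G : SimpleGraph V) (t : V → ℕ) (w v : V) : Prop :=
  IsParent G t w v ∧ cliqueSize G t w = cliqueSize G t v + 1

/-- The state of the computation of maximal cliques after the vertices later than `m` have been
processed. -/
structure RepInvariant (G : SimpleGraph V) (t : V → ℕ) (m : ℕ) (rep : V → V) : Prop where
  subset : ∀ v x, InClique G t v x → InClique G t (rep v) x
  maximal : ∀ v w, m < t w → Extends G t w v → CliqueMaximal G t (rep v)
  eq_self : ∀ v, (∀ w, m < t w → ¬ Extends G t w v) → rep v = v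

namespace RepInvariant

variable {t : V → ℕ} {m : ℕ} {rep : V → V}

theorem init (hm : ∀ v, t v ≤ m) : RepInvariant G t m id where
  subset _ _ h := h
  maximal v w hw := absurd (hm w) (by omega)
  eq_self _ _ := rfl

/-- All extensions of the clique of `v` come from vertices later than `v`, and these have been
processed already. -/
theorem maximal_rep (h : RepInvariant G t m rep) (ht : EarlierCliques G t) {v : V}
    (hv : m ≤ t v) : CliqueMaximal G t (rep v) := by
  by_cases hex : ∃ w, Extends G t w v
  · obtain ⟨w, hw⟩ := hex
    have := hw.1.1.2
    exact h.maximal v w (by omega) hw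
  · push Not at hex
    rw [h.eq_self v fun w _ => hex w]
    by_contra hcon
    obtain ⟨w, hw⟩ := ht.exists_child_of_not_maximal hcon
    exact hex w hw

/-- The clique of `w` contains that of `v`, and its representative is final because everything later
than `w` is done. If several vertices extend `v`, each overwrites the representative with an equally
good one. -/
theorem step_of_extends (h : RepInvariant G t (m + 1) rep) (ht : EarlierCliques G t) {w v : V}
    (hw : t w = m + 1) (hwv : Extends G t w v) {rep' : V → V} (hv : rep' v = rep w)
    (hne : ∀ u, u ≠ v → rep' u = rep u) : RepInvariant G t m rep' := by
  refine ⟨fun u x hx => ?_, fun u z hz hzu => ?_, fun u hu => ?_⟩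
  · by_cases huv : u = v
    · subst huv
      rw [hv]
      exact h.subset w x (Or.inr (ht.inClique_of_size hwv.1 hwv.2 hx))
    · rw [hne u huv]; exact h.subset u x hx
  · by_cases huv : u = v
    · subst huv
      rw [hv]
      exact h.maximal_rep ht hw.ge
    · rw [hne u huv]
      refine h.maximal u z (lt_of_le_of_ne hz fun he => ?_) hzu
      have : z = w := ht.injective (by omega)
      subst this
      refine huv (ht.injective (le_antisymm (hwv.1.2 u hzu.1.1) (hzu.1.2 v hwv.1.1)))
  · have huv : u ≠ v := by
      rintro rfl
      exact hu w (by omega) hwv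
    rw [hne u huv]
    exact h.eq_self u fun z hz => hu z (by omega)

theorem step_of_not_extends (h : RepInvariant G t (m + 1) rep) (ht : EarlierCliques G t) {w : V}
    (hw : t w = m + 1) (hwv : ∀ v, ¬ Extends G t w v) : RepInvariant G t m rep := by
  refine ⟨h.subset, fun u z hz hzu => ?_, fun u hu => h.eq_self u fun z hz => hu z (by omega)⟩
  refine h.maximal u z (lt_of_le_of_ne hz fun he => ?_) hzu
  have : z = w := ht.injective (by omega)
  subst this
  exact hwv u hzu

theorem cliqueRep (h : RepInvariant G t 0 rep) (ht : EarlierCliques G t) :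
    CliqueRep G t rep where
  subset := h.subset
  maximal _ := h.maximal_rep ht (Nat.zero_le _)
  eq_self _ hv := h.eq_self _ fun _ _ hw => ht.not_maximal_of_size hw.1 hw.2 hv

end RepInvariant

end Search

/-! ### Bookkeeping for the refinement process. -/

section Refinement

variable {V : Type*} [Fintype V] {A : V → V → Prop} {S : V → V → Prop} {e₁ e₂ : V → V}
  {prio : V → ℕ}

/-- The sets `{c | A c x}` are connected by the edges `e₁ v — e₂ v` with `S v x`. -/
structure CliqueTree (A S : V → V → Prop) (e₁ e₂ : V → V) : Prop where
  constant : ∀ (f : V → ℕ) (x : V), (∀ v, S v x → f (e₁ v) = f (e₂ v)) →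
    ∀ c d, A c x → A d x → f c = f d
  mem : ∀ v x, S v x → A (e₁ v) x ∧ A (e₂ v) x

/-- The sets `pend = 1` and `pend = 2` consist of the pivots which wait and which have been
processed, `used` of the processed edges, and `chosen` of the elements which have been split off. -/
structure RefineInvariant (A S : V → V → Prop) (prio : V → ℕ) (key pend used chosen : V → ℕ) :
    Prop where
  pend_le : ∀ x, pend x ≤ 2
  straddles : ∀ x, pend x = 1 → Straddles A key x
  settled : ∀ x, pend x = 2 → Settled A key x
  pend_ne : ∀ v x, used v ≠ 0 → S v x → pend x ≠ 0
  eq_of_chosen : ∀ c d, chosen c ≠ 0 → key d = key c → d = c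
  steps : Relation.ReflTransGen (RefineStep A prio) (fun _ => 0) key

open Classical in
/-- The number of things done so far. -/
noncomputable def progress (pend used chosen : V → ℕ) : ℕ :=
  (Finset.univ.filter fun x => pend x = 2).card + (Finset.univ.filter fun v => used v ≠ 0).card +
    (Finset.univ.filter fun c => chosen c ≠ 0).card

omit [Fintype V] in
theorem RefineInvariant.init :
    RefineInvariant A S prio (fun _ => 0) (fun _ => 0) (fun _ => 0) (fun _ => 0) where
  pend_le := by simp
  straddles := by simp
  settled := by simp
  pend_ne := by simp
  eq_of_chosen := by simp
  steps := .refl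

namespace RefineInvariant

variable {key pend used chosen key' pend' used' chosen' : V → ℕ}

theorem pivot (h : RefineInvariant A S prio key pend used chosen) {x lo hi : V}
    (hx : pend x = 1) (hlo : A lo x) (hhi : A hi x)
    (hle : ∀ c, A c x → key lo ≤ key c ∧ key c ≤ key hi)
    (hkey : key' = pivotKey A key x (key lo) (key hi))
    (hpend : pend' x = 2) (hpend' : ∀ y, y ≠ x → pend' y = pend y) :
    RefineInvariant A S prio key' pend' used chosen ∧
      progress pend used chosen < progress pend' used chosen := by
  classical
  obtain ⟨c, d, hc, hd, hcd⟩ := h.straddles x hx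
  have hlt : key lo < key hi := by
    have := hle c hc
    have := hle d hd
    omega
  have hstep : RefineStep A prio key key' := hkey ▸ RefineStep.pivot x lo hi hlo hhi hle hlt
  refine ⟨⟨fun y => ?_, fun y hy => ?_, fun y hy => ?_, fun v y hv hy => ?_, fun c d hc hcd => ?_,
    h.steps.tail hstep⟩, ?_⟩
  · by_cases hyx : y = x
    · rw [hyx, hpend]
    · rw [hpend' y hyx]; exact h.pend_le y
  · by_cases hyx : y = x
    · rw [hyx, hpend] at hy; omega
    · rw [hpend' y hyx] at hy; exact (h.straddles y hy).step hstep
  · by_cases hyx : y = x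
    · rw [hyx, hkey]; exact settled_pivotKey hlo hhi hle hlt
    · rw [hpend' y hyx] at hy; exact (h.settled y hy).step hstep
  · by_cases hyx : y = x
    · rw [hyx, hpend]; omega
    · rw [hpend' y hyx]; exact h.pend_ne v y hv hy
  · refine h.eq_of_chosen c d hc ?_
    by_contra hne
    exact hstep.ne hne hcd
  · have : (Finset.univ.filter fun y => pend' y = 2) =
        insert x (Finset.univ.filter fun y => pend y = 2) := by
      ext y
      by_cases hyx : y = x
      · simp [hyx, hpend]
      · simp [hyx, hpend' y hyx]
    simp only [progress]
    rw [this, Finset.card_insert_of_notMem (by simp [hx])]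
    omega

/-- Both ends of the edge belong to the set of every `x` on it, so once the ends are in different
classes all these `x` straddle and become pivots. -/
theorem edge (h : RefineInvariant A S prio key pend used chosen) (hT : CliqueTree A S e₁ e₂) {v : V}
    (hv : used v = 0) (hkey : key (e₁ v) ≠ key (e₂ v))
    (hused : used' v = 1) (hused' : ∀ w, w ≠ v → used' w = used w)
    (hpend : ∀ x, pend x = 0 → S v x → pend' x = 1)
    (hpend' : ∀ x, ¬ (pend x = 0 ∧ S v x) → pend' x = pend x) :
    RefineInvariant A S prio key pend' used' chosen ∧
      progress pend used chosen < progress pend' used' chosen := by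
  classical
  have hcase : ∀ x, (pend x = 0 ∧ S v x ∧ pend' x = 1) ∨ pend' x = pend x := by
    intro x
    by_cases hx : pend x = 0 ∧ S v x
    · exact Or.inl ⟨hx.1, hx.2, hpend x hx.1 hx.2⟩
    · exact Or.inr (hpend' x hx)
  refine ⟨⟨fun x => ?_, fun x hx => ?_, fun x hx => ?_, fun w x hw hx => ?_, h.eq_of_chosen,
    h.steps⟩, ?_⟩
  · have := h.pend_le x
    rcases hcase x with h1 | h1 <;> omega
  · rcases hcase x with h1 | h1
    · obtain ⟨h2, h3⟩ := hT.mem v x h1.2.1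
      exact ⟨_, _, h2, h3, hkey⟩
    · exact h.straddles x (by omega)
  · rcases hcase x with h1 | h1
    · omega
    · exact h.settled x (by omega)
  · by_cases hwv : w = v
    · rcases hcase x with h1 | h1
      · omega
      · intro h0
        have := hpend x (by omega) (hwv ▸ hx)
        omega
    · rw [hused' w hwv] at hw
      have := h.pend_ne w x hw hx
      rcases hcase x with h1 | h1 <;> omega
  · have h1 : (Finset.univ.filter fun w => used' w ≠ 0) =
        insert v (Finset.univ.filter fun w => used w ≠ 0) := by
      ext w
      by_cases hwv : w = v
      · simp [hwv, hused]
      · simp [hwv, hused' w hwv]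
    have h2 : (Finset.univ.filter fun x => pend' x = 2) =
        Finset.univ.filter fun x => pend x = 2 := by
      ext x
      simp only [Finset.mem_filter, Finset.mem_univ, true_and]
      rcases hcase x with h1 | h1 <;> omega
    simp only [progress]
    rw [h1, h2, Finset.card_insert_of_notMem (by simp [hv])]
    omega

/-- If the set of `x` straddles, some tree edge of `x` joins different classes. This edge has been
used, so `x` has become a pivot; as none is waiting, `x` has been processed and is settled. Thus
waiting pivots and tree edges suffice to certify that a split is allowed. -/
theorem split (h : RefineInvariant A S prio key pend used chosen) (hT : CliqueTree A S e₁ e₂)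
    (hpend : ∀ x, pend x ≠ 1) (hused : ∀ v, used v = 0 → key (e₁ v) = key (e₂ v)) {C : V}
    (hC : chosen C = 0) (hmax : ∀ c, chosen c = 0 → prio c ≤ prio C)
    (hkey : key' = splitKey key C) (hchosen : chosen' C = 1)
    (hchosen' : ∀ c, c ≠ C → chosen' c = chosen c) :
    RefineInvariant A S prio key' pend used chosen' ∧
      progress pend used chosen < progress pend used chosen' := by
  classical
  have hfree : ∀ x, Straddles A key x → Settled A key x := by
    rintro x ⟨c, d, hc, hd, hcd⟩
    have hex : ∃ v, S v x ∧ key (e₁ v) ≠ key (e₂ v) := by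
      by_contra hcon
      push Not at hcon
      exact hcd (hT.constant key x hcon c d hc hd)
    obtain ⟨v, hvx, hv⟩ := hex
    have h1 : used v ≠ 0 := fun h0 => hv (hused v h0)
    have h2 := h.pend_ne v x h1 hvx
    have h3 := hpend x
    have h4 := h.pend_le x
    exact h.settled x (by omega)
  -- Elements chosen before are alone in their classes, so the maximum over the unchosen ones is a
  -- maximum over the class.
  have hprio : ∀ c, key c = key C → prio c ≤ prio C := by
    intro c hc
    by_cases hch : chosen c = 0
    · exact hmax c hch
    · rw [h.eq_of_chosen c C hch hc.symm]
  have hstep : RefineStep A prio key key' := hkey ▸ RefineStep.split C hfree hprio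
  refine ⟨⟨h.pend_le, fun x hx => absurd hx (hpend x), fun x hx => (h.settled x hx).step hstep,
    h.pend_ne, fun c d hc hcd => ?_, h.steps.tail hstep⟩, ?_⟩
  · have hcd' : key d = key c := by
      by_contra hne
      exact hstep.ne hne hcd
    by_cases hcC : c = C
    · subst hcC
      by_contra hne
      rw [hkey] at hcd
      simp [splitKey, hcd', hne] at hcd
    · rw [hchosen' c hcC] at hc
      exact h.eq_of_chosen c d hc hcd'
  · have : (Finset.univ.filter fun c => chosen' c ≠ 0) =
        insert C (Finset.univ.filter fun c => chosen c ≠ 0) := by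
      ext c
      by_cases hcC : c = C
      · simp [hcC, hchosen]
      · simp [hcC, hchosen' c hcC]
    simp only [progress]
    rw [this, Finset.card_insert_of_notMem (by simp [hC])]
    omega

omit [Fintype V] in
theorem injective_of_chosen (h : RefineInvariant A S prio key pend used chosen)
    (hall : ∀ c, chosen c ≠ 0) : Function.Injective key :=
  fun c d hcd => h.eq_of_chosen d c (hall d) hcd

end RefineInvariant

/-- Each of the three counts is at most the number of vertices, so a total of three times this
number exhausts all of them. -/
theorem chosen_of_progress {pend used chosen : V → ℕ}
    (h : 3 * Fintype.card V ≤ progress pend used chosen) : ∀ c, chosen c ≠ 0 := by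
  classical
  have h1 : (Finset.univ.filter fun x => pend x = 2).card ≤ Fintype.card V := Finset.card_le_univ _
  have h2 : (Finset.univ.filter fun v => used v ≠ 0).card ≤ Fintype.card V := Finset.card_le_univ _
  have h3 : (Finset.univ.filter fun c => chosen c ≠ 0).card ≤ Fintype.card V :=
    Finset.card_le_univ _
  simp only [progress] at h
  have h4 := (Finset.card_eq_iff_eq_univ _).1
    (show (Finset.univ.filter fun c => chosen c ≠ 0).card = Fintype.card V by omega)
  intro c
  have : c ∈ Finset.univ.filter fun c => chosen c ≠ 0 := by rw [h4]; exact Finset.mem_univ c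
  simpa using this

end Refinement

open Classical in
theorem cliqueSize_eq {V : Type*} [Fintype V] (G : SimpleGraph V) (t : V → ℕ) (v : V) :
    cliqueSize G t v = (Finset.univ.filter (Earlier G t v)).card + 1 := by
  have : (Finset.univ.filter (InClique G t v)) =
      insert v (Finset.univ.filter (Earlier G t v)) := by
    ext y; simp [InClique]
  rw [cliqueSize, this, Finset.card_insert_of_notMem]
  simp [Earlier]

open Classical in
theorem card_range_filter {n : ℕ} (P : Fin n → Prop) :
    ((Finset.range n).filter fun j => ∃ hj : j < n, P ⟨j, hj⟩).card =
      (Finset.univ.filter P).card := by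
  rw [← Finset.card_map Fin.valEmbedding]
  congr 1
  ext j
  simp only [Finset.mem_filter, Finset.mem_range, Finset.mem_map, Finset.mem_univ, true_and,
    Fin.valEmbedding_apply]
  constructor
  · rintro ⟨_, hj, h⟩; exact ⟨⟨j, hj⟩, h, rfl⟩
  · rintro ⟨a, h, rfl⟩; exact ⟨a.2, a.2, h⟩

namespace RAM

/-! ### Computing the maximal cliques -/

namespace Expr

abbrev isZero (x : Expr) : Expr := op .eq x (const 0)

/-- The entry of the adjacency matrix for the vertices in the registers `u`, `v`. -/
def adjacency (u v : ℕ) : Expr :=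
  get 0 (op .add (op .mul (reg u) (reg 0)) (reg v))

/-- Whether the vertex in register `v` is an earlier neighbour of that in register `u`. -/
def earlier (u v : ℕ) : Expr :=
  op .mul (op .lt (const 0) (adjacency u v)) (op .lt (get 1 (reg v)) (get 1 (reg u)))

theorem eval_lt {s : State} {x y : Expr} {p : Prop} [Decidable p] (h : x.eval s < y.eval s ↔ p) :
    (op .lt x y).eval s = if p then 1 else 0 := by
  by_cases hp : p
  · rw [if_pos hp]; exact if_pos (h.2 hp)
  · rw [if_neg hp]; exact if_neg fun hx => hp (h.1 hx)

end Expr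

/-- The graph `G` is stored in array `0`, and register `0` holds the number of vertices. -/
structure Encodes {n : ℕ} (G : SimpleGraph (Fin n)) (s : State) : Prop where
  reg_zero : s.reg 0 = n
  adj_iff : ∀ u v : Fin n, s.arr 0 (u * n + v) ≠ 0 ↔ G.Adj u v

theorem Encodes.of_agreeOff {n : ℕ} {G : SimpleGraph (Fin n)} {s s' : State} (h : Encodes G s)
    {R B : List ℕ} (hs : AgreeOff R B s s') (hR : 0 ∉ R) (hB : 0 ∉ B) : Encodes G s' :=
  ⟨(hs.1 0 hR).trans h.reg_zero, fun u v => by rw [hs.2 0 hB]; exact h.adj_iff u v⟩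

theorem instanceState_encodes {n : ℕ} (G : SimpleGraph (Fin n)) (k l : ℤ) :
    Encodes G (instanceState G k l) := by
  refine ⟨by simp [instanceState], fun u v => ?_⟩
  have hiff : (∃ u' v' : Fin n, (u : ℕ) * n + v = u' * n + v' ∧ G.Adj u' v') ↔ G.Adj u v := by
    constructor
    · rintro ⟨u', v', he, hadj⟩
      have hn : 0 < n := u.pos
      have h1 : (v : ℕ) = v' := by
        have := congrArg (· % n) he
        simpa [Nat.mul_add_mod_of_lt, Nat.add_mod, Nat.mod_eq_of_lt] using this
      have h2 : (u : ℕ) = u' := by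
        rw [h1] at he
        exact Nat.eq_of_mul_eq_mul_right hn (by omega)
      rwa [Fin.ext h1, Fin.ext h2]
    · exact fun h => ⟨u, v, rfl, h⟩
  simp only [instanceState, true_and, hiff]
  split_ifs with h
  · simpa using hiff.1 h.2
  · simpa using fun hadj => h ⟨rfl, hiff.2 hadj⟩

section

variable {n : ℕ} {G : SimpleGraph (Fin n)} {s : State}

theorem Encodes.adjacency_iff (h : Encodes G s) {u v : ℕ} (hu : s.reg u < n) (hv : s.reg v < n) :
    (Expr.adjacency u v).eval s ≠ 0 ↔ G.Adj ⟨s.reg u, hu⟩ ⟨s.reg v, hv⟩ := by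
  simp only [Expr.adjacency, Expr.eval, Op.eval, h.reg_zero]
  exact h.adj_iff ⟨s.reg u, hu⟩ ⟨s.reg v, hv⟩

theorem Encodes.earlier_iff (h : Encodes G s) {t : Fin n → ℕ} (ht : ∀ v : Fin n, s.arr 1 v = t v)
    {u v : ℕ} (hu : s.reg u < n) (hv : s.reg v < n) :
    (Expr.earlier u v).eval s ≠ 0 ↔ Earlier G t ⟨s.reg u, hu⟩ ⟨s.reg v, hv⟩ := by
  have h1 := h.adjacency_iff hu hv
  have h2 := ht ⟨s.reg u, hu⟩
  have h3 := ht ⟨s.reg v, hv⟩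
  simp only at h2 h3
  simp only [Expr.earlier, Expr.eval, Op.eval, Earlier, ← h1, ← h2, ← h3, Nat.pos_iff_ne_zero]
  split_ifs <;> simp_all

end

namespace Cmd

/-- Maximum cardinality search: array `1` gets the times of the visits, array `2` counts visited
neighbours, and array `3` gets the vertices in the order of their visits. -/
def search : Cmd :=
  .loop 5 (.seq (pick 6 7 8 (.isZero (.get 1 (.reg 6))) (.op .lt (.get 2 (.reg 8)) (.get 2 (.reg 6))))
    (.seq (.store 1 (.reg 8) (.op .add (.reg 5) (.const 1)))
    (.seq (.store 3 (.reg 5) (.reg 8))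
    (fill 6 2 (.op .add (.get 2 (.reg 6)) (.op .lt (.const 0) (.adjacency 8 6)))))))

variable {n : ℕ} {G : SimpleGraph (Fin n)} {s : State}

theorem exec_search (hG : Encodes G s) (h1 : ∀ v, s.arr 1 v = 0) (h2 : ∀ v, s.arr 2 v = 0) :
    (∃ cnt, SearchInvariant G n (fun v : Fin n => (search.exec s).arr 1 v) cnt) ∧
    ∀ v : Fin n, (search.exec s).arr 1 v ≠ 0 →
      (search.exec s).arr 3 ((search.exec s).arr 1 v - 1) = v := by
  classical
  have key := exec_loop (s := s) (i := 5)
    (p := (.seq (pick 6 7 8 (.isZero (.get 1 (.reg 6))) (.op .lt (.get 2 (.reg 8)) (.get 2 (.reg 6))))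
    (.seq (.store 1 (.reg 8) (.op .add (.reg 5) (.const 1)))
    (.seq (.store 3 (.reg 5) (.reg 8))
    (fill 6 2 (.op .add (.get 2 (.reg 6)) (.op .lt (.const 0) (.adjacency 8 6))))))))
    (I := fun m s' => AgreeOff [5, 6, 7, 8] [1, 2, 3] s s' ∧
    SearchInvariant G m (fun v : Fin n => s'.arr 1 v) (fun v : Fin n => s'.arr 2 v) ∧
    ∀ v : Fin n, s'.arr 1 v ≠ 0 → s'.arr 3 (s'.arr 1 v - 1) = v) (by rfl) ?_ ?_
  · rw [hG.reg_zero] at key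
    exact ⟨⟨_, key.2.1⟩, key.2.2⟩
  · refine ⟨⟨fun r hr => ?_, fun _ _ => rfl⟩, ?_, ?_⟩
    · simp only [List.mem_cons, not_or] at hr
      simp [hr.1]
    · simp only [State.setReg_arr, h1, h2]
      exact SearchInvariant.init
    · simp [h1]
  · rintro m s' hm h5 h0 ⟨hag, hinv, hord⟩
    have hG' := hG.of_agreeOff hag (by simp) (by simp)
    rw [hG.reg_zero] at hm h0
    simp only [exec]
    have hpick := exec_pick (i := 6) (f := 7) (b := 8) (cond := .isZero (.get 1 (.reg 6)))
      (better := .op .lt (.get 2 (.reg 8)) (.get 2 (.reg 6))) (s := s') (by rfl) (by omega) (by omega)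
      (by omega) (fun j => s'.arr 1 j = 0) (fun j => s'.arr 2 j)
      (fun s'' hs'' _ => by simp [Expr.eval, Op.eval, hs''.2])
      (fun s'' hs'' _ _ => by simp [Expr.eval, Op.eval, hs''.2])
    have hag1 := agreeOff_exec (pick 6 7 8 (.isZero (.get 1 (.reg 6)))
      (.op .lt (.get 2 (.reg 8)) (.get 2 (.reg 6)))) s' (R := [6, 7, 8]) (B := [])
      (by simp [pick, writtenRegs]) (by simp [pick, writtenArrs])
    set s₁ := (pick 6 7 8 (.isZero (.get 1 (.reg 6)))
      (.op .lt (.get 2 (.reg 8)) (.get 2 (.reg 6)))).exec s'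
    have harr : s₁.arr = s'.arr := funext fun a => hag1.2 a (by simp)
    rw [h0] at hpick
    obtain ⟨v₀, hv₀⟩ := hinv.exists_unvisited (by simpa using hm)
    rcases hpick with hpick | ⟨-, hbn, hb0, hbmax⟩
    · exact absurd hv₀ (hpick.2 v₀ v₀.2)
    set b : Fin n := ⟨s₁.reg 8, hbn⟩ with hb
    have hr5 : s₁.reg 5 = m := by rw [hag1.1 5 (by simp), h5]
    have hr8 : s₁.reg 8 = b := rfl
    simp only [Expr.eval, Op.eval, hr5, hr8, State.setArr_reg]
    set s₂ := (s₁.setArr 1 b (m + 1)).setArr 3 m b with hs₂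
    have hG₂ : Encodes G s₂ := by
      refine ⟨by simp [hs₂, hag1.1 0, h0], fun u v => ?_⟩
      have : s₂.arr 0 = s'.arr 0 := by funext j; simp [hs₂, harr]
      rw [this]; exact hG'.adj_iff u v
    have h2₂ : ∀ j, s₂.arr 2 j = s'.arr 2 j := fun j => by simp [hs₂, harr]
    have h8₂ : s₂.reg 8 = b := by simp [hs₂, hr8]
    have hfill := exec_fill (i := 6) (a := 2)
      (e := .op .add (.get 2 (.reg 6)) (.op .lt (.const 0) (.adjacency 8 6))) (s := s₂) (by rfl)
      (fun j => s'.arr 2 j + if ∃ hj : j < n, G.Adj b ⟨j, hj⟩ then 1 else 0)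
      (fun s'' hs'' hlt heq => by
        have hG'' := hG₂.of_agreeOff hs'' (by simp) (by simp)
        have h8 : s''.reg 8 = b := by rw [hs''.1 8 (by simp), h8₂]
        rw [hG₂.reg_zero] at hlt
        have := hG''.adjacency_iff (u := 8) (v := 6) (by rw [h8]; exact b.2) hlt
        have hb' : (⟨s''.reg 8, by rw [h8]; exact b.2⟩ : Fin n) = b := Fin.ext h8
        rw [hb', ← Nat.pos_iff_ne_zero] at this
        have hev : (Expr.op .lt (.const 0) (.adjacency 8 6)).eval s'' =
            if ∃ hj : s''.reg 6 < n, G.Adj b ⟨s''.reg 6, hj⟩ then 1 else 0 :=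
          Expr.eval_lt (this.trans ⟨fun h => ⟨hlt, h⟩, fun h => h.2⟩)
        rw [← hev, ← h2₂, ← heq]
        rfl)
    have hag2 := agreeOff_exec (fill 6 2 (.op .add (.get 2 (.reg 6))
      (.op .lt (.const 0) (.adjacency 8 6)))) s₂ (R := [6]) (B := [2])
      (by simp [fill, writtenRegs]) (by simp [fill, writtenArrs])
    rw [hG₂.reg_zero] at hfill
    set s₃ := (fill 6 2 (.op .add (.get 2 (.reg 6)) (.op .lt (.const 0) (.adjacency 8 6)))).exec s₂
    have h1₃ : ∀ j, s₃.arr 1 j = if j = b then m + 1 else s'.arr 1 j := fun j => by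
      rw [hag2.2 1 (by simp)]; simp [hs₂, harr]
    have h3₃ : ∀ j, s₃.arr 3 j = if j = m then (b : ℕ) else s'.arr 3 j := fun j => by
      rw [hag2.2 3 (by simp)]; simp [hs₂, harr]
    refine ⟨⟨fun r hr => ?_, fun a ha => ?_⟩, ?_, ?_⟩
    · simp only [List.mem_cons, List.not_mem_nil, or_false, not_or] at hr
      rw [State.setReg_reg, if_neg hr.1, hag2.1 r (by simp [hr]), hs₂, State.setArr_reg,
        State.setArr_reg, hag1.1 r (by simp [hr]), hag.1 r (by simp [hr])]
    · simp only [List.mem_cons, List.not_mem_nil, or_false, not_or] at ha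
      rw [State.setReg_arr, hag2.2 a (by simp [ha])]
      funext j
      simp [hs₂, ha, harr, hag.2 a]
    · refine hinv.step (b := b) hb0 (fun c hc => ?_) (fun v => ?_) (fun v => ?_)
      · exact_mod_cast hbmax c c.2 hc
      · simp [h1₃, Fin.ext_iff]
      · simp [hfill v v.2]
    · intro v hv
      simp only [State.setReg_arr, h1₃, h3₃] at hv ⊢
      by_cases hvb : v = b
      · simp [hvb]
      · have hvb' : (v : ℕ) ≠ b := fun h => hvb (Fin.ext h)
        simp only [hvb', if_false] at hv ⊢
        have h3 : s'.arr 1 v ≤ m := hinv.le v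
        -- Older visits have times at most `m`, so their cells in array `3` come before cell `m`.
        rw [if_neg (by omega), hord v hv]

/-- Array `4` gets the latest earlier neighbours. -/
def parents : Cmd :=
  tabulate 5 4 (.seq (pick 6 7 8 (.earlier 5 6) (.op .lt (.get 1 (.reg 8)) (.get 1 (.reg 6))))
    (.ite (.reg 7) .skip (.assign 8 (.reg 5)))) (.reg 8)

theorem exec_parents (hG : Encodes G s) {t : Fin n → ℕ} (ht : ∀ v : Fin n, s.arr 1 v = t v) :
    ∃ par : Fin n → Fin n, (∀ v : Fin n, (parents.exec s).arr 4 v = par v) ∧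
      (∀ v x, Earlier G t v x → IsParent G t v (par v)) ∧
      ∀ v, (∀ x, ¬ Earlier G t v x) → par v = v := by
  have key := exec_tabulate (i := 5) (a := 4) (p := .seq (pick 6 7 8 (.earlier 5 6)
    (.op .lt (.get 1 (.reg 8)) (.get 1 (.reg 6)))) (.ite (.reg 7) .skip (.assign 8 (.reg 5))))
    (e := .reg 8) (s := s) (by rfl) (by rfl)
    (fun j x => ∀ hj : j < n, ∃ u : Fin n, x = u ∧
      (∀ x, Earlier G t ⟨j, hj⟩ x → IsParent G t ⟨j, hj⟩ u) ∧
      ((∀ x, ¬ Earlier G t ⟨j, hj⟩ x) → u = ⟨j, hj⟩)) ?_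
  · rw [hG.reg_zero] at key
    choose par h1 h2 h3 using fun v : Fin n => key v v.2 v.2
    exact ⟨par, h1, h2, h3⟩
  · intro s' hag h5 _ hj
    have hG' := hG.of_agreeOff hag (by decide) (by decide)
    have ht' : ∀ v : Fin n, s'.arr 1 v = t v := fun v => by rw [hag.2 1 (by simp), ht]
    set v : Fin n := ⟨s'.reg 5, hj⟩ with hv
    have hpick := exec_pick (i := 6) (f := 7) (b := 8) (cond := .earlier 5 6)
      (better := .op .lt (.get 1 (.reg 8)) (.get 1 (.reg 6))) (s := s') (by rfl) (by omega) (by omega)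
      (by omega) (fun j => ∃ hj : j < n, Earlier G t v ⟨j, hj⟩) (fun j => s'.arr 1 j)
      (fun s'' hs'' hlt => by
        have hG'' := hG'.of_agreeOff hs'' (by simp) (by simp)
        rw [hG'.reg_zero] at hlt
        have h5 : s''.reg 5 = v := hs''.1 5 (by simp)
        have := hG''.earlier_iff (u := 5) (v := 6) (t := t) (fun v => by rw [hs''.2 1 (by simp), ht'])
          (by rw [h5]; exact v.2) hlt
        rw [this]
        simp only [h5]
        exact ⟨fun h => ⟨hlt, h⟩, fun h => h.2⟩)
      (fun s'' hs'' _ _ => by simp [Expr.eval, Op.eval, hs''.2])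
    have hag1 := agreeOff_exec (pick 6 7 8 (.earlier 5 6)
      (.op .lt (.get 1 (.reg 8)) (.get 1 (.reg 6)))) s' (R := [6, 7, 8]) (B := [])
      (by simp [pick, writtenRegs]) (by simp [pick, writtenArrs])
    rw [hG'.reg_zero] at hpick
    simp only [exec, Expr.eval]
    set s₁ := (pick 6 7 8 (.earlier 5 6) (.op .lt (.get 1 (.reg 8)) (.get 1 (.reg 6)))).exec s'
    rcases hpick with ⟨hf, hno⟩ | ⟨hf, hbn, ⟨_, hP⟩, hmax⟩
    · have hno' : ∀ x, ¬ Earlier G t v x := fun x hx => hno x x.2 ⟨x.2, hx⟩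
      refine ⟨v, ?_, fun x hx => absurd hx (hno' x), fun _ => rfl⟩
      simp [hf, hag1.1 5, hv]
    · refine ⟨⟨s₁.reg 8, hbn⟩, by simp [hf], fun _ _ => ⟨hP, fun x hx => ?_⟩, fun h => absurd hP (h _)⟩
      have := hmax x x.2 ⟨x.2, hx⟩
      have h2 : s'.arr 1 (s₁.reg 8) = _ := ht' ⟨s₁.reg 8, hbn⟩
      rw [ht' x, h2] at this
      exact_mod_cast this

/-- Array `5` gets the numbers of earlier neighbours. -/
def sizes : Cmd :=
  tabulate 5 5 (count 6 7 (.earlier 5 6)) (.reg 7)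

theorem exec_sizes (hG : Encodes G s) {t : Fin n → ℕ} (ht : ∀ v : Fin n, s.arr 1 v = t v) :
    ∀ v : Fin n, (sizes.exec s).arr 5 v + 1 = cliqueSize G t v := by
  have key := exec_tabulate (i := 5) (a := 5) (p := count 6 7 (.earlier 5 6))
    (e := .reg 7) (s := s) (by rfl) (by rfl)
    (fun j x => ∀ hj : j < n, x + 1 = cliqueSize G t ⟨j, hj⟩) ?_
  · rw [hG.reg_zero] at key
    exact fun v => key v v.2 v.2
  · intro s' hag h5 _ hj
    have hG' := hG.of_agreeOff hag (by decide) (by decide)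
    have ht' : ∀ v : Fin n, s'.arr 1 v = t v := fun v => by rw [hag.2 1 (by simp), ht]
    set v : Fin n := ⟨s'.reg 5, hj⟩ with hv
    have hcount := exec_count (i := 6) (r := 7) (cond := .earlier 5 6) (s := s') (by rfl) (by omega)
      (fun j => ∃ hj : j < n, Earlier G t v ⟨j, hj⟩)
      (fun s'' hs'' hlt => by
        have hG'' := hG'.of_agreeOff hs'' (by simp) (by simp)
        rw [hG'.reg_zero] at hlt
        have h5 : s''.reg 5 = v := hs''.1 5 (by simp)
        have := hG''.earlier_iff (u := 5) (v := 6) (t := t) (fun v => by rw [hs''.2 1 (by simp), ht'])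
          (by rw [h5]; exact v.2) hlt
        rw [this]
        simp only [h5]
        exact ⟨fun h => ⟨hlt, h⟩, fun h => h.2⟩)
    simp only [Expr.eval]
    rw [hcount, hG'.reg_zero, cliqueSize_eq]
    congr 1
    convert card_range_filter (Earlier G t v)

/-- Array `6` gets the representatives of maximal cliques. -/
def representatives : Cmd :=
  .seq (fill 5 6 (.reg 5))
  (.loop 5 (.seq (.assign 6 (.get 3 (.op .sub (.op .sub (.reg 0) (.const 1)) (.reg 5))))
    (.ite (.op .eq (.get 5 (.reg 6)) (.op .add (.get 5 (.get 4 (.reg 6))) (.const 1)))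
      (.store 6 (.get 4 (.reg 6)) (.get 6 (.reg 6))) .skip)))

theorem exec_representatives (hn : s.reg 0 = n) {t : Fin n → ℕ} (ht : EarlierCliques G t)
    (hle : ∀ v, t v ≤ n) (hex : ∀ i < n, ∃ v, t v = i + 1)
    (hord : ∀ v : Fin n, s.arr 3 (t v - 1) = v) {par : Fin n → Fin n}
    (hpar : ∀ v : Fin n, s.arr 4 v = par v)
    (hp : ∀ v x, Earlier G t v x → IsParent G t v (par v))
    (hp' : ∀ v, (∀ x, ¬ Earlier G t v x) → par v = v)
    (hsize : ∀ v : Fin n, s.arr 5 v + 1 = cliqueSize G t v) :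
    ∃ rep : Fin n → Fin n, (∀ v : Fin n, (representatives.exec s).arr 6 v = rep v) ∧
      CliqueRep G t rep := by
  have hfill := exec_fill (i := 5) (a := 6) (e := .reg 5) (s := s) (by rfl) (fun j => j)
    (fun s' _ _ _ => rfl)
  have hag1 := agreeOff_exec (fill 5 6 (.reg 5)) s (R := [5]) (B := [6])
      (by simp [fill, writtenRegs]) (by simp [fill, writtenArrs])
  set s₁ := (fill 5 6 (.reg 5)).exec s
  have hn₁ : s₁.reg 0 = n := by rw [hag1.1 0 (by simp), hn]
  have key := exec_loop (s := s₁) (i := 5)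
    (p := .seq (.assign 6 (.get 3 (.op .sub (.op .sub (.reg 0) (.const 1)) (.reg 5))))
    (.ite (.op .eq (.get 5 (.reg 6)) (.op .add (.get 5 (.get 4 (.reg 6))) (.const 1)))
      (.store 6 (.get 4 (.reg 6)) (.get 6 (.reg 6))) .skip))
    (I := fun m s' => (∀ a ∈ [3, 4, 5], s'.arr a = s.arr a) ∧ ∃ rep : Fin n → Fin n,
      (∀ v : Fin n, s'.arr 6 v = rep v) ∧ RepInvariant G t (n - m) rep) (by rfl) ?_ ?_
  · rw [hn₁] at key
    obtain ⟨_, rep, h1, h2⟩ := key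
    exact ⟨rep, h1, (by simpa using h2 : RepInvariant G t 0 rep).cliqueRep ht⟩
  · refine ⟨fun a ha => ?_, id, fun v => ?_, by simpa using RepInvariant.init hle⟩
    · rw [State.setReg_arr, hag1.2 a]
      rintro h
      simp only [List.mem_cons, List.not_mem_nil, or_false] at ha h
      omega
    · rw [State.setReg_arr, hfill v (by rw [hn]; exact v.2)]
      rfl
  · rintro m s' hm h5 h0 ⟨harr, rep, hrep, hinv⟩
    rw [hn₁] at hm h0
    -- Round `m` handles the vertex visited at time `n - m`: the latest vertices come first.
    obtain ⟨w, hw⟩ := hex (n - 1 - m) (by omega)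
    have h3 : s'.arr 3 (n - 1 - m) = w := by
      rw [harr 3 (by simp), ← hord w, hw]; rfl
    have h4 : s'.arr 4 w = par w := by rw [harr 4 (by simp), hpar]
    have h5' : ∀ v : Fin n, s'.arr 5 v + 1 = cliqueSize G t v := fun v => by
      rw [harr 5 (by simp), hsize]
    rw [show n - m = n - (m + 1) + 1 by omega] at hinv
    have hw' : t w = n - (m + 1) + 1 := by omega
    by_cases hext : s'.arr 5 w = s'.arr 5 (par w) + 1
    · have hsz : cliqueSize G t w = cliqueSize G t (par w) + 1 := by
        have := h5' w; have := h5' (par w); omega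
      have hE : Extends G t w (par w) := by
        refine ⟨?_, hsz⟩
        -- A vertex without earlier neighbours is its own parent, so it cannot pass the comparison
        -- of sizes.
        by_contra hcon
        have : ∀ x, ¬ Earlier G t w x := fun x hx => hcon (hp w x hx)
        rw [hp' w this] at hsz
        omega
      refine ⟨fun a ha => ?_, fun v => if v = par w then rep w else rep v, fun v => ?_,
        hinv.step_of_extends ht hw' hE (by simp) (fun u hu => by simp [hu])⟩
      · have : a ≠ 6 := by rintro rfl; simp at ha
        rw [← harr a ha]
        funext j
        simp [exec, Expr.eval, Op.eval, h0, h5, h3, h4, hext, this]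
      · simp [exec, Expr.eval, Op.eval, h0, h5, h3, h4, hext, hrep, Fin.val_inj]
        split_ifs <;> rfl
    · have hE : ∀ v, ¬ Extends G t w v := by
        intro v hv
        have hpv : par w = v := ht.injective
          (le_antisymm (hv.1.2 _ (hp w v hv.1.1).1) ((hp w v hv.1.1).2 v hv.1.1))
        subst hpv
        have := hv.2; have := h5' w; have := h5' (par w); omega
      refine ⟨fun a ha => ?_, rep, fun v => ?_, hinv.step_of_not_extends ht hw' hE⟩
      · rw [← harr a ha]
        simp [exec, Expr.eval, Op.eval, h0, h5, h3, h4, hext]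
      · rw [← hrep v]
        simp [exec, Expr.eval, Op.eval, h0, h5, h3, h4, hext]

end Cmd

end RAM

namespace RAM

/-! ### Computing a consecutive arrangement of the maximal cliques -/

namespace Expr

abbrev and (x y : Expr) : Expr := op .mul x y

abbrev or (x y : Expr) : Expr := op .lt (const 0) (op .add x y)

theorem and_iff {s : State} {x y : Expr} {p q : Prop} (hx : x.eval s ≠ 0 ↔ p)
    (hy : y.eval s ≠ 0 ↔ q) : (and x y).eval s ≠ 0 ↔ p ∧ q := by
  rw [← hx, ← hy]; exact mul_ne_zero_iff

theorem or_iff {s : State} {x y : Expr} {p q : Prop} (hx : x.eval s ≠ 0 ↔ p)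
    (hy : y.eval s ≠ 0 ↔ q) : (or x y).eval s ≠ 0 ↔ p ∨ q := by
  have : (or x y).eval s ≠ 0 ↔ 0 < x.eval s + y.eval s := by
    by_cases h : 0 < x.eval s + y.eval s <;> simp only [eval, Op.eval, h, if_true, if_false] <;> simp
  rw [← hx, ← hy, this]
  omega

theorem eval_or {s : State} {x y : Expr} {p q : Prop} [Decidable (p ∨ q)] (hx : x.eval s ≠ 0 ↔ p)
    (hy : y.eval s ≠ 0 ↔ q) : (or x y).eval s = if p ∨ q then 1 else 0 := by
  refine eval_lt ?_
  rw [← hx, ← hy]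
  simp only [eval, Op.eval]
  omega

theorem isZero_iff {s : State} {x : Expr} {p : Prop} (hx : x.eval s ≠ 0 ↔ p) :
    (isZero x).eval s ≠ 0 ↔ ¬ p := by
  rw [← hx]
  simp only [eval, Op.eval]
  split_ifs <;> simp_all

theorem lt_iff {s : State} {x y : Expr} : (op .lt x y).eval s ≠ 0 ↔ x.eval s < y.eval s := by
  simp [eval, Op.eval]

theorem eq_iff {s : State} {x y : Expr} : (op .eq x y).eval s ≠ 0 ↔ x.eval s = y.eval s := by
  simp [eval, Op.eval]

/-- Whether the vertex in register `x` is in the maximal clique represented by that in register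
`c`. -/
def member (c x : ℕ) : Expr :=
  and (op .eq (get 6 (reg c)) (reg c)) (or (op .eq (reg x) (reg c)) (earlier c x))

end Expr

/-- The arrays `1`, `4`, `6` hold the search times, the parents and the representatives. -/
structure CliqueData {n : ℕ} (G : SimpleGraph (Fin n)) (t : Fin n → ℕ) (par rep : Fin n → Fin n)
    (s : State) : Prop extends Encodes G s where
  time_eq : ∀ v : Fin n, s.arr 1 v = t v
  par_eq : ∀ v : Fin n, s.arr 4 v = par v
  rep_eq : ∀ v : Fin n, s.arr 6 v = rep v

section

variable {n : ℕ} {G : SimpleGraph (Fin n)} {t : Fin n → ℕ} {par rep : Fin n → Fin n} {s : State}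

theorem CliqueData.of_agreeOff (h : CliqueData G t par rep s) {R B : List ℕ} {s' : State}
    (hs : AgreeOff R B s s') (hR : 0 ∉ R) (hB : ∀ a ∈ [0, 1, 4, 6], a ∉ B) :
    CliqueData G t par rep s' := by
  simp only [List.mem_cons, List.not_mem_nil, or_false, forall_eq_or_imp, forall_eq] at hB
  refine ⟨h.toEncodes.of_agreeOff hs hR hB.1, fun v => ?_, fun v => ?_, fun v => ?_⟩
  · rw [hs.2 1 hB.2.1, h.time_eq]
  · rw [hs.2 4 hB.2.2.1, h.par_eq]
  · rw [hs.2 6 hB.2.2.2, h.rep_eq]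

theorem CliqueData.earlier_iff (h : CliqueData G t par rep s) {c x : ℕ} {u v : Fin n}
    (hc : s.reg c = u) (hx : s.reg x = v) :
    (Expr.earlier c x).eval s ≠ 0 ↔ Earlier G t u v := by
  have := h.toEncodes.earlier_iff h.time_eq (u := c) (v := x) (by omega) (by omega)
  simp only [hc, hx] at this
  exact this

theorem CliqueData.member_iff (h : CliqueData G t par rep s) {c x : ℕ} {u v : Fin n}
    (hc : s.reg c = u) (hx : s.reg x = v) :
    (Expr.member c x).eval s ≠ 0 ↔ InMaxClique G t rep u v := by
  refine Expr.and_iff (Expr.eq_iff.trans ?_) (Expr.or_iff (Expr.eq_iff.trans ?_)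
    (h.earlier_iff hc hx))
  · simp [Expr.eval, hc, h.rep_eq, Fin.val_inj]
  · simp [Expr.eval, hc, hx, Fin.val_inj]

end

namespace Cmd

section

variable {n : ℕ} {s : State}

theorem exec_fill_fin {i a : ℕ} {e : Expr} (hn : s.reg 0 = n) (hwf : (fill i a e).wellFormed)
    (g : Fin n → ℕ) (hg : ∀ s' (v : Fin n), AgreeOff [i] [a] s s' → s'.reg i = v →
      s'.arr a v = s.arr a v → e.eval s' = g v) :
    ∀ v : Fin n, ((fill i a e).exec s).arr a v = g v := by
  intro v
  have := exec_fill (s := s) hwf (fun j => if hj : j < n then g ⟨j, hj⟩ else 0)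
    (fun s' hs' hlt heq => by
      rw [hn] at hlt
      rw [dif_pos hlt]
      exact hg s' ⟨_, hlt⟩ hs' rfl heq) v (by omega)
  rw [this, dif_pos v.2]

theorem exec_pick_fin {i f b : ℕ} {cond better : Expr} (hn : s.reg 0 = n)
    (hwf : (pick i f b cond better).wellFormed) (hfb : f ≠ b) (hif : i ≠ f) (hib : i ≠ b)
    (P : Fin n → Prop) (val : Fin n → ℤ)
    (hP : ∀ s' (v : Fin n), AgreeOff [i, f, b] [] s s' → s'.reg i = v →
      (cond.eval s' ≠ 0 ↔ P v))
    (hval : ∀ s' (v u : Fin n), AgreeOff [i, f, b] [] s s' → s'.reg i = v → s'.reg b = u →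
      (better.eval s' ≠ 0 ↔ val u < val v)) :
    (((pick i f b cond better).exec s).reg f = 0 ∧ ∀ v, ¬ P v) ∨
    (((pick i f b cond better).exec s).reg f = 1 ∧ ∃ v : Fin n,
      ((pick i f b cond better).exec s).reg b = v ∧ P v ∧ ∀ u, P u → val u ≤ val v) := by
  have := exec_pick (s := s) hwf hfb hif hib (fun j => ∃ hj : j < n, P ⟨j, hj⟩)
    (fun j => if hj : j < n then val ⟨j, hj⟩ else 0)
    (fun s' hs' hlt => by
      rw [hn] at hlt
      rw [hP s' ⟨_, hlt⟩ hs' rfl]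
      exact ⟨fun h => ⟨hlt, h⟩, fun h => h.2⟩)
    (fun s' hs' hlt hlt' => by
      rw [hn] at hlt hlt'
      rw [hval s' ⟨_, hlt⟩ ⟨_, hlt'⟩ hs' rfl rfl]
      simp [hlt, hlt'])
  rw [hn] at this
  rcases this with ⟨h1, h2⟩ | ⟨h1, h2, ⟨_, h3⟩, h4⟩
  · exact Or.inl ⟨h1, fun v hv => h2 v v.2 ⟨v.2, hv⟩⟩
  · refine Or.inr ⟨h1, ⟨_, h2⟩, rfl, h3, fun u hu => ?_⟩
    have := h4 u u.2 ⟨u.2, hu⟩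
    simpa [h2] using this

end

section Refine

/-- Process the pivot in register `8`. The keys are in array `b + 7`, the states of the pivots in
array `b + 8`. -/
def pivotStep (b : ℕ) : Cmd :=
  .seq (pick 6 10 11 (.member 6 8) (.op .lt (.get (b + 7) (.reg 6)) (.get (b + 7) (.reg 11))))
  (.seq (pick 6 10 12 (.member 6 8) (.op .lt (.get (b + 7) (.reg 12)) (.get (b + 7) (.reg 6))))
  (.seq (.assign 13 (.get (b + 7) (.reg 11)))
  (.seq (.assign 14 (.get (b + 7) (.reg 12)))
  (.seq (fill 6 (b + 7) (.op .add (.op .add (.get (b + 7) (.reg 6))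
    (.or (.op .lt (.reg 13) (.get (b + 7) (.reg 6)))
      (.and (.op .eq (.get (b + 7) (.reg 6)) (.reg 13)) (.member 6 8))))
    (.or (.op .lt (.reg 14) (.get (b + 7) (.reg 6)))
      (.and (.op .eq (.get (b + 7) (.reg 6)) (.reg 14)) (.isZero (.member 6 8))))))
  (.store (b + 8) (.reg 8) (.const 2))))))

/-- Make pivots out of the elements on the edge in register `8`, and record this in array `b + 9`. -/
def edgeStep (b : ℕ) : Cmd :=
  .seq (fill 6 (b + 8) (.op .add (.get (b + 8) (.reg 6))
    (.op .lt (.const 0) (.and (.isZero (.get (b + 8) (.reg 6))) (.earlier 8 6)))))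
  (.store (b + 9) (.reg 8) (.const 1))

/-- Split off the clique in register `8`, and record this in array `b + 10`. -/
def splitStep (b : ℕ) : Cmd :=
  .seq (.assign 13 (.get (b + 7) (.reg 8)))
  (.seq (fill 6 (b + 7) (.op .add (.get (b + 7) (.reg 6))
    (.or (.op .lt (.reg 13) (.get (b + 7) (.reg 6)))
      (.and (.op .eq (.get (b + 7) (.reg 6)) (.reg 13)) (.isZero (.op .eq (.reg 6) (.reg 8)))))))
  (.store (b + 10) (.reg 8) (.const 1)))

/-- A step of the refinement process, with the priorities in array `T`. -/
def refineStep (T b : ℕ) : Cmd :=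
  .seq (pick 6 7 8 (.op .eq (.get (b + 8) (.reg 6)) (.const 1)) (.const 0))
  (.ite (.reg 7) (pivotStep b)
  (.seq (pick 6 7 8 (.and (.isZero (.get (b + 9) (.reg 6)))
    (.isZero (.op .eq (.get (b + 7) (.get 6 (.reg 6))) (.get (b + 7) (.get 6 (.get 4 (.reg 6)))))))
    (.const 0))
  (.ite (.reg 7) (edgeStep b)
  (.seq (pick 6 7 8 (.isZero (.get (b + 10) (.reg 6)))
    (.op .lt (.get T (.reg 8)) (.get T (.reg 6))))
  (.ite (.reg 7) (splitStep b) .skip)))))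

/-- The refinement process, with the priorities in array `T` and the keys in array `b + 7`. -/
def refine (T b : ℕ) : Cmd :=
  .loop 9 (.seq (refineStep T b) (.seq (refineStep T b) (refineStep T b)))

variable {n : ℕ} {G : SimpleGraph (Fin n)} {t : Fin n → ℕ} {par rep : Fin n → Fin n} {s : State}
  {b : ℕ}

theorem exec_pivotStep (hD : CliqueData G t par rep s) {x : Fin n} (hx : s.reg 8 = x)
    (hex : ∃ c, InMaxClique G t rep c x) :
    ∃ lo hi : Fin n, InMaxClique G t rep lo x ∧ InMaxClique G t rep hi x ∧
      (∀ c : Fin n, InMaxClique G t rep c x →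
        s.arr (b + 7) lo ≤ s.arr (b + 7) c ∧ s.arr (b + 7) c ≤ s.arr (b + 7) hi) ∧
      (∀ v : Fin n, ((pivotStep b).exec s).arr (b + 7) v =
        pivotKey (InMaxClique G t rep) (fun c : Fin n => s.arr (b + 7) c) x
          (s.arr (b + 7) lo) (s.arr (b + 7) hi) v) ∧
      ∀ j, ((pivotStep b).exec s).arr (b + 8) j = if j = x then 2 else s.arr (b + 8) j := by
  classical
  obtain ⟨c₀, hc₀⟩ := hex
  simp only [pivotStep, exec]
  have hpick := exec_pick_fin (s := s) (i := 6) (f := 10) (b := 11) (cond := .member 6 8)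
    (better := .op .lt (.get (b + 7) (.reg 6)) (.get (b + 7) (.reg 11))) hD.reg_zero (by rfl)
    (by omega) (by omega) (by omega) (fun c => InMaxClique G t rep c x)
    (fun c => - (s.arr (b + 7) c : ℤ))
    (fun s' v hs' hv => (hD.of_agreeOff hs' (by simp) (by simp)).member_iff hv
      (by rw [hs'.1 8 (by simp), hx]))
    (fun s' v u hs' hv hu => by simp [Expr.eval, Op.eval, hs'.2, hv, hu])
  have hag := agreeOff_exec (pick 6 10 11 (.member 6 8)
    (.op .lt (.get (b + 7) (.reg 6)) (.get (b + 7) (.reg 11)))) s (R := [6, 10, 11]) (B := [])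
    (by simp [pick, writtenRegs]) (by simp [pick, writtenArrs])
  set s₁ := (pick 6 10 11 (.member 6 8)
    (.op .lt (.get (b + 7) (.reg 6)) (.get (b + 7) (.reg 11)))).exec s
  rcases hpick with hpick | ⟨-, lo, hlo, hloA, hlo_le⟩
  · exact absurd hc₀ (hpick.2 c₀)
  have hD₁ := hD.of_agreeOff hag (by simp) (by simp)
  have hpick := exec_pick_fin (s := s₁) (i := 6) (f := 10) (b := 12) (cond := .member 6 8)
    (better := .op .lt (.get (b + 7) (.reg 12)) (.get (b + 7) (.reg 6))) hD₁.reg_zero (by rfl)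
    (by omega) (by omega) (by omega) (fun c => InMaxClique G t rep c x)
    (fun c => (s.arr (b + 7) c : ℤ))
    (fun s' v hs' hv => (hD₁.of_agreeOff hs' (by simp) (by simp)).member_iff hv
      (by rw [hs'.1 8 (by simp), hag.1 8 (by simp), hx]))
    (fun s' v u hs' hv hu => by simp [Expr.eval, Op.eval, hs'.2, hag.2, hv, hu])
  have hag' := agreeOff_exec (pick 6 10 12 (.member 6 8)
    (.op .lt (.get (b + 7) (.reg 12)) (.get (b + 7) (.reg 6)))) s₁ (R := [6, 10, 12]) (B := [])
    (by simp [pick, writtenRegs]) (by simp [pick, writtenArrs])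
  set s₂ := (pick 6 10 12 (.member 6 8)
    (.op .lt (.get (b + 7) (.reg 12)) (.get (b + 7) (.reg 6)))).exec s₁
  rcases hpick with hpick | ⟨-, hi, hhi, hhiA, hhi_le⟩
  · exact absurd hc₀ (hpick.2 c₀)
  have hlo₂ : s₂.reg 11 = lo := by rw [hag'.1 11 (by simp), hlo]
  have hx₂ : s₂.reg 8 = x := by rw [hag'.1 8 (by simp), hag.1 8 (by simp), hx]
  have harr₂ : s₂.arr = s.arr := funext fun a => by rw [hag'.2 a (by simp), hag.2 a (by simp)]
  -- The two extreme keys are saved in registers before the array of keys is overwritten.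
  set s₃ := (s₂.setReg 13 (Expr.eval s₂ (.get (b + 7) (.reg 11)))) with hs₃
  set s₄ := (s₃.setReg 14 (Expr.eval s₃ (.get (b + 7) (.reg 12)))) with hs₄
  have hag₄ : AgreeOff [6, 10, 11, 12, 13, 14] [] s s₄ :=
    ⟨fun r hr => by
      simp only [List.mem_cons, List.not_mem_nil, or_false, not_or] at hr
      simp [hs₄, hs₃, hr, hag'.1 r, hag.1 r], fun a _ => by simp [hs₄, hs₃, harr₂]⟩
  have hD₄ := hD.of_agreeOff hag₄ (by simp) (by simp)
  have h13 : s₄.reg 13 = s.arr (b + 7) lo := by simp [hs₄, hs₃, Expr.eval, hlo₂, harr₂]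
  have h14 : s₄.reg 14 = s.arr (b + 7) hi := by simp [hs₄, hs₃, Expr.eval, hhi, harr₂]
  have hfill := exec_fill_fin (s := s₄) (i := 6) (a := b + 7)
    (e := .op .add (.op .add (.get (b + 7) (.reg 6))
      (.or (.op .lt (.reg 13) (.get (b + 7) (.reg 6)))
        (.and (.op .eq (.get (b + 7) (.reg 6)) (.reg 13)) (.member 6 8))))
      (.or (.op .lt (.reg 14) (.get (b + 7) (.reg 6)))
        (.and (.op .eq (.get (b + 7) (.reg 6)) (.reg 14)) (.isZero (.member 6 8)))))
    hD₄.reg_zero (by rfl)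
    (pivotKey (InMaxClique G t rep) (fun c : Fin n => s.arr (b + 7) c) x
          (s.arr (b + 7) lo) (s.arr (b + 7) hi))
    (fun s' v hs' hv heq => by
      have hmem := (hD₄.of_agreeOff hs' (by simp) (by simp)).member_iff hv
        (x := 8) (v := x) (by rw [hs'.1 8 (by simp), hag₄.1 8 (by simp), hx])
      have hk : Expr.eval s' (.get (b + 7) (.reg 6)) = s.arr (b + 7) v := by
        simp only [Expr.eval, hv, heq, hag₄.2 (b + 7) (by simp)]
      have h13' : Expr.eval s' (.reg 13) = s.arr (b + 7) lo := by
        rw [← h13, ← hs'.1 13 (by simp)]; rfl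
      have h14' : Expr.eval s' (.reg 14) = s.arr (b + 7) hi := by
        rw [← h14, ← hs'.1 14 (by simp)]; rfl
      have e1 := Expr.eval_or (s := s') (Expr.lt_iff (x := .reg 13) (y := .get (b + 7) (.reg 6)))
        (Expr.and_iff (Expr.eq_iff (x := .get (b + 7) (.reg 6)) (y := .reg 13)) hmem)
      have e2 := Expr.eval_or (s := s') (Expr.lt_iff (x := .reg 14) (y := .get (b + 7) (.reg 6)))
        (Expr.and_iff (Expr.eq_iff (x := .get (b + 7) (.reg 6)) (y := .reg 14))
          (Expr.isZero_iff hmem))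
      rw [Expr.eval, Expr.eval, e1, e2, hk, h13', h14']
      rfl)
  refine ⟨lo, hi, hloA, hhiA, fun c hc => ⟨?_, ?_⟩, fun v => ?_, fun j => ?_⟩
  · have := hlo_le c hc; omega
  · have := hhi_le c hc; omega
  · rw [← hfill v]
    simp
  · have hag₅ := agreeOff_exec (fill 6 (b + 7) (.op .add (.op .add (.get (b + 7) (.reg 6))
      (.or (.op .lt (.reg 13) (.get (b + 7) (.reg 6)))
        (.and (.op .eq (.get (b + 7) (.reg 6)) (.reg 13)) (.member 6 8))))
      (.or (.op .lt (.reg 14) (.get (b + 7) (.reg 6)))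
        (.and (.op .eq (.get (b + 7) (.reg 6)) (.reg 14)) (.isZero (.member 6 8)))))) s₄ (R := [6])
      (B := [b + 7]) (by simp [fill, writtenRegs]) (by simp [fill, writtenArrs])
    rw [State.setArr_arr, hag₅.2 (b + 8) (by simp), hag₄.2 (b + 8) (by simp)]
    simp only [Expr.eval, hag₅.1 8 (by simp), hag₄.1 8 (by simp), hx, true_and]

theorem exec_edgeStep (hD : CliqueData G t par rep s) {v : Fin n} (hv : s.reg 8 = v) :
    (∀ x : Fin n, s.arr (b + 8) x = 0 → Earlier G t v x →
      ((edgeStep b).exec s).arr (b + 8) x = 1) ∧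
    (∀ x : Fin n, ¬ (s.arr (b + 8) x = 0 ∧ Earlier G t v x) →
      ((edgeStep b).exec s).arr (b + 8) x = s.arr (b + 8) x) ∧
    ∀ j, ((edgeStep b).exec s).arr (b + 9) j = if j = v then 1 else s.arr (b + 9) j := by
  classical
  have hfill := exec_fill_fin (s := s) (i := 6) (a := b + 8)
    (e := .op .add (.get (b + 8) (.reg 6))
      (.op .lt (.const 0) (.and (.isZero (.get (b + 8) (.reg 6))) (.earlier 8 6))))
    hD.reg_zero (by rfl)
    (fun x : Fin n => s.arr (b + 8) x + if s.arr (b + 8) x = 0 ∧ Earlier G t v x then 1 else 0)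
    (fun s' x hs' hx heq => by
      have hE := (hD.of_agreeOff hs' (by simp) (by simp)).earlier_iff (c := 8) (u := v)
        (by rw [hs'.1 8 (by simp), hv]) hx
      have hk : Expr.eval s' (.get (b + 8) (.reg 6)) = s.arr (b + 8) x := by
        simp only [Expr.eval, hx, heq]
      have hz : (Expr.isZero (.get (b + 8) (.reg 6))).eval s' ≠ 0 ↔ s.arr (b + 8) x = 0 := by
        rw [Expr.eq_iff, hk]; rfl
      have e1 := Expr.and_iff hz hE
      rw [← Nat.pos_iff_ne_zero] at e1
      rw [Expr.eval, hk, Expr.eval_lt (x := .const 0) e1]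
      rfl)
  have hag := agreeOff_exec (fill 6 (b + 8) (.op .add (.get (b + 8) (.reg 6))
      (.op .lt (.const 0) (.and (.isZero (.get (b + 8) (.reg 6))) (.earlier 8 6))))) s (R := [6])
      (B := [b + 8]) (by simp [fill, writtenRegs]) (by simp [fill, writtenArrs])
  simp only [edgeStep, exec]
  refine ⟨fun x h1 h2 => ?_, fun x hx => ?_, fun j => ?_⟩
  · rw [State.setArr_arr, if_neg (by simp), hfill x, if_pos ⟨h1, h2⟩, h1]
  · rw [State.setArr_arr, if_neg (by simp), hfill x, if_neg hx, add_zero]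
  · rw [State.setArr_arr, hag.2 (b + 9) (by simp)]
    simp only [Expr.eval, hag.1 8 (by simp), hv, true_and]

theorem exec_splitStep (hn : s.reg 0 = n) {C : Fin n} (hC : s.reg 8 = C) :
    (∀ v : Fin n, ((splitStep b).exec s).arr (b + 7) v =
      splitKey (fun c : Fin n => s.arr (b + 7) c) C v) ∧
    ∀ j, ((splitStep b).exec s).arr (b + 10) j = if j = C then 1 else s.arr (b + 10) j := by
  classical
  simp only [splitStep, exec]
  set s₁ := s.setReg 13 (Expr.eval s (.get (b + 7) (.reg 8))) with hs₁
  have h13 : s₁.reg 13 = s.arr (b + 7) C := by simp [hs₁, Expr.eval, hC]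
  have h8 : s₁.reg 8 = C := by simp [hs₁, hC]
  have hfill := exec_fill_fin (s := s₁) (i := 6) (a := b + 7)
    (e := .op .add (.get (b + 7) (.reg 6))
    (.or (.op .lt (.reg 13) (.get (b + 7) (.reg 6)))
      (.and (.op .eq (.get (b + 7) (.reg 6)) (.reg 13)) (.isZero (.op .eq (.reg 6) (.reg 8))))))
    (by simp [hs₁, hn]) (by rfl) (splitKey (fun c : Fin n => s.arr (b + 7) c) C)
    (fun s' v hs' hv heq => by
      have hk : Expr.eval s' (.get (b + 7) (.reg 6)) = s.arr (b + 7) v := by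
        simp only [Expr.eval, hv, heq, hs₁, State.setReg_arr]
      have h13' : Expr.eval s' (.reg 13) = s.arr (b + 7) C := by
        rw [← h13, ← hs'.1 13 (by simp)]; rfl
      have h8' : Expr.eval s' (.op .eq (.reg 6) (.reg 8)) ≠ 0 ↔ v = C := by
        rw [Expr.eq_iff, Expr.eval, Expr.eval, hv, hs'.1 8 (by simp), h8, Fin.val_inj]
      have e1 := Expr.eval_or (s := s') (Expr.lt_iff (x := .reg 13) (y := .get (b + 7) (.reg 6)))
        (Expr.and_iff (Expr.eq_iff (x := .get (b + 7) (.reg 6)) (y := .reg 13))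
          (Expr.isZero_iff h8'))
      rw [Expr.eval, e1, hk, h13']
      simp only [splitKey, Op.eval]
      congr)
  have hag := agreeOff_exec (fill 6 (b + 7) (.op .add (.get (b + 7) (.reg 6))
    (.or (.op .lt (.reg 13) (.get (b + 7) (.reg 6)))
      (.and (.op .eq (.get (b + 7) (.reg 6)) (.reg 13)) (.isZero (.op .eq (.reg 6) (.reg 8)))))))
      s₁ (R := [6]) (B := [b + 7]) (by simp [fill, writtenRegs]) (by simp [fill, writtenArrs])
  refine ⟨fun v => ?_, fun j => ?_⟩
  · rw [State.setArr_arr, if_neg (by simp), hfill v]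
  · rw [State.setArr_arr, hag.2 (b + 10) (by simp)]
    simp only [Expr.eval, hag.1 8 (by simp), h8, true_and]
    rfl

/-- The invariant of the refinement process for the state of the machine. -/
def Refining (G : SimpleGraph (Fin n)) (t : Fin n → ℕ) (rep : Fin n → Fin n) (prio : Fin n → ℕ)
    (b : ℕ) (s : State) : Prop :=
  RefineInvariant (InMaxClique G t rep) (Earlier G t) prio (fun v : Fin n => s.arr (b + 7) v)
    (fun v : Fin n => s.arr (b + 8) v) (fun v : Fin n => s.arr (b + 9) v)
    (fun v : Fin n => s.arr (b + 10) v)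

/-- The progress of the refinement process for the state of the machine. -/
noncomputable def refineProgress (n b : ℕ) (s : State) : ℕ :=
  progress (fun v : Fin n => s.arr (b + 8) v) (fun v : Fin n => s.arr (b + 9) v)
    (fun v : Fin n => s.arr (b + 10) v)

theorem agreeOff_refineStep (T b : ℕ) (s : State) :
    AgreeOff [6, 7, 8, 10, 11, 12, 13, 14] [b + 7, b + 8, b + 9, b + 10] s
      ((refineStep T b).exec s) := by
  refine agreeOff_exec _ _ ?_ ?_
  · simp [refineStep, pivotStep, edgeStep, splitStep, pick, fill, writtenRegs]
  · simp [refineStep, pivotStep, edgeStep, splitStep, pick, fill, writtenArrs]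

/-- The order of the branches supplies the hypotheses of `RefineInvariant.split`: a clique is split
off only if no pivot is waiting and no unused edge joins different classes. If no clique is left
either, the step does nothing. -/
theorem exec_refineStep {T : ℕ} {prio : Fin n → ℕ} (hD : CliqueData G t par rep s)
    (hT : ∀ v : Fin n, s.arr T v = prio v)
    (htree : CliqueTree (InMaxClique G t rep) (Earlier G t) rep fun v => rep (par v))
    (hI : Refining G t rep prio b s) :
    Refining G t rep prio b ((refineStep T b).exec s) ∧
    (refineProgress n b s < refineProgress n b ((refineStep T b).exec s) ∨
      ∀ c : Fin n, ((refineStep T b).exec s).arr (b + 10) c ≠ 0) ∧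
    ((∀ c : Fin n, s.arr (b + 10) c ≠ 0) →
      ∀ c : Fin n, ((refineStep T b).exec s).arr (b + 10) c ≠ 0) := by
  have hpick := exec_pick_fin (s := s) (i := 6) (f := 7) (b := 8)
    (cond := .op .eq (.get (b + 8) (.reg 6)) (.const 1)) (better := .const 0) hD.reg_zero (by rfl)
    (by omega) (by omega) (by omega) (fun x => s.arr (b + 8) x = 1) (fun _ => 0)
    (fun s' v hs' hv => by simp [Expr.eval, Op.eval, hs'.2, hv])
    (fun s' v u hs' hv hu => by simp [Expr.eval])
  have hag := agreeOff_exec (pick 6 7 8 (.op .eq (.get (b + 8) (.reg 6)) (.const 1)) (.const 0)) s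
    (R := [6, 7, 8]) (B := []) (by simp [pick, writtenRegs]) (by simp [pick, writtenArrs])
  simp only [refineStep, exec]
  set s₁ := (pick 6 7 8 (.op .eq (.get (b + 8) (.reg 6)) (.const 1)) (.const 0)).exec s
  have hD₁ := hD.of_agreeOff hag (by simp) (by simp)
  have harr₁ : s₁.arr = s.arr := funext fun a => hag.2 a (by simp)
  rcases hpick with ⟨h7, hno⟩ | ⟨h7, x, hx, hxp, -⟩
  swap
  · simp only [Expr.eval, h7, one_ne_zero, if_true, ne_eq, not_false_eq_true]
    obtain ⟨c, d, hc, hd, hcd⟩ := hI.straddles x hxp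
    obtain ⟨lo, hi, hlo, hhi, hle, hkey, hpend⟩ := exec_pivotStep (b := b) hD₁ hx ⟨c, hc⟩
    have hag' := agreeOff_exec (pivotStep b) s₁ (R := [6, 10, 11, 12, 13, 14])
      (B := [b + 7, b + 8]) (by simp [pivotStep, pick, fill, writtenRegs])
      (by simp [pivotStep, pick, fill, writtenArrs])
    have h9 : ((pivotStep b).exec s₁).arr (b + 9) = s.arr (b + 9) := by
      rw [hag'.2 _ (by simp), harr₁]
    have h10 : ((pivotStep b).exec s₁).arr (b + 10) = s.arr (b + 10) := by
      rw [hag'.2 _ (by simp), harr₁]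
    rw [harr₁] at hle hkey hpend
    have := hI.pivot (x := x) hxp hlo hhi hle (funext hkey)
      (pend' := fun v : Fin n => ((pivotStep b).exec s₁).arr (b + 8) v)
      (by rw [hpend, if_pos rfl]) (fun y hy => by rw [hpend, if_neg (by simpa [Fin.val_inj] using hy)])
    simp only [Refining, refineProgress, h9, h10]
    exact ⟨this.1, Or.inl this.2, id⟩
  simp only [Expr.eval, h7, if_false, ne_eq, not_true_eq_false]
  have hpick := exec_pick_fin (s := s₁) (i := 6) (f := 7) (b := 8)
    (cond := .and (.isZero (.get (b + 9) (.reg 6)))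
      (.isZero (.op .eq (.get (b + 7) (.get 6 (.reg 6))) (.get (b + 7) (.get 6 (.get 4 (.reg 6)))))))
    (better := .const 0) hD₁.reg_zero (by rfl)
    (by omega) (by omega) (by omega)
    (fun v => s.arr (b + 9) v = 0 ∧ ¬ s.arr (b + 7) (rep v) = s.arr (b + 7) (rep (par v)))
    (fun _ => 0)
    (fun s' v hs' hv => by
      have hD' := hD₁.of_agreeOff hs' (by simp) (by simp)
      refine Expr.and_iff (Expr.eq_iff.trans ?_) (Expr.isZero_iff (Expr.eq_iff.trans ?_))
      · simp [Expr.eval, hs'.2, harr₁, hv]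
      · simp only [Expr.eval, hv, hD'.rep_eq, hD'.par_eq]
        rw [hs'.2 _ (by simp), harr₁])
    (fun s' v u hs' hv hu => by simp [Expr.eval])
  have hag₂ := agreeOff_exec (pick 6 7 8 (.and (.isZero (.get (b + 9) (.reg 6)))
      (.isZero (.op .eq (.get (b + 7) (.get 6 (.reg 6))) (.get (b + 7) (.get 6 (.get 4 (.reg 6)))))))
      (.const 0)) s₁
    (R := [6, 7, 8]) (B := []) (by simp [pick, writtenRegs]) (by simp [pick, writtenArrs])
  set s₂ := (pick 6 7 8 (.and (.isZero (.get (b + 9) (.reg 6)))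
      (.isZero (.op .eq (.get (b + 7) (.get 6 (.reg 6))) (.get (b + 7) (.get 6 (.get 4 (.reg 6)))))))
      (.const 0)).exec s₁
  have hD₂ := hD₁.of_agreeOff hag₂ (by simp) (by simp)
  have harr₂ : s₂.arr = s.arr := (funext fun a => hag₂.2 a (by simp)).trans harr₁
  rcases hpick with ⟨h7, hno'⟩ | ⟨h7, v, hv, ⟨hv0, hvk⟩, -⟩
  swap
  · simp only [h7, one_ne_zero, if_true, not_false_eq_true]
    obtain ⟨hp, hp', hused⟩ := exec_edgeStep (b := b) hD₂ hv
    have hag' := agreeOff_exec (edgeStep b) s₂ (R := [6])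
      (B := [b + 8, b + 9]) (by simp [edgeStep, fill, writtenRegs])
      (by simp [edgeStep, fill, writtenArrs])
    have h7 : ((edgeStep b).exec s₂).arr (b + 7) = s.arr (b + 7) := by
      rw [hag'.2 _ (by simp), harr₂]
    have h10 : ((edgeStep b).exec s₂).arr (b + 10) = s.arr (b + 10) := by
      rw [hag'.2 _ (by simp), harr₂]
    rw [harr₂] at hp hp' hused
    have := hI.edge htree (v := v) hv0 hvk
      (pend' := fun v : Fin n => ((edgeStep b).exec s₂).arr (b + 8) v)
      (used' := fun v : Fin n => ((edgeStep b).exec s₂).arr (b + 9) v)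
      (by rw [hused, if_pos rfl]) (fun y hy => by rw [hused, if_neg (by simpa [Fin.val_inj] using hy)])
      hp hp'
    simp only [Refining, refineProgress, h7, h10]
    exact ⟨this.1, Or.inl this.2, id⟩
  simp only [h7, if_false, not_true_eq_false]
  have hpick := exec_pick_fin (s := s₂) (i := 6) (f := 7) (b := 8)
    (cond := .isZero (.get (b + 10) (.reg 6)))
    (better := .op .lt (.get T (.reg 8)) (.get T (.reg 6))) hD₂.reg_zero (by rfl)
    (by omega) (by omega) (by omega) (fun c => s.arr (b + 10) c = 0) (fun c => prio c)
    (fun s' v hs' hv => by simp [Expr.eval, Op.eval, hs'.2, harr₂, hv])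
    (fun s' v u hs' hv hu => by simp [Expr.eval, Op.eval, hs'.2, harr₂, hv, hu, hT])
  have hag₃ := agreeOff_exec (pick 6 7 8 (.isZero (.get (b + 10) (.reg 6)))
    (.op .lt (.get T (.reg 8)) (.get T (.reg 6)))) s₂
    (R := [6, 7, 8]) (B := []) (by simp [pick, writtenRegs]) (by simp [pick, writtenArrs])
  set s₃ := (pick 6 7 8 (.isZero (.get (b + 10) (.reg 6)))
    (.op .lt (.get T (.reg 8)) (.get T (.reg 6)))).exec s₂
  have hD₃ := hD₂.of_agreeOff hag₃ (by simp) (by simp)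
  have harr₃ : s₃.arr = s.arr := (funext fun a => hag₃.2 a (by simp)).trans harr₂
  rcases hpick with ⟨h7, hall⟩ | ⟨h7, C, hC, hC0, hmax⟩
  · simp only [h7, if_false, not_true_eq_false, Refining, refineProgress, harr₃]
    exact ⟨hI, Or.inr hall, fun _ => hall⟩
  simp only [h7, one_ne_zero, if_true, not_false_eq_true]
  obtain ⟨hkey, hchosen⟩ := exec_splitStep (b := b) hD₃.reg_zero hC
  have hag' := agreeOff_exec (splitStep b) s₃ (R := [6, 13])
    (B := [b + 7, b + 10]) (by simp [splitStep, fill, writtenRegs])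
    (by simp [splitStep, fill, writtenArrs])
  have h8 : ((splitStep b).exec s₃).arr (b + 8) = s.arr (b + 8) := by
    rw [hag'.2 _ (by simp), harr₃]
  have h9 : ((splitStep b).exec s₃).arr (b + 9) = s.arr (b + 9) := by
    rw [hag'.2 _ (by simp), harr₃]
  rw [harr₃] at hkey hchosen
  have := hI.split htree (C := C) hno (fun v hv => by
      by_contra hcon
      exact hno' v ⟨hv, hcon⟩) hC0 (fun c hc => by exact_mod_cast hmax c hc) (funext hkey)
    (chosen' := fun v : Fin n => ((splitStep b).exec s₃).arr (b + 10) v)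
    (by rw [hchosen, if_pos rfl])
    (fun y hy => by rw [hchosen, if_neg (by simpa [Fin.val_inj] using hy)])
  simp only [Refining, refineProgress, h8, h9]
  exact ⟨this.1, Or.inl this.2, fun hall => absurd hC0 (hall C)⟩

/-- Each of the `n` rounds contains three steps, and a step makes progress unless everything has
been chosen. So `3 n` steps suffice, and then all classes are singletons. -/
theorem exec_refine {T : ℕ} {prio : Fin n → ℕ} (hD : CliqueData G t par rep s)
    (hT : ∀ v : Fin n, s.arr T v = prio v) (hTb : T ∉ [b + 7, b + 8, b + 9, b + 10])
    (htree : CliqueTree (InMaxClique G t rep) (Earlier G t) rep fun v => rep (par v))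
    (h0 : ∀ a ∈ [b + 7, b + 8, b + 9, b + 10], ∀ j, s.arr a j = 0) :
    Relation.ReflTransGen (RefineStep (InMaxClique G t rep) prio) (fun _ => 0)
      (fun v : Fin n => ((refine T b).exec s).arr (b + 7) v) ∧
    Function.Injective (fun v : Fin n => ((refine T b).exec s).arr (b + 7) v) := by
  have key := exec_loop (s := s) (i := 9)
    (p := .seq (refineStep T b) (.seq (refineStep T b) (refineStep T b)))
    (I := fun m s' => AgreeOff [6, 7, 8, 9, 10, 11, 12, 13, 14] [b + 7, b + 8, b + 9, b + 10] s s' ∧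
      Refining G t rep prio b s' ∧
      (3 * m ≤ refineProgress n b s' ∨ ∀ c : Fin n, s'.arr (b + 10) c ≠ 0)) (by rfl) ?_ ?_
  · obtain ⟨-, hI, hall⟩ := key
    rw [hD.reg_zero] at hall
    refine ⟨hI.steps, hI.injective_of_chosen ?_⟩
    rcases hall with hall | hall
    · exact chosen_of_progress (by rw [Fintype.card_fin]; exact hall)
    · exact hall
  · simp only [List.mem_cons, List.not_mem_nil, or_false, forall_eq_or_imp, forall_eq] at h0
    refine ⟨⟨fun r hr => ?_, fun _ _ => rfl⟩, ?_, Or.inl (by simp)⟩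
    · simp only [List.mem_cons, not_or] at hr
      simp [hr]
    · simp only [Refining, State.setReg_arr, h0]
      exact RefineInvariant.init
  · rintro m s' - - - ⟨hag, hI, hm⟩
    have step : ∀ s', AgreeOff [6, 7, 8, 9, 10, 11, 12, 13, 14] [b + 7, b + 8, b + 9, b + 10] s s' →
        Refining G t rep prio b s' → ∀ q, (q ≤ refineProgress n b s' ∨
          ∀ c : Fin n, s'.arr (b + 10) c ≠ 0) →
        AgreeOff [6, 7, 8, 9, 10, 11, 12, 13, 14] [b + 7, b + 8, b + 9, b + 10] s
          ((refineStep T b).exec s') ∧ Refining G t rep prio b ((refineStep T b).exec s') ∧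
        (q + 1 ≤ refineProgress n b ((refineStep T b).exec s') ∨
          ∀ c : Fin n, ((refineStep T b).exec s').arr (b + 10) c ≠ 0) := by
      intro s' hag hI q hq
      obtain ⟨h1, h2, h3⟩ := exec_refineStep (T := T) (hD.of_agreeOff hag (by simp) (by simp))
        (fun v => by rw [hag.2 T hTb, hT]) htree hI
      refine ⟨hag.trans ((agreeOff_refineStep T b s').mono (by simp) (by simp)), h1, ?_⟩
      rcases hq with hq | hq
      · exact h2.imp (fun h => by omega) id
      · exact Or.inr (h3 hq)
    obtain ⟨a1, b1, c1⟩ := step s' hag hI _ hm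
    obtain ⟨a2, b2, c2⟩ := step _ a1 b1 _ c1
    obtain ⟨a3, b3, c3⟩ := step _ a2 b2 _ c2
    refine ⟨⟨fun r hr => ?_, a3.2⟩, b3, c3⟩
    rw [State.setReg_reg, if_neg (by rintro rfl; simp at hr)]
    exact a3.1 r hr

end Refine

end Cmd

end RAM

open Classical in
-- As `p` decreases by one, the count is updated by a single comparison. This keeps an entry of the
-- table linear and the whole table quadratic.
theorem innerCount_eq_succ_add {V : Type*} [Fintype V] {pos last : V → ℕ}
    (hpos : Function.Injective pos) (v : V) (q : ℕ) :
    innerCount pos last (pos v) q =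
      innerCount pos last (pos v + 1) q + if last v < q then 1 else 0 := by
  have hsplit : ∀ u, pos v ≤ pos u ↔ u = v ∨ pos v + 1 ≤ pos u := fun u => by
    constructor
    · intro h
      rcases h.eq_or_lt with h | h
      · exact Or.inl (hpos h.symm)
      · exact Or.inr h
    · rintro (rfl | h)
      · exact le_rfl
      · omega
  rw [innerCount, innerCount]
  split_ifs with h
  · rw [← Finset.card_insert_of_notMem (a := v) (by simp)]
    congr 1
    ext u
    by_cases hu : u = v
    · simp [hu, h]
    · simp [hsplit, hu]
  · rw [add_zero]
    congr 1
    ext u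
    by_cases hu : u = v
    · simp [hu, h]
    · simp [hsplit, hu]

theorem innerCount_succ_self {V : Type*} [Fintype V] {pos last : V → ℕ}
    (h : ∀ v, pos v ≤ last v) (q : ℕ) : innerCount pos last q q = 0 := by
  rw [innerCount, Finset.card_eq_zero, Finset.filter_eq_empty_iff]
  intro v _ hv
  have := h v
  omega

namespace RAM

namespace Cmd

/-! ### Computing the order of the vertices and the table -/

variable {n : ℕ} {s : State}

theorem exec_tabulate_fin {i a : ℕ} {p : Cmd} {e : Expr} (hn : s.reg 0 = n)
    (hwf : (tabulate i a p e).wellFormed) (hp : p.writtenArrs = []) (R : Fin n → ℕ → Prop)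
    (hR : ∀ s' (v : Fin n), AgreeOff (i :: p.writtenRegs) [a] s s' → s'.reg i = v →
      s'.reg 0 = n → R v (e.eval (p.exec s'))) :
    ∀ v : Fin n, R v (((tabulate i a p e).exec s).arr a v) := by
  intro v
  exact exec_tabulate (s := s) hwf hp (fun j x => ∀ hj : j < n, R ⟨j, hj⟩ x)
    (fun s' hs' _ h0 hj => hR s' ⟨_, hj⟩ hs' rfl (h0.trans hn)) v (by omega) v.2

open Classical in
theorem exec_count_fin {i r : ℕ} {cond : Expr} (hn : s.reg 0 = n)
    (hwf : (count i r cond).wellFormed) (hir : i ≠ r) (P : Fin n → Prop)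
    (hP : ∀ s' (v : Fin n), AgreeOff [i, r] [] s s' → s'.reg i = v → (cond.eval s' ≠ 0 ↔ P v)) :
    ((count i r cond).exec s).reg r = (Finset.univ.filter P).card := by
  rw [exec_count hwf hir (fun j => ∃ hj : j < n, P ⟨j, hj⟩) fun s' hs' hlt => ?_, hn]
  · convert card_range_filter P
  rw [hn] at hlt
  rw [hP s' ⟨_, hlt⟩ hs' rfl]
  exact ⟨fun h => ⟨hlt, h⟩, fun h => h.2⟩

/-- Array `16` gets the key of the first maximal clique around every vertex, where array `11` holds
the keys of the cliques. -/
def firstCliques : Cmd :=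
  tabulate 5 16 (pick 6 7 8 (.member 6 5) (.op .lt (.get 11 (.reg 6)) (.get 11 (.reg 8))))
    (.get 11 (.reg 8))

/-- Array `17` gets the ranks of the vertices with respect to array `16`. -/
def ranks : Cmd :=
  tabulate 5 17 (count 6 7 (.or (.op .lt (.get 16 (.reg 6)) (.get 16 (.reg 5)))
    (.and (.op .eq (.get 16 (.reg 6)) (.get 16 (.reg 5))) (.op .lt (.reg 6) (.reg 5))))) (.reg 7)

/-- Array `18` gets the last positions in the closed neighbourhoods of the vertices. -/
def lastNeighbors : Cmd :=
  tabulate 5 18 (pick 6 7 8 (.or (.op .eq (.reg 6) (.reg 5)) (.adjacency 5 6))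
    (.op .lt (.get 17 (.reg 8)) (.get 17 (.reg 6)))) (.get 17 (.reg 8))

/-- Array `19` gets the entries of array `18`, sorted by position. -/
def sortByRank : Cmd :=
  .loop 5 (.store 19 (.get 17 (.reg 5)) (.get 18 (.reg 5)))

/-- `min n (keep p + min A l)`, where register `7` holds `A` and `p` is given by `5` and `6`. -/
def candidate : Expr :=
  -- Minima are written as `x - (x - y)`. The truncation at `n` makes the slope of the expression
  -- one; the plain sum of a table entry and a count would have slope two and break the bound on the
  -- growth of numbers.
  .op .sub (.reg 0) (.op .sub (.reg 0) (.op .add (.get 20 (.op .sub (.reg 5) (.reg 6)))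
    (.op .sub (.reg 7) (.op .sub (.reg 7) (.reg 2)))))

/-- Try the next candidate for the entry which is computed in register `8`. -/
def keepRound : Cmd :=
  -- The counter in register `6` always runs up to `n - 1`; rounds with `6` beyond `5` have no
  -- candidate `p = q - m`.
  .ite (.op .lt (.reg 5) (.reg 6)) .skip
    (.seq (.assign 7 (.op .add (.reg 7) (.op .lt (.get 19 (.op .sub (.reg 5) (.reg 6)))
      (.op .add (.reg 5) (.const 1)))))
    (.ite (.op .lt (.reg 8) candidate) (.assign 8 candidate) .skip))

/-- Compute the next entry of the table of array `20` in register `8`. -/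
def keepEntry : Cmd :=
  .seq (.assign 7 (.const 0)) (.seq (.assign 8 (.const 0))
  (.loop 6 keepRound))

/-- Fill the table of array `20`. -/
def keepTable : Cmd :=
  .loop 5 (.seq keepEntry (.store 20 (.op .add (.reg 5) (.const 1)) (.reg 8)))

theorem exec_firstCliques {G : SimpleGraph (Fin n)} {t : Fin n → ℕ} {par rep : Fin n → Fin n}
    (hD : CliqueData G t par rep s) (hex : ∀ x, ∃ c, InMaxClique G t rep c x) :
    (∀ x : Fin n, ∃ c : Fin n, InMaxClique G t rep c x ∧
      s.arr 11 c = (firstCliques.exec s).arr 16 x) ∧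
    ∀ x c : Fin n, InMaxClique G t rep c x → (firstCliques.exec s).arr 16 x ≤ s.arr 11 c := by
  rw [← forall_and]
  refine exec_tabulate_fin hD.reg_zero (by rfl) (by rfl) (fun x y =>
    (∃ c : Fin n, InMaxClique G t rep c x ∧ s.arr 11 c = y) ∧
    ∀ c : Fin n, InMaxClique G t rep c x → y ≤ s.arr 11 c) fun s' x hs' hx h0 => ?_
  have hD' := hD.of_agreeOff hs' (by decide) (by decide)
  have h11 : s'.arr 11 = s.arr 11 := hs'.2 11 (by simp)
  have hpick := exec_pick_fin (s := s') (i := 6) (f := 7) (b := 8) (cond := .member 6 5)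
    (better := .op .lt (.get 11 (.reg 6)) (.get 11 (.reg 8))) h0 (by rfl)
    (by omega) (by omega) (by omega) (fun c => InMaxClique G t rep c x)
    (fun c => - (s.arr 11 c : ℤ))
    (fun s'' v hs'' hv => (hD'.of_agreeOff hs'' (by simp) (by simp)).member_iff hv
      (by rw [hs''.1 5 (by simp), hx]))
    (fun s'' v u hs'' hv hu => by simp [Expr.eval, Op.eval, hs''.2, h11, hv, hu])
  have hag := agreeOff_exec (pick 6 7 8 (.member 6 5)
    (.op .lt (.get 11 (.reg 6)) (.get 11 (.reg 8)))) s' (R := [6, 7, 8]) (B := [])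
    (by simp [pick, writtenRegs]) (by simp [pick, writtenArrs])
  rcases hpick with ⟨-, hno⟩ | ⟨-, c, hc, hcA, hle⟩
  · obtain ⟨c, hc⟩ := hex x
    exact absurd hc (hno c)
  · simp only [Expr.eval, hc, hag.2 11 (by simp), h11]
    exact ⟨⟨c, hcA, rfl⟩, fun d hd => by have := hle d hd; omega⟩

theorem exec_ranks (hn : s.reg 0 = n) (x : Fin n) :
    (ranks.exec s).arr 17 x = leftRank (fun v : Fin n => s.arr 16 v) x := by
  refine exec_tabulate_fin hn (by rfl) (by rfl)
    (fun x y => y = leftRank (fun v : Fin n => s.arr 16 v) x) (fun s' x hs' hx h0 => ?_) x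
  rw [Expr.eval, exec_count_fin h0 (by rfl) (by omega) (fun v => s.arr 16 v < s.arr 16 x ∨
    (s.arr 16 v = s.arr 16 x ∧ v < x)), leftRank]
  · congr
  intro s'' v hs'' hv
  have hx' : s''.reg 5 = x := by rw [hs''.1 5 (by simp), hx]
  have h16 : s''.arr 16 = s.arr 16 := by rw [hs''.2 16 (by simp), hs'.2 16 (by simp)]
  refine Expr.or_iff (Expr.lt_iff.trans ?_) (Expr.and_iff (Expr.eq_iff.trans ?_)
    (Expr.lt_iff.trans ?_)) <;> simp [Expr.eval, hv, hx', h16]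

theorem exec_lastNeighbors {G : SimpleGraph (Fin n)} (hG : Encodes G s) :
    LastNeighbor G (fun v : Fin n => s.arr 17 v)
      fun v : Fin n => (lastNeighbors.exec s).arr 18 v := by
  have key := exec_tabulate_fin (s := s) (i := 5) (a := 18)
    (p := pick 6 7 8 (.or (.op .eq (.reg 6) (.reg 5)) (.adjacency 5 6))
      (.op .lt (.get 17 (.reg 8)) (.get 17 (.reg 6)))) (e := .get 17 (.reg 8))
    hG.reg_zero (by rfl) (by rfl) (fun x y =>
    (∃ u : Fin n, (u = x ∨ G.Adj x u) ∧ y = s.arr 17 u) ∧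
    ∀ u : Fin n, (u = x ∨ G.Adj x u) → s.arr 17 u ≤ y) (fun s' x hs' hx h0 => ?_)
  · exact ⟨fun v => (key v).2 v (Or.inl rfl), fun v u h => (key v).2 u (Or.inr h),
      fun v => (key v).1⟩
  have hG' := hG.of_agreeOff hs' (by decide) (by decide)
  have h17 : s'.arr 17 = s.arr 17 := hs'.2 17 (by simp)
  have hpick := exec_pick_fin (s := s') (i := 6) (f := 7) (b := 8)
    (cond := .or (.op .eq (.reg 6) (.reg 5)) (.adjacency 5 6))
    (better := .op .lt (.get 17 (.reg 8)) (.get 17 (.reg 6))) h0 (by rfl)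
    (by omega) (by omega) (by omega) (fun u => u = x ∨ G.Adj x u) (fun u => s.arr 17 u)
    (fun s'' v hs'' hv => by
      have hx' : s''.reg 5 = x := by rw [hs''.1 5 (by simp), hx]
      have := (hG'.of_agreeOff hs'' (by simp) (by simp)).adjacency_iff (u := 5) (v := 6)
        (by omega) (by omega)
      simp only [hx', hv] at this
      exact Expr.or_iff (Expr.eq_iff.trans (by simp [Expr.eval, hv, hx', Fin.val_inj])) this)
    (fun s'' v u hs'' hv hu => by simp [Expr.eval, Op.eval, hs''.2, h17, hv, hu])
  have hag := agreeOff_exec (pick 6 7 8 (.or (.op .eq (.reg 6) (.reg 5)) (.adjacency 5 6))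
    (.op .lt (.get 17 (.reg 8)) (.get 17 (.reg 6)))) s' (R := [6, 7, 8]) (B := [])
    (by simp [pick, writtenRegs]) (by simp [pick, writtenArrs])
  rcases hpick with ⟨-, hno⟩ | ⟨-, c, hc, hcA, hle⟩
  · exact absurd (Or.inl rfl) (hno x)
  · simp only [Expr.eval, hc, hag.2 17 (by simp), h17]
    exact ⟨⟨c, hcA, rfl⟩, fun u hu => by exact_mod_cast hle u hu⟩

theorem exec_sortByRank (hn : s.reg 0 = n)
    (hinj : Function.Injective fun v : Fin n => s.arr 17 v) (v : Fin n) :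
    (sortByRank.exec s).arr 19 (s.arr 17 v) = s.arr 18 v := by
  have key := exec_loop (s := s) (i := 5) (p := .store 19 (.get 17 (.reg 5)) (.get 18 (.reg 5)))
    (I := fun m s' => s'.arr 17 = s.arr 17 ∧ s'.arr 18 = s.arr 18 ∧
      ∀ v : Fin n, v < m → s'.arr 19 (s.arr 17 v) = s.arr 18 v) (by rfl) ⟨rfl, rfl, by simp⟩ ?_
  · rw [hn] at key
    exact key.2.2 v v.2
  · rintro m s' hm h5 - ⟨h17, h18, h19⟩
    rw [hn] at hm
    refine ⟨?_, ?_, fun v hv => ?_⟩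
    · rw [← h17]; funext j; simp [exec]
    · rw [← h18]; funext j; simp [exec]
    · by_cases hvm : (v : ℕ) = m
      · simp [exec, Expr.eval, h5, h17, h18, hvm]
      · have : s.arr 17 v ≠ s.arr 17 m := fun h =>
          hvm (congrArg Fin.val (hinj (a₁ := v) (a₂ := ⟨m, hm⟩) h))
        simp [exec, Expr.eval, h5, h17, this, h19 v (by omega)]

theorem exec_keepEntry (hn : s.reg 0 = n) {q : ℕ} (hq : s.reg 5 = q) (hqn : q < n)
    {pos last : Fin n → ℕ} (hinj : Function.Injective pos) (hsurj : ∀ p < n, ∃ v, pos v = p)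
    (hle : ∀ v, pos v ≤ last v) (hlast : ∀ v, s.arr 19 (pos v) = last v) :
    (∀ p ≤ q, min n (s.arr 20 p + min (innerCount pos last p (q + 1)) (s.reg 2)) ≤
      (keepEntry.exec s).reg 8) ∧
    ((keepEntry.exec s).reg 8 = 0 ∨ ∃ p ≤ q, (keepEntry.exec s).reg 8 ≤
      s.arr 20 p + min (innerCount pos last p (q + 1)) (s.reg 2)) := by
  have hn₁ : ((s.setReg 7 0).setReg 8 0).reg 0 = n := by simp [hn]
  have key := exec_loop (s := (s.setReg 7 0).setReg 8 0) (i := 6)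
    (p := keepRound)
    -- Round `m` treats `p = q - m`, so the candidates are scanned downwards from `q`. For `m > q`
    -- the truncated difference `q + 1 - m` stays at `0`, as does the state of the count.
    (I := fun m s' => AgreeOff [6, 7, 8] [] s s' ∧
      s'.reg 7 = innerCount pos last (q + 1 - m) (q + 1) ∧
      (∀ p ≤ q, q + 1 ≤ p + m →
        min n (s.arr 20 p + min (innerCount pos last p (q + 1)) (s.reg 2)) ≤ s'.reg 8) ∧
      (s'.reg 8 = 0 ∨ ∃ p ≤ q, s'.reg 8 ≤
        s.arr 20 p + min (innerCount pos last p (q + 1)) (s.reg 2))) (by rfl) ?_ ?_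
  · rw [hn₁] at key
    exact ⟨fun p hp => key.2.2.1 p hp (by omega), key.2.2.2⟩
  · refine ⟨⟨fun r hr => ?_, fun _ _ => rfl⟩, ?_, fun p _ _ => by omega, Or.inl (by simp)⟩
    · simp only [List.mem_cons, List.not_mem_nil, or_false, not_or] at hr
      simp [hr]
    · simp [innerCount_succ_self hle]
  · rintro m s' hm h6 h0 ⟨hag, h7, h8, h8'⟩
    rw [hn₁] at hm h0
    refine ⟨hag.trans (AgreeOff.trans (agreeOff_exec keepRound s'
      (by simp [keepRound, writtenRegs]) (by simp [keepRound, writtenArrs])) ⟨fun r hr => ?_, fun _ _ => rfl⟩), ?_⟩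
    · simp only [List.mem_cons, List.not_mem_nil, or_false, not_or] at hr
      simp [hr]
    have h5 : s'.reg 5 = q := by rw [hag.1 5 (by simp), hq]
    have h2 : s'.reg 2 = s.reg 2 := hag.1 2 (by simp)
    by_cases hmq : q < m
    · have hc : (Expr.op .lt (.reg 5) (.reg 6)).eval s' ≠ 0 := by
        rw [Expr.lt_iff, Expr.eval, Expr.eval, h5, h6]; exact hmq
      simp only [keepRound, exec, if_pos hc, State.setReg_reg]
      refine ⟨?_, fun p hp _ => ?_, ?_⟩
      · rw [if_neg (by decide), h7]; congr 1; omega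
      · rw [if_neg (by decide)]; exact h8 p hp (by omega)
      · rw [if_neg (by decide)]; exact h8'
    · have hc : ¬ (Expr.op .lt (.reg 5) (.reg 6)).eval s' ≠ 0 := by
        rw [Expr.lt_iff, Expr.eval, Expr.eval, h5, h6]; exact hmq
      obtain ⟨v, hv⟩ := hsurj (q - m) (by omega)
      have hA := innerCount_eq_succ_add (last := last) hinj v (q + 1)
      rw [hv, show q - m + 1 = q + 1 - m by omega, ← h7] at hA
      have h19 : s'.arr 19 (q - m) = last v := by rw [hag.2 19 (by simp), ← hv, hlast]
      have h20 : s'.arr 20 = s.arr 20 := hag.2 20 (by simp)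
      set s₁ := s'.setReg 7 (Expr.eval s' (.op .add (.reg 7) (.op .lt
        (.get 19 (.op .sub (.reg 5) (.reg 6))) (.op .add (.reg 5) (.const 1))))) with hs₁
      have h7₁ : s₁.reg 7 = innerCount pos last (q - m) (q + 1) := by
        rw [hA]; simp [hs₁, Expr.eval, Op.eval, h5, h6, h19]
      have hcand : candidate.eval s₁ =
          min n (s.arr 20 (q - m) + min (innerCount pos last (q - m) (q + 1)) (s.reg 2)) := by
        have h1 : s₁.reg 0 = n := by simp [hs₁, h0]
        have h3 : s₁.reg 5 = q := by simp [hs₁, h5]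
        have h4 : s₁.reg 6 = m := by simp [hs₁, h6]
        have h9 : s₁.reg 2 = s.reg 2 := by simp [hs₁, h2]
        have h10 : s₁.arr 20 = s.arr 20 := by simp [hs₁, h20]
        simp only [candidate, Expr.eval, Op.eval, h1, h3, h4, h7₁, h9, h10]
        omega
      have h8₁ : s₁.reg 8 = s'.reg 8 := by simp [hs₁]
      have hmem : ∀ p ≤ q, q + 1 ≤ p + (m + 1) → p ≠ q - m → q + 1 ≤ p + m := by omega
      have hlt : (Expr.op .lt (.reg 8) candidate).eval s₁ ≠ 0 ↔
          s'.reg 8 < candidate.eval s₁ := by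
        rw [Expr.lt_iff, Expr.eval, h8₁]
      have hexec : keepRound.exec s' =
          if s'.reg 8 < candidate.eval s₁ then s₁.setReg 8 (candidate.eval s₁) else s₁ := by
        rw [keepRound, exec, if_neg hc]
        by_cases hbet : s'.reg 8 < candidate.eval s₁
        · rw [if_pos hbet]; exact if_pos (hlt.2 hbet)
        · rw [if_neg hbet]; exact if_neg (mt hlt.1 hbet)
      rw [hexec]
      clear_value s₁
      by_cases hbet : s'.reg 8 < candidate.eval s₁
      · simp only [if_pos hbet, State.setReg_reg]
        refine ⟨?_, fun p hp hpm => ?_, Or.inr ⟨q - m, by omega, ?_⟩⟩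
        · simp only [Nat.reduceEqDiff, if_false, h7₁]
          congr 1; omega
        · simp only [Nat.reduceEqDiff, if_false, if_true]
          by_cases hpe : p = q - m
          · rw [hcand, hpe]
          · exact (h8 p hp (hmem p hp hpm hpe)).trans hbet.le
        · simp only [Nat.reduceEqDiff, if_false, if_true, hcand]
          omega
      · simp only [if_neg hbet, State.setReg_reg]
        refine ⟨?_, fun p hp hpm => ?_, ?_⟩
        · simp only [Nat.reduceEqDiff, if_false, h7₁]
          congr 1; omega
        · simp only [Nat.reduceEqDiff, if_false, h8₁]
          by_cases hpe : p = q - m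
          · rw [hpe, ← hcand]; omega
          · exact h8 p hp (hmem p hp hpm hpe)
        · simp only [Nat.reduceEqDiff, if_false, h8₁]
          exact h8'

theorem exec_keepTable (hn : s.reg 0 = n) (h20 : s.arr 20 0 = 0)
    {pos last : Fin n → ℕ} (hinj : Function.Injective pos) (hsurj : ∀ p < n, ∃ v, pos v = p)
    (hle : ∀ v, pos v ≤ last v) (hlast : ∀ v, s.arr 19 (pos v) = last v) :
    KeepTable pos last (s.reg 2) ((keepTable.exec s).arr 20) := by
  have key := exec_loop (s := s) (i := 5)
    (p := .seq keepEntry (.store 20 (.op .add (.reg 5) (.const 1)) (.reg 8)))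
    (I := fun m s' => AgreeOff [5, 6, 7, 8] [20] s s' ∧ s'.arr 20 0 = 0 ∧
      ∀ q < m, (∀ p ≤ q, min n (s'.arr 20 p + min (innerCount pos last p (q + 1)) (s.reg 2)) ≤
        s'.arr 20 (q + 1)) ∧ (s'.arr 20 (q + 1) = 0 ∨ ∃ p ≤ q, s'.arr 20 (q + 1) ≤
        s'.arr 20 p + min (innerCount pos last p (q + 1)) (s.reg 2))) (by rfl) ?_ ?_
  · rw [hn] at key
    obtain ⟨-, h1, h2⟩ := key
    exact ⟨h1, fun q hq => by rw [Fintype.card_fin] at hq ⊢; exact (h2 q hq).1,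
      fun q hq => by rw [Fintype.card_fin] at hq; exact (h2 q hq).2⟩
  · refine ⟨⟨fun r hr => ?_, fun _ _ => rfl⟩, h20, by simp⟩
    simp only [List.mem_cons, List.not_mem_nil, or_false, not_or] at hr
    simp [hr]
  · rintro m s' hm h5 h0 ⟨hag, hz, hI⟩
    rw [hn] at hm h0
    obtain ⟨h1, h2⟩ := exec_keepEntry h0 h5 hm hinj hsurj hle
      (fun v => by rw [hag.2 19 (by simp), hlast])
    have hag' := agreeOff_exec keepEntry s' (R := [6, 7, 8]) (B := [])
      (by simp [keepEntry, keepRound, writtenRegs]) (by simp [keepEntry, keepRound, writtenArrs])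
    have h5' : (keepEntry.exec s').reg 5 = m := by rw [hag'.1 5 (by simp), h5]
    simp only [exec, Expr.eval, Op.eval, h5']
    rw [hag.1 2 (by simp)] at h1 h2
    set x := (keepEntry.exec s').reg 8
    have h20' : ∀ j, (((keepEntry.exec s').setArr 20 (m + 1) x).setReg 5 (m + 1)).arr 20 j =
        if j = m + 1 then x else s'.arr 20 j := fun j => by simp [hag'.2 20]
    refine ⟨⟨fun r hr => ?_, fun a ha => ?_⟩, ?_, fun q hq => ?_⟩
    · simp only [List.mem_cons, List.not_mem_nil, or_false, not_or] at hr
      simp [hr, hag'.1 r, hag.1 r]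
    · simp only [List.mem_cons, List.not_mem_nil, or_false] at ha
      funext j
      simp [ha, hag'.2 a, hag.2 a]
    · rw [h20', if_neg (by omega), hz]
    · have hne : ∀ p ≤ q, (((keepEntry.exec s').setArr 20 (m + 1) x).setReg 5 (m + 1)).arr 20 p =
          s'.arr 20 p := fun p hp => by rw [h20', if_neg (by omega)]
      rcases Nat.lt_succ_iff_lt_or_eq.1 hq with hlt | rfl
      · rw [h20' (q + 1), if_neg (by omega)]
        refine ⟨fun p hp => ?_, (hI q hlt).2.imp id ?_⟩
        · rw [hne p hp]; exact (hI q hlt).1 p hp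
        · rintro ⟨p, hp, h⟩
          exact ⟨p, hp, by rw [hne p hp]; exact h⟩
      · rw [h20' (q + 1), if_pos rfl]
        refine ⟨fun p hp => ?_, h2.imp id ?_⟩
        · rw [hne p hp]; exact h1 p hp
        · rintro ⟨p, hp, h⟩
          exact ⟨p, hp, by rw [hne p hp]; exact h⟩

end Cmd

end RAM

/-! ### Assembling the algorithm. -/

namespace RAM

namespace Cmd

/-- Compute the maximal cliques and a tree of them. -/
def cliques : Cmd :=
  .seq search (.seq parents (.seq sizes representatives))

theorem exec_cliques {n : ℕ} {G : SimpleGraph (Fin n)} {s : State} {r : Fin n → Fin n → Prop}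
    (hr : IntervalModel G r) (hG : Encodes G s) (h1 : ∀ v, s.arr 1 v = 0)
    (h2 : ∀ v, s.arr 2 v = 0) :
    ∃ (t : Fin n → ℕ) (par rep : Fin n → Fin n), EarlierCliques G t ∧ CliqueRep G t rep ∧
      (∀ v x, Earlier G t v x → IsParent G t v (par v)) ∧
      CliqueData G t par rep (cliques.exec s) := by
  obtain ⟨⟨cnt, hinv⟩, hord⟩ := exec_search hG h1 h2
  have hag₁ := agreeOff_exec search s (R := [5, 6, 7, 8]) (B := [1, 2, 3]) (by decide) (by decide)
  simp only [cliques, exec]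
  set s₁ := search.exec s
  have hG₁ := hG.of_agreeOff hag₁ (by simp) (by simp)
  obtain ⟨ht, ht0⟩ := SearchInvariant.earlierCliques (by rwa [Fintype.card_fin]) hr
  set t : Fin n → ℕ := fun v => s₁.arr 1 v with htdef
  obtain ⟨par, hpar, hp, hp'⟩ := exec_parents hG₁ (t := t) (fun _ => rfl)
  have hag₂ := agreeOff_exec parents s₁ (R := [5, 6, 7, 8]) (B := [4]) (by decide) (by decide)
  set s₂ := parents.exec s₁
  have hG₂ := hG₁.of_agreeOff hag₂ (by simp) (by simp)
  have hsize := exec_sizes hG₂ (t := t) (fun v => by rw [hag₂.2 1 (by simp)])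
  have hag₃ := agreeOff_exec sizes s₂ (R := [5, 6, 7, 8]) (B := [5]) (by decide) (by decide)
  set s₃ := sizes.exec s₂
  have hG₃ := hG₂.of_agreeOff hag₃ (by simp) (by simp)
  have h4 : ∀ v : Fin n, s₃.arr 4 v = par v := fun v => by rw [hag₃.2 4 (by simp), hpar]
  obtain ⟨rep, hrep, hcr⟩ := exec_representatives hG₃.reg_zero ht hinv.le hinv.exists_eq
    (fun v => by rw [hag₃.2 3 (by simp), hag₂.2 3 (by simp)]; exact hord v (ht0 v)) h4 hp hp' hsize
  have hag₄ := agreeOff_exec representatives s₃ (R := [5, 6, 7, 8]) (B := [6]) (by decide)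
    (by decide)
  exact ⟨t, par, rep, ht, hcr, hp, hG₃.of_agreeOff hag₄ (by simp) (by simp),
    fun v => by rw [hag₄.2 1 (by simp), hag₃.2 1 (by simp), hag₂.2 1 (by simp)],
    fun v => by rw [hag₄.2 4 (by simp), h4], hrep⟩

theorem agreeOff_refine (T b : ℕ) (s : State) :
    AgreeOff [6, 7, 8, 9, 10, 11, 12, 13, 14] [b + 7, b + 8, b + 9, b + 10] s
      ((refine T b).exec s) := by
  refine agreeOff_exec _ _ ?_ ?_
  · simp [refine, refineStep, pivotStep, edgeStep, splitStep, pick, fill, writtenRegs]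
  · simp [refine, refineStep, pivotStep, edgeStep, splitStep, pick, fill, writtenArrs]

/-- Compute a consecutive arrangement of the maximal cliques; its keys are in array `11`. -/
def arrangement : Cmd :=
  .seq (refine 15 0) (refine 7 4)

theorem exec_arrangement {n : ℕ} {G : SimpleGraph (Fin n)} {t : Fin n → ℕ} {par rep : Fin n → Fin n}
    {s : State} (hD : CliqueData G t par rep s) (ht : EarlierCliques G t)
    (hrep : CliqueRep G t rep) (hpar : ∀ v x, Earlier G t v x → IsParent G t v (par v))
    (hex : ∃ r, ConsecutiveOn (InMaxClique G t rep) Set.univ r)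
    (h0 : ∀ a ∈ [7, 8, 9, 10, 11, 12, 13, 14], ∀ j, s.arr a j = 0) :
    ∀ x c d e : Fin n, InMaxClique G t rep c x → InMaxClique G t rep e x →
      (arrangement.exec s).arr 11 c ≤ (arrangement.exec s).arr 11 d →
      (arrangement.exec s).arr 11 d ≤ (arrangement.exec s).arr 11 e → InMaxClique G t rep d x := by
  have htree : CliqueTree (InMaxClique G t rep) (Earlier G t) rep fun v => rep (par v) :=
    ⟨fun f x hf => ht.constant_of_tree hpar f x hf, fun v x hx => ht.inMaxClique_edge hrep hpar hx⟩
  -- The first pass may use any priorities, so the content of array `15` does not matter. The second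
  -- pass takes the keys of the first one, in array `7`, as its priorities.
  obtain ⟨h1, hinj1⟩ := exec_refine (T := 15) (b := 0) (prio := fun v : Fin n => s.arr 15 v) hD
    (fun _ => rfl) (by simp) htree (fun a ha => h0 a (by simp at ha ⊢; omega))
  have hag := agreeOff_refine 15 0 s
  simp only [arrangement, exec]
  set s₁ := (refine 15 0).exec s
  obtain ⟨h2, hinj2⟩ := exec_refine (T := 7) (b := 4) (prio := fun v : Fin n => s₁.arr 7 v)
    (hD.of_agreeOff hag (by simp) (by simp)) (fun _ => rfl) (by simp) htree (fun a ha j => by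
      simp only [List.mem_cons, List.not_mem_nil, or_false, Nat.reduceAdd] at ha
      rw [hag.2 a (by simp; omega)]
      exact h0 a (by simp; omega) j)
  intro x c d e hc he hcd hde
  exact consecutive_of_refine_twice hex h1 hinj1 h2 hinj2 hc he hcd hde

/-- Compute the table of array `20` from a consecutive arrangement. -/
def table : Cmd :=
  .seq firstCliques (.seq ranks (.seq lastNeighbors (.seq sortByRank keepTable)))

theorem exec_table {n : ℕ} {G : SimpleGraph (Fin n)} {t : Fin n → ℕ} {par rep : Fin n → Fin n}
    {s : State} (hD : CliqueData G t par rep s) (ht : EarlierCliques G t)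
    (hrep : CliqueRep G t rep)
    (hkey : ∀ x c d e : Fin n, InMaxClique G t rep c x → InMaxClique G t rep e x →
      s.arr 11 c ≤ s.arr 11 d → s.arr 11 d ≤ s.arr 11 e → InMaxClique G t rep d x)
    (h20 : s.arr 20 0 = 0) (k : ℕ) :
    COC G k (s.reg 2) ↔ n ≤ (table.exec s).arr 20 n + k := by
  obtain ⟨hleft, hmin⟩ := exec_firstCliques hD
    fun x => ⟨_, EarlierCliques.inMaxClique_rep hrep (Or.inl rfl)⟩
  have hag₁ := agreeOff_exec firstCliques s (R := [5, 6, 7, 8]) (B := [16]) (by decide) (by decide)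
  simp only [table, exec]
  set s₁ := firstCliques.exec s
  have hG₁ := hD.toEncodes.of_agreeOff hag₁ (by simp) (by simp)
  have hrank := exec_ranks hG₁.reg_zero
  have hag₂ := agreeOff_exec ranks s₁ (R := [5, 6, 7, 8]) (B := [17]) (by decide) (by decide)
  set s₂ := ranks.exec s₁
  have hG₂ := hG₁.of_agreeOff hag₂ (by simp) (by simp)
  have hlast := exec_lastNeighbors hG₂
  have hag₃ := agreeOff_exec lastNeighbors s₂ (R := [5, 6, 7, 8]) (B := [18]) (by decide)
    (by decide)
  set s₃ := lastNeighbors.exec s₂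
  have hpos : (fun v : Fin n => s₂.arr 17 v) = leftRank fun v : Fin n => s₁.arr 16 v :=
    funext hrank
  have h17 : (fun v : Fin n => s₃.arr 17 v) = leftRank fun v : Fin n => s₁.arr 16 v := by
    rw [hag₃.2 17 (by simp), hpos]
  have hn₃ : s₃.reg 0 = n := by rw [hag₃.1 0 (by simp), hG₂.reg_zero]
  have hsort := exec_sortByRank hn₃ (by rw [h17]; exact leftRank_injective)
  have hag₄ := agreeOff_exec sortByRank s₃ (R := [5, 6, 7, 8]) (B := [19]) (by decide) (by decide)
  set s₄ := sortByRank.exec s₃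
  set pos : Fin n → ℕ := leftRank fun v : Fin n => s₁.arr 16 v with hposdef
  have hinj : Function.Injective pos := leftRank_injective
  have hcard : ∀ v, pos v < Fintype.card (Fin n) := leftRank_lt_card
  have hle : ∀ v, pos v < n := fun v => by simpa using hcard v
  -- The ranks are injective and below `n`, so every position is occupied; the table is computed
  -- from the vertices at successive positions.
  have hsurj : ∀ p < n, ∃ v, pos v = p := by
    intro p hp
    have : Function.Injective fun v => (⟨pos v, hle v⟩ : Fin n) :=
      fun u v huv => hinj (congrArg Fin.val huv)
    obtain ⟨v, hv⟩ := (Finite.surjective_of_injective this) ⟨p, hp⟩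
    exact ⟨v, congrArg Fin.val hv⟩
  rw [hpos] at hlast
  have h2 : s₄.reg 2 = s.reg 2 := by
    rw [hag₄.1 2 (by simp), hag₃.1 2 (by simp), hag₂.1 2 (by simp), hag₁.1 2 (by simp)]
  have htable := exec_keepTable (s := s₄) (by rw [hag₄.1 0 (by simp), hn₃])
    (by rw [hag₄.2 20 (by simp), hag₃.2 20 (by simp), hag₂.2 20 (by simp), hag₁.2 20 (by simp), h20])
    hinj hsurj hlast.self_le (fun v => by rw [← congrFun h17 v]; exact hsort v)
  rw [h2] at htable
  have := coc_iff_keep (leftOrder_of_consecutive (fun x y => ht.adj_iff_inMaxClique hrep)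
    hkey (left := fun v : Fin n => s₁.arr 16 v) hleft hmin hinj
    fun x y h => leftRank_lt_leftRank (Or.inl h)) hcard hlast htable k
  rwa [Fintype.card_fin] at this

/-- The algorithm up to the computation of the table. -/
def solve : Cmd :=
  .seq cliques (.seq arrangement table)

/-- The answer after `solve`. -/
def answer : Expr :=
  .and (.and (.isZero (.reg 3)) (.isZero (.reg 4)))
    (.op .lt (.reg 0) (.op .add (.op .add (.get 20 (.reg 0)) (.reg 1)) (.const 1)))

theorem agreeOff_cliques (s : State) :
    AgreeOff [5, 6, 7, 8] [1, 2, 3, 4, 5, 6] s (cliques.exec s) := by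
  refine agreeOff_exec cliques s ?_ ?_
  · simp [cliques, search, parents, sizes, representatives, pick, count, fill, tabulate, writtenRegs]
  · simp [cliques, search, parents, sizes, representatives, pick, count, fill, tabulate, writtenArrs]

theorem agreeOff_arrangement (s : State) :
    AgreeOff [6, 7, 8, 9, 10, 11, 12, 13, 14] [7, 8, 9, 10, 11, 12, 13, 14] s
      (arrangement.exec s) :=
  ((agreeOff_refine 15 0 s).mono (by simp) (by simp)).trans
    ((agreeOff_refine 7 4 _).mono (by simp) (by simp))

theorem agreeOff_table (s : State) :
    AgreeOff [5, 6, 7, 8] [16, 17, 18, 19, 20] s (table.exec s) := by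
  refine agreeOff_exec table s ?_ ?_
  · simp [table, firstCliques, ranks, lastNeighbors, sortByRank, keepTable, keepEntry, keepRound,
      pick, count, tabulate, writtenRegs]
  · simp [table, firstCliques, ranks, lastNeighbors, sortByRank, keepTable, keepEntry, keepRound,
      pick, count, tabulate, writtenArrs]

theorem exec_solve {n : ℕ} {G : SimpleGraph (Fin n)} (hG : IsIntervalGraph G) (k l : ℤ)
    [Decidable (COC G k l)] :
    answer.eval (solve.exec (instanceState G k l)) = if COC G k l then 1 else 0 := by
  obtain ⟨r, hr⟩ := hG.exists_model
  have hzero : ∀ a ≠ 0, ∀ j, (instanceState G k l).arr a j = 0 := fun a ha j => by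
    simp [instanceState, ha]
  obtain ⟨t, par, rep, ht, hrep, hpar, hD⟩ := exec_cliques hr (instanceState_encodes G k l)
    (hzero 1 (by simp)) (hzero 2 (by simp))
  have hag₁ := agreeOff_cliques (instanceState G k l)
  have hkey := exec_arrangement hD ht hrep hpar (ht.exists_consecutive hr hrep)
    (fun a ha j => by
      simp only [List.mem_cons, List.not_mem_nil, or_false] at ha
      rw [hag₁.2 a (by simp; omega), hzero a (by omega)])
  have hag₂ := agreeOff_arrangement (cliques.exec (instanceState G k l))
  have hcoc := exec_table (hD.of_agreeOff hag₂ (by simp) (by simp)) ht hrep hkey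
    (by rw [hag₂.2 20 (by simp), hag₁.2 20 (by simp), hzero 20 (by simp)]) k.natAbs
  rw [hag₂.1 2 (by simp), hag₁.1 2 (by simp)] at hcoc
  have hag₃ := agreeOff_table (arrangement.exec (cliques.exec (instanceState G k l)))
  have hsolve : solve.exec (instanceState G k l) =
      table.exec (arrangement.exec (cliques.exec (instanceState G k l))) := rfl
  rw [← hsolve] at hcoc hag₃
  have hreg : ∀ i < 5, (solve.exec (instanceState G k l)).reg i = (instanceState G k l).reg i := by
    intro i hi
    rw [hag₃.1 i (by simp; omega), hag₂.1 i (by simp; omega), hag₁.1 i (by simp; omega)]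
  have h2 : (instanceState G k l).reg 2 = l.natAbs := by simp [instanceState]
  rw [h2] at hcoc
  simp only [answer, Expr.eval, Op.eval, hreg 0 (by simp), hreg 1 (by simp), hreg 3 (by simp),
    hreg 4 (by simp)]
  -- For negative `k` or `l` the table has been computed from an absolute value and means nothing;
  -- the sign registers then force the answer `0`.
  by_cases hneg : k < 0 ∨ l < 0
  · rw [if_neg (not_coc_of_neg hneg)]
    rcases hneg with h | h <;> simp [instanceState, h]
  · push Not at hneg
    rw [Int.natAbs_of_nonneg hneg.1, Int.natAbs_of_nonneg hneg.2] at hcoc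
    simp only [hcoc]
    simp [instanceState, not_lt.2 hneg.1, not_lt.2 hneg.2]

end Cmd

end RAM

/-- Component Order Connectivity can be solved in `O(n^2)` time on interval graphs, on a machine with
words of `O(log (n + |k| + |l|))` bits. The answer is left in register `0`. -/
theorem mainTheorem12 :
    ∃ (p : RAM.Program) (c d : ℕ),
      ∀ (n : ℕ) (G : SimpleGraph (Fin n)) (k l : ℤ), IsIntervalGraph G →
        ∃ (t : ℕ) (s : RAM.State),
          RAM.Run ((n + k.natAbs + l.natAbs + 2) ^ d) p (instanceState G k l) t s ∧
          t ≤ c * (n ^ 2 + 1) ∧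
          (COC G k l → s.reg 0 = 1) ∧ (¬ COC G k l → s.reg 0 = 0) := by
  classical
  -- Well-formedness and loop depth at most two are properties of the program text and are checked
  -- by evaluation.
  obtain ⟨c, d, h⟩ := RAM.Cmd.solve.exists_run (by decide) (by decide) RAM.Cmd.answer
  refine ⟨.seq RAM.Cmd.solve.toProgram (.assign 0 RAM.Cmd.answer), c, d, fun n G k l hG => ?_⟩
  obtain ⟨t, hrun, ht⟩ := h n G k l
  have hans := RAM.Cmd.exec_solve hG k l
  refine ⟨t, _, hrun, ht, fun hc => ?_, fun hc => ?_⟩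
  · rw [RAM.State.setReg_reg, if_pos rfl, hans, if_pos hc]
  · rw [RAM.State.setReg_reg, if_pos rfl, hans, if_neg hc]
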